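/- All algebras are over $\mathbb C$, associative, not necessarily unital; $M(\cdot)$ denotes the multiplier algebra. A homomorphism $\gamma:P\to M(Q)$ is non-degenerate if $\gamma(P)Q=Q=Q\gamma(P)$ (linear spans); if $Q$ has a non-degenerate product, such a $\gamma$ extends uniquely to a homomorphism $M(P)\to M(Q)$, denoted by the same symbol. We use the Sweedler notation. Let $(A,\Delta)$ be an algebraic quantum group: a regular multiplier Hopf algebra (a non-degenerate algebra $A$ with a coassociative homomorphism $\Delta:A\to M(A\otimes A)$ for which the maps sending $a\otimes a'$ to $\Delta(a)(1\otimes a')$, $(a\otimes 1)\Delta(a')$, $\Delta(a)(a'\otimes 1)$ and $(1\otimes a)\Delta(a')$ are bijections from $A\otimes A$ to $A\otimes A$) with a fixed non-zero left integral $\varphi$, i.e. a linear functional with $(\iota\otimes\varphi)\Delta(a)=\varphi(a)1$ for all $a\in A$. Let $B=\widehat A=\{\varphi(\,\cdot\,c): c\in A\}$ be its dual, with pairing $\langle a,b\rangle=b(a)$, the product $\langle a,bb'\rangle=\langle\Delta(a),b\otimes b'\rangle$ and the actions $\langle b\triangleright a,b'\rangle=\langle a,b'b\rangle$ of $B$ on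 $A$ and $\langle a',a\triangleright b\rangle=\langle a'a,b\rangle$, $\langle a',b\triangleleft a\rangle=\langle aa',b\rangle$ of $A$ on $B$ and on the linear functionals on $A$. Pairings are extended to multipliers by $\langle y\triangleright x,n\rangle=\langle x,ny\rangle$. Let $AB$ be the Heisenberg algebra, i.e. the vector space $A\otimes B$ with the product $$(a\otimes b)(a'\otimes b')=\sum\langle a'_{(2)},b_{(1)}\rangle\,aa'_{(1)}\otimes b_{(2)}b'=\sum aa'_{(1)}\otimes(b\triangleleft a'_{(2)})b'.$$ **Proposition.** The algebras $B$ and $AB$ are non-degenerate. There is a unique homomorphism $\Delta:B\to M(B\otimes B)$ with $\langle a\otimes a',\Delta(b)\rangle=\langle aa',b\rangle$, a unique $V\in M(B\otimes A)$ with $\langle V,a\otimes b\rangle=\langle a,b\rangle$, and a unique pair of homomorphisms $j_A:A\to M(AB)$, $j_B:B\to M(AB)$ such that $j_A(a)(a'\otimes b')=aa'\otimes b'$ and $(a'\otimes b')j_B(b)=a'\otimes b'b$. The homomorphisms $j_A$ and $j_B$ are non-degenerate, and $j_A(a)j_B(b)=a\otimes b$. Identifying $A$ and $B$ with their images in $M(AB)$,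 we have, for all $a\in A$ and $b\in B$, $$\Delta(a)V=V(a\otimes 1)\ \text{ in } M(AB\otimes A)\qquad\text{and}\qquad V\Delta(b)=(1\otimes b)V\ \text{ in } M(B\otimes AB).$$ Moreover, each of these two families of identities is equivalent to the Heisenberg commutation relations: for every non-degenerate algebra $C$ and all non-degenerate homomorphisms $j_A:A\to M(C)$, $j_B:B\to M(C)$, the following are equivalent: 1. $(j_A\otimes\iota)(\Delta(a))\,(j_B\otimes\iota)(V)=(j_B\otimes\iota)(V)\,(j_A(a)\otimes 1)$ in $M(C\otimes A)$ for all $a\in A$; 2. $(\iota\otimes j_A)(V)\,(\iota\otimes j_B)(\Delta(b))=(1\otimes j_B(b))\,(\iota\otimes j_A)(V)$ in $M(B\otimes C)$ for all $b\in B$; 3. $j_B(b)j_A(a)=\sum\langle a_{(2)},b_{(1)}\rangle\,j_A(a_{(1)})j_B(b_{(2)})$ for all $a\in A$, $b\in B$, where both sides are multiplied by elements of $j_A(A)$ from the left and of $j_B(B)$ from the right. -/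

import Mathlib

open scoped TensorProduct

noncomputable section

set_option linter.unusedSectionVars false

namespace MultiplierHopf

universe u v w

section Algebras

variable (A : Type u) [NonUnitalRing A] [Module ℂ A] [IsScalarTower ℂ A A] [SMulCommClass ℂ A A]

/-- The product of `A` is non-degenerate. -/
def IsNondegenerate (A : Type u) [NonUnitalRing A] : Prop :=
  (∀ a : A, (∀ x : A, a * x = 0) → a = 0) ∧ (∀ a : A, (∀ x : A, x * a = 0) → a = 0)

/-- The multiplier algebra `M(A)`: pairs `(L, R)` of linear maps with `R(x) y = x L(y)`,
where `L(y)` is written `m y` and `R(x)` is written `x m`. Left parts compose in the usual order,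
right parts in the opposite order. -/
def multiplierAlgebra : Subalgebra ℂ (Module.End ℂ A × (Module.End ℂ A)ᵐᵒᵖ) where
  carrier := {m | ∀ x y : A, m.2.unop x * y = x * m.1 y}
  mul_mem' := by
    intro m n hm hn x y
    simp only [Set.mem_ofPred_eq] at hm hn
    simp [hm, hn]
  add_mem' := by
    intro m n hm hn x y
    simp only [Set.mem_ofPred_eq] at hm hn
    simp [hm, hn, add_mul, mul_add]
  algebraMap_mem' := by
    intro r x y
    simp [Prod.algebraMap_apply, Module.algebraMap_end_apply, MulOpposite.algebraMap_apply,
      smul_mul_assoc, mul_smul_comm]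

/-- The type of multipliers of `A`. -/
def Multiplier : Type u := multiplierAlgebra A

instance : Ring (Multiplier A) := inferInstanceAs (Ring (multiplierAlgebra A))

instance : Algebra ℂ (Multiplier A) := inferInstanceAs (Algebra ℂ (multiplierAlgebra A))

end Algebras

namespace Multiplier

variable {A : Type u} [NonUnitalRing A] [Module ℂ A] [IsScalarTower ℂ A A] [SMulCommClass ℂ A A]
variable {C : Type v} [NonUnitalRing C] [Module ℂ C] [IsScalarTower ℂ C C] [SMulCommClass ℂ C C]
variable {D : Type w} [NonUnitalRing D] [Module ℂ D] [IsScalarTower ℂ D D] [SMulCommClass ℂ D D]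

/-- The map `x ↦ m x`. -/
def left (m : Multiplier A) : A →ₗ[ℂ] A := m.1.1

/-- The map `x ↦ x m`. -/
def right (m : Multiplier A) : A →ₗ[ℂ] A := m.1.2.unop

theorem central (m : Multiplier A) (x y : A) : right m x * y = x * left m y := m.2 x y

/-- The multiplier with given left and right parts. -/
def mk (L R : A →ₗ[ℂ] A) (h : ∀ x y, R x * y = x * L y) : Multiplier A :=
  ⟨(L, MulOpposite.op R), h⟩

@[simp] theorem left_mk (L R : A →ₗ[ℂ] A) (h : ∀ x y, R x * y = x * L y) :
    left (mk L R h) = L := rfl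
@[simp] theorem right_mk (L R : A →ₗ[ℂ] A) (h : ∀ x y, R x * y = x * L y) :
    right (mk L R h) = R := rfl
@[simp] theorem left_mul (m n : Multiplier A) (x : A) : left (m * n) x = left m (left n x) := rfl
@[simp] theorem right_mul (m n : Multiplier A) (x : A) :
    right (m * n) x = right n (right m x) := rfl
@[simp] theorem left_one (x : A) : left (1 : Multiplier A) x = x := rfl
@[simp] theorem right_one (x : A) : right (1 : Multiplier A) x = x := rfl
@[simp] theorem left_add (m n : Multiplier A) : left (m + n) = left m + left n := rfl
@[simp] theorem right_add (m n : Multiplier A) : right (m + n) = right m + right n := rfl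
@[simp] theorem left_smul (r : ℂ) (m : Multiplier A) : left (r • m) = r • left m := rfl
@[simp] theorem right_smul (r : ℂ) (m : Multiplier A) : right (r • m) = r • right m := rfl

theorem ext' {m n : Multiplier A} (hl : ∀ x, left m x = left n x)
    (hr : ∀ x, right m x = right n x) : m = n := by
  apply Subtype.ext
  apply Prod.ext
  · exact LinearMap.ext hl
  · exact MulOpposite.unop_injective (LinearMap.ext hr)

/-- The canonical map `A → M(A)`. -/
def of (a : A) : Multiplier A :=
  mk (LinearMap.mulLeft ℂ a) (LinearMap.mulRight ℂ a) (by simp [mul_assoc])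

@[simp] theorem left_of (a x : A) : left (of a) x = a * x := rfl
@[simp] theorem right_of (a x : A) : right (of a) x = x * a := rfl

variable (A) in
/-- The canonical map `A → M(A)` as a homomorphism. -/
def ofHom : A →ₙₐ[ℂ] Multiplier A where
  toFun := of
  map_smul' r a := ext' (fun x => smul_mul_assoc r a x) (fun x => mul_smul_comm r x a)
  map_zero' := ext' (fun x => zero_mul x) (fun x => mul_zero x)
  map_add' a b := ext' (fun x => add_mul a b x) (fun x => mul_add x a b)
  map_mul' a b := ext' (fun x => mul_assoc a b x) (fun x => (mul_assoc x a b).symm)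

@[simp] theorem ofHom_apply (a : A) : ofHom A a = of a := rfl

theorem of_injective (hA : IsNondegenerate A) : Function.Injective (of : A → Multiplier A) := by
  intro a b h
  rw [← sub_eq_zero]
  apply hA.1
  intro x
  have := congrArg (fun m => left m x) h
  have h' : a * x = b * x := this
  rw [sub_mul, h', sub_self]

theorem left_mul_right (hA : IsNondegenerate A) (m : Multiplier A) (x y : A) :
    left m (x * y) = left m x * y := by
  rw [← sub_eq_zero]
  apply hA.2
  intro z
  rw [mul_sub, ← central, ← mul_assoc, ← mul_assoc, ← central, sub_self]

theorem right_mul_left (hA : IsNondegenerate A) (m : Multiplier A) (x y : A) :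
    right m (x * y) = x * right m y := by
  rw [← sub_eq_zero]
  apply hA.1
  intro z
  rw [sub_mul, central, mul_assoc, mul_assoc, central, sub_self]

theorem mul_of (hA : IsNondegenerate A) (m : Multiplier A) (x : A) : m * of x = of (left m x) :=
  ext' (fun y => by simp [left_mul_right hA]) (fun y => by simp [central])

theorem of_mul (hA : IsNondegenerate A) (m : Multiplier A) (x : A) : of x * m = of (right m x) :=
  ext' (fun y => by simp [central]) (fun y => by simp [right_mul_left hA])

theorem ext_left (hA : IsNondegenerate A) {m n : Multiplier A} (h : ∀ x, left m x = left n x) :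
    m = n := by
  refine ext' h fun x => ?_
  rw [← sub_eq_zero]
  apply hA.1
  intro y
  rw [sub_mul, central, central, h, sub_self]

/-- The element `m ⊗ n` of `M(C ⊗ D)` for `m` in `M(C)` and `n` in `M(D)`. -/
def tmul (m : Multiplier C) (n : Multiplier D) : Multiplier (C ⊗[ℂ] D) :=
  mk (TensorProduct.map (left m) (left n)) (TensorProduct.map (right m) (right n)) (by
    intro x y
    induction x with
    | zero => simp
    | add x₁ x₂ h₁ h₂ => simp [add_mul, h₁, h₂]
    | tmul c d =>
      induction y with
      | zero => simp
      | add y₁ y₂ h₁ h₂ => simp only [mul_add, map_add, h₁, h₂]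
      | tmul c' d' => simp [central])

@[simp] theorem left_tmul (m : Multiplier C) (n : Multiplier D) :
    left (tmul m n) = TensorProduct.map (left m) (left n) := rfl
@[simp] theorem right_tmul (m : Multiplier C) (n : Multiplier D) :
    right (tmul m n) = TensorProduct.map (right m) (right n) := rfl

theorem tmul_mul_tmul (m m' : Multiplier C) (n n' : Multiplier D) :
    tmul m n * tmul m' n' = tmul (m * m') (n * n') := by
  apply ext'
  · intro x
    induction x with
    | zero => simp
    | add x₁ x₂ h₁ h₂ => rw [map_add, map_add, h₁, h₂]
    | tmul c d => simp
  · intro x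
    induction x with
    | zero => simp
    | add x₁ x₂ h₁ h₂ => rw [map_add, map_add, h₁, h₂]
    | tmul c d => simp

theorem of_tmul (c : C) (d : D) : of (c ⊗ₜ[ℂ] d) = tmul (of c) (of d) := by
  apply ext'
  · intro x
    induction x with
    | zero => simp
    | add x₁ x₂ h₁ h₂ => rw [map_add, map_add, h₁, h₂]
    | tmul c d => simp
  · intro x
    induction x with
    | zero => simp
    | add x₁ x₂ h₁ h₂ => rw [map_add, map_add, h₁, h₂]
    | tmul c d => simp

/-- `m ⊗ n` as a bilinear map in `m` and `n`. -/
def tmulₗ : Multiplier C →ₗ[ℂ] Multiplier D →ₗ[ℂ] Multiplier (C ⊗[ℂ] D) :=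
  LinearMap.mk₂ ℂ tmul
    (fun m m' n => ext' (fun x => by simp [TensorProduct.map_add_left])
      (fun x => by simp [TensorProduct.map_add_left]))
    (fun r m n => ext' (fun x => by simp [TensorProduct.map_smul_left])
      (fun x => by simp [TensorProduct.map_smul_left]))
    (fun m n n' => ext' (fun x => by simp [TensorProduct.map_add_right])
      (fun x => by simp [TensorProduct.map_add_right]))
    (fun r m n => ext' (fun x => by simp [TensorProduct.map_smul_right])
      (fun x => by simp [TensorProduct.map_smul_right]))

end Multiplier

open Multiplier

section Extension

variable {P : Type u} [NonUnitalRing P] [Module ℂ P] [IsScalarTower ℂ P P] [SMulCommClass ℂ P P]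
variable {Q : Type v} [NonUnitalRing Q] [Module ℂ Q] [IsScalarTower ℂ Q Q] [SMulCommClass ℂ Q Q]

/-- A homomorphism `γ : P → M(Q)` is non-degenerate if `γ(P) Q = Q = Q γ(P)` (linear spans). -/
def IsNondegenerateHom (γ : P →ₙₐ[ℂ] Multiplier Q) : Prop :=
  Submodule.span ℂ {y : Q | ∃ p x, y = left (γ p) x} = ⊤ ∧
  Submodule.span ℂ {y : Q | ∃ p x, y = right (γ p) x} = ⊤

/-- `n ∈ M(Q)` is the image of `m ∈ M(P)` under the extension of `γ : P → M(Q)` to `M(P)`. -/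
def IsExtension (γ : P →ₙₐ[ℂ] Multiplier Q) (m : Multiplier P) (n : Multiplier Q) : Prop :=
  ∀ p : P, n * γ p = γ (left m p) ∧ γ p * n = γ (right m p)

theorem IsExtension.unique {γ : P →ₙₐ[ℂ] Multiplier Q} (hγ : IsNondegenerateHom γ)
    {m : Multiplier P} {n n' : Multiplier Q} (h : IsExtension γ m n) (h' : IsExtension γ m n') :
    n = n' := by
  apply ext'
  · have : left n = left n' := by
      refine LinearMap.ext_on hγ.1 ?_
      rintro _ ⟨p, x, rfl⟩
      rw [← left_mul, ← left_mul, (h p).1, (h' p).1]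
    simp [this]
  · have : right n = right n' := by
      refine LinearMap.ext_on hγ.2 ?_
      rintro _ ⟨p, x, rfl⟩
      rw [← right_mul, ← right_mul, (h p).2, (h' p).2]
    simp [this]

theorem exists_isExtension (hQ : IsNondegenerate Q) {γ : P →ₙₐ[ℂ] Multiplier Q}
    (hγ : IsNondegenerateHom γ) (m : Multiplier P) : ∃ n, IsExtension γ m n := by
  -- the two maps `P ⊗ Q → Q` and their twisted versions
  let actL : P ⊗[ℂ] Q →ₗ[ℂ] Q := TensorProduct.lift (LinearMap.mk₂ ℂ (fun p x => left (γ p) x)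
    (by simp) (by simp) (by simp) (by simp))
  let actR : P ⊗[ℂ] Q →ₗ[ℂ] Q := TensorProduct.lift (LinearMap.mk₂ ℂ (fun p x => right (γ p) x)
    (by simp) (by simp) (by simp) (by simp))
  have surjL : Function.Surjective actL := by
    rw [← LinearMap.range_eq_top, eq_top_iff, ← hγ.1, Submodule.span_le]
    rintro _ ⟨p, x, rfl⟩
    exact ⟨p ⊗ₜ x, by simp [actL]⟩
  have surjR : Function.Surjective actR := by
    rw [← LinearMap.range_eq_top, eq_top_iff, ← hγ.2, Submodule.span_le]
    rintro _ ⟨p, x, rfl⟩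
    exact ⟨p ⊗ₜ x, by simp [actR]⟩
  have key : ∀ s t, actR (TensorProduct.map (right m) LinearMap.id s) * actL t =
      actR s * actL (TensorProduct.map (left m) LinearMap.id t) := by
    intro s t
    induction s with
    | zero => simp
    | add s₁ s₂ h₁ h₂ => simp only [map_add, add_mul, h₁, h₂]
    | tmul p x =>
      induction t with
      | zero => simp
      | add t₁ t₂ h₁ h₂ => simp only [map_add, mul_add, h₁, h₂]
      | tmul q y =>
        simp only [TensorProduct.map_tmul, LinearMap.id_coe, id_eq, TensorProduct.lift.tmul,
          LinearMap.mk₂_apply, actR, actL]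
        rw [central, central, ← left_mul, ← left_mul, ← map_mul, ← map_mul, central]
  let gL := (LinearMap.ker actL).liftQ (actL ∘ₗ TensorProduct.map (left m) LinearMap.id) (by
    intro t ht
    rw [LinearMap.mem_ker] at ht ⊢
    apply hQ.2
    intro z
    obtain ⟨s, rfl⟩ := surjR z
    rw [LinearMap.comp_apply, ← key, ht, mul_zero])
  let gR := (LinearMap.ker actR).liftQ (actR ∘ₗ TensorProduct.map (right m) LinearMap.id) (by
    intro t ht
    rw [LinearMap.mem_ker] at ht ⊢
    apply hQ.1
    intro z
    obtain ⟨s, rfl⟩ := surjL z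
    rw [LinearMap.comp_apply, key, ht, zero_mul])
  let L : Q →ₗ[ℂ] Q := gL ∘ₗ (actL.quotKerEquivOfSurjective surjL).symm.toLinearMap
  let R : Q →ₗ[ℂ] Q := gR ∘ₗ (actR.quotKerEquivOfSurjective surjR).symm.toLinearMap
  have hL : ∀ t, L (actL t) = actL (TensorProduct.map (left m) LinearMap.id t) := by
    intro t
    have : (actL.quotKerEquivOfSurjective surjL).symm (actL t) = Submodule.Quotient.mk t := by
      rw [LinearEquiv.symm_apply_eq]; rfl
    simp only [L, LinearMap.comp_apply, LinearEquiv.coe_coe, this]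
    rfl
  have hR : ∀ t, R (actR t) = actR (TensorProduct.map (right m) LinearMap.id t) := by
    intro t
    have : (actR.quotKerEquivOfSurjective surjR).symm (actR t) = Submodule.Quotient.mk t := by
      rw [LinearEquiv.symm_apply_eq]; rfl
    simp only [R, LinearMap.comp_apply, LinearEquiv.coe_coe, this]
    rfl
  have hc : ∀ x y, R x * y = x * L y := by
    intro x y
    obtain ⟨s, rfl⟩ := surjR x
    obtain ⟨t, rfl⟩ := surjL y
    rw [hL, hR, key]
  refine ⟨mk L R hc, fun p => ⟨?_, ?_⟩⟩
  · refine ext_left hQ fun x => ?_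
    have := hL (p ⊗ₜ x)
    simpa [actL] using this
  · have hr : ∀ x, right (γ p * mk L R hc) x = right (γ (right m p)) x := fun x => by
      have := hR (p ⊗ₜ x)
      simpa [actR] using this
    refine ext_left hQ fun x => ?_
    rw [← sub_eq_zero]
    apply hQ.2
    intro z
    rw [mul_sub, ← central, ← central, hr, sub_self]

open Classical in
/-- The extension of `γ : P → M(Q)` to `M(P) → M(Q)`. For a non-degenerate homomorphism `γ` and a
non-degenerate algebra `Q`, it is the unique one, see `extend_spec`. -/
def extend (γ : P →ₙₐ[ℂ] Multiplier Q) (m : Multiplier P) : Multiplier Q :=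
  if h : ∃ n, IsExtension γ m n then h.choose else 0

theorem extend_spec (hQ : IsNondegenerate Q) {γ : P →ₙₐ[ℂ] Multiplier Q}
    (hγ : IsNondegenerateHom γ) (m : Multiplier P) : IsExtension γ m (extend γ m) := by
  have h := exists_isExtension hQ hγ m
  rw [extend, dif_pos h]
  exact h.choose_spec

end Extension

section TensorHom

variable {P : Type*} [NonUnitalRing P] [Module ℂ P] [IsScalarTower ℂ P P] [SMulCommClass ℂ P P]
variable {Q : Type*} [NonUnitalRing Q] [Module ℂ Q] [IsScalarTower ℂ Q Q] [SMulCommClass ℂ Q Q]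
variable {C : Type*} [NonUnitalRing C] [Module ℂ C] [IsScalarTower ℂ C C] [SMulCommClass ℂ C C]
variable {D : Type*} [NonUnitalRing D] [Module ℂ D] [IsScalarTower ℂ D D] [SMulCommClass ℂ D D]

/-- The homomorphism `α ⊗ β : P ⊗ Q → M(C ⊗ D)` for `α : P → M(C)` and `β : Q → M(D)`. -/
def tensorHom (α : P →ₙₐ[ℂ] Multiplier C) (β : Q →ₙₐ[ℂ] Multiplier D) :
    P ⊗[ℂ] Q →ₙₐ[ℂ] Multiplier (C ⊗[ℂ] D) :=
  { TensorProduct.lift (tmulₗ.compl₁₂ (α : P →ₗ[ℂ] Multiplier C) (β : Q →ₗ[ℂ] Multiplier D)) with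
    map_zero' := map_zero _
    map_mul' := by
      intro x y
      change TensorProduct.lift _ (x * y) = TensorProduct.lift _ x * TensorProduct.lift _ y
      induction x with
      | zero => simp
      | add x₁ x₂ h₁ h₂ => rw [add_mul, map_add, h₁, h₂, map_add, add_mul]
      | tmul c d =>
        induction y with
        | zero => simp
        | add y₁ y₂ h₁ h₂ => rw [mul_add, map_add, h₁, h₂, map_add, mul_add]
        | tmul c' d' => simp [tmulₗ, tmul_mul_tmul] }

@[simp] theorem tensorHom_tmul (α : P →ₙₐ[ℂ] Multiplier C) (β : Q →ₙₐ[ℂ] Multiplier D)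
    (p : P) (q : Q) : tensorHom α β (p ⊗ₜ q) = tmul (α p) (β q) := rfl

theorem tensorHom_nondegenerate {α : P →ₙₐ[ℂ] Multiplier C} {β : Q →ₙₐ[ℂ] Multiplier D}
    (hα : IsNondegenerateHom α) (hβ : IsNondegenerateHom β) :
    IsNondegenerateHom (tensorHom α β) := by
  have aux : ∀ (f : P → C → C) (g : Q → D → D) (S : Submodule ℂ (C ⊗[ℂ] D)),
      Submodule.span ℂ {y | ∃ p x, y = f p x} = ⊤ → Submodule.span ℂ {y | ∃ p x, y = g p x} = ⊤ →
      (∀ p q x y, f p x ⊗ₜ g q y ∈ S) → S = ⊤ := by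
    intro f g S hf hg h
    rw [eq_top_iff, ← TensorProduct.span_tmul_eq_top, Submodule.span_le]
    rintro _ ⟨c, d, rfl⟩
    have hc : c ∈ Submodule.span ℂ {y | ∃ p x, y = f p x} := hf ▸ Submodule.mem_top
    have hd : d ∈ Submodule.span ℂ {y | ∃ p x, y = g p x} := hg ▸ Submodule.mem_top
    induction hc using Submodule.span_induction with
    | zero => simp
    | add x y _ _ h₁ h₂ => rw [TensorProduct.add_tmul]; exact S.add_mem h₁ h₂
    | smul r x _ h₁ => rw [← TensorProduct.smul_tmul']; exact S.smul_mem r h₁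
    | mem x hx =>
      obtain ⟨p, x, rfl⟩ := hx
      induction hd using Submodule.span_induction with
      | zero => simp
      | add x y _ _ h₁ h₂ => rw [TensorProduct.tmul_add]; exact S.add_mem h₁ h₂
      | smul r x _ h₁ => rw [TensorProduct.tmul_smul]; exact S.smul_mem r h₁
      | mem y hy =>
        obtain ⟨q, y, rfl⟩ := hy
        exact h p q x y
  refine ⟨aux _ _ _ hα.1 hβ.1 ?_, aux _ _ _ hα.2 hβ.2 ?_⟩
  · intro p q x y
    exact Submodule.subset_span ⟨p ⊗ₜ q, x ⊗ₜ y, by simp⟩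
  · intro p q x y
    exact Submodule.subset_span ⟨p ⊗ₜ q, x ⊗ₜ y, by simp⟩

end TensorHom

/-- The slice map `ι ⊗ ω : X ⊗ Y → X` for a linear functional `ω` on `Y`. -/
def slice {X Y : Type*} [AddCommGroup X] [Module ℂ X] [AddCommGroup Y] [Module ℂ Y]
    (ω : Y →ₗ[ℂ] ℂ) : X ⊗[ℂ] Y →ₗ[ℂ] X :=
  (TensorProduct.rid ℂ X).toLinearMap ∘ₗ LinearMap.lTensor X ω

section Slice

variable {X Y : Type*} [AddCommGroup X] [Module ℂ X] [AddCommGroup Y] [Module ℂ Y]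

@[simp] theorem slice_tmul (ω : Y →ₗ[ℂ] ℂ) (x : X) (y : Y) : slice ω (x ⊗ₜ[ℂ] y) = ω y • x := by
  simp [slice]

theorem eq_zero_of_slice {t : X ⊗[ℂ] Y} (h : ∀ ω : Y →ₗ[ℂ] ℂ, slice ω t = 0) : t = 0 := by
  classical
  let b := Module.Basis.ofVectorSpace ℂ Y
  apply (TensorProduct.equivFinsuppOfBasisRight (M := X) b).injective
  ext i
  rw [TensorProduct.equivFinsuppOfBasisRight_apply]
  simpa [slice] using h (b.coord i)

theorem slice_map {X' Y' : Type*} [AddCommGroup X'] [Module ℂ X'] [AddCommGroup Y'] [Module ℂ Y']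
    (f : X →ₗ[ℂ] X') (g : Y →ₗ[ℂ] Y') (ω : Y' →ₗ[ℂ] ℂ) (t : X ⊗[ℂ] Y) :
    slice ω (TensorProduct.map f g t) = f (slice (ω ∘ₗ g) t) := by
  induction t with
  | zero => simp
  | add x y h₁ h₂ => simp [h₁, h₂]
  | tmul x y => simp

end Slice

theorem IsNondegenerate.tensor {C D : Type*}
    [NonUnitalRing C] [Module ℂ C] [IsScalarTower ℂ C C] [SMulCommClass ℂ C C]
    [NonUnitalRing D] [Module ℂ D] [IsScalarTower ℂ D D] [SMulCommClass ℂ D D]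
    (hC : IsNondegenerate C) (hD : IsNondegenerate D) : IsNondegenerate (C ⊗[ℂ] D) := by
  have aux : ∀ (f : C → C →ₗ[ℂ] C) (g : D → D →ₗ[ℂ] D), (∀ c, (∀ x, f x c = 0) → c = 0) →
      (∀ d, (∀ y, g y d = 0) → d = 0) → ∀ t : C ⊗[ℂ] D,
      (∀ x y, TensorProduct.map (f x) (g y) t = 0) → t = 0 := by
    intro f g hf hg t ht
    have h1 : ∀ y, TensorProduct.map LinearMap.id (g y) t = 0 := by
      intro y
      refine eq_zero_of_slice fun ω => hf _ fun x => ?_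
      rw [slice_map, LinearMap.id_apply, ← slice_map, ht, map_zero]
    have h2 : TensorProduct.comm ℂ C D t = 0 := by
      refine eq_zero_of_slice fun ω => hg _ fun y => ?_
      have := slice_map (g y) LinearMap.id ω (TensorProduct.comm ℂ C D t)
      rw [LinearMap.comp_id] at this
      rw [← this, TensorProduct.map_comm, h1, map_zero, map_zero]
    simpa using h2
  refine ⟨fun t ht => ?_, fun t ht => ?_⟩
  · refine aux (fun x => LinearMap.mulRight ℂ x) (fun y => LinearMap.mulRight ℂ y)
      (fun c h => hC.1 c h) (fun d h => hD.1 d h) t fun x y => ?_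
    rw [← ht (x ⊗ₜ y)]
    exact congrArg (fun m => right m t) (of_tmul x y).symm
  · refine aux (fun x => LinearMap.mulLeft ℂ x) (fun y => LinearMap.mulLeft ℂ y)
      (fun c h => hC.2 c h) (fun d h => hD.2 d h) t fun x y => ?_
    rw [← ht (x ⊗ₜ y)]
    exact congrArg (fun m => left m t) (of_tmul x y).symm

/-- A regular multiplier Hopf algebra over `ℂ`: an algebra `A` with non-degenerate product and a
coproduct, that is, a coassociative homomorphism `Δ : A → M(A ⊗ A)`, such that the four canonical
maps `a ⊗ b ↦ Δ(a)(1 ⊗ b)`, `(a ⊗ 1)Δ(b)`, `Δ(a)(b ⊗ 1)`, `(1 ⊗ a)Δ(b)` have values in `A ⊗ A`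
and are bijective from `A ⊗ A` to itself. -/
structure RegularMultiplierHopfAlgebra (A : Type u) [NonUnitalRing A] [Module ℂ A]
    [IsScalarTower ℂ A A] [SMulCommClass ℂ A A] where
  nondegenerate : IsNondegenerate A
  /-- the coproduct -/
  Δ : A →ₙₐ[ℂ] Multiplier (A ⊗[ℂ] A)
  /-- `a ⊗ b ↦ Δ(a)(1 ⊗ b)` -/
  T₁ : A ⊗[ℂ] A ≃ₗ[ℂ] A ⊗[ℂ] A
  T₁_spec : ∀ a b : A, of (T₁ (a ⊗ₜ b)) = Δ a * tmul 1 (of b)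
  /-- `a ⊗ b ↦ (a ⊗ 1)Δ(b)` -/
  T₂ : A ⊗[ℂ] A ≃ₗ[ℂ] A ⊗[ℂ] A
  T₂_spec : ∀ a b : A, of (T₂ (a ⊗ₜ b)) = tmul (of a) 1 * Δ b
  /-- `a ⊗ b ↦ Δ(a)(b ⊗ 1)` -/
  T₃ : A ⊗[ℂ] A ≃ₗ[ℂ] A ⊗[ℂ] A
  T₃_spec : ∀ a b : A, of (T₃ (a ⊗ₜ b)) = Δ a * tmul (of b) 1
  /-- `a ⊗ b ↦ (1 ⊗ a)Δ(b)` -/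
  T₄ : A ⊗[ℂ] A ≃ₗ[ℂ] A ⊗[ℂ] A
  T₄_spec : ∀ a b : A, of (T₄ (a ⊗ₜ b)) = tmul 1 (of a) * Δ b
  /-- `(a ⊗ 1 ⊗ 1)(Δ ⊗ ι)(Δ(b)(1 ⊗ c)) = (ι ⊗ Δ)((a ⊗ 1)Δ(b))(1 ⊗ 1 ⊗ c)` -/
  coassoc : ∀ a b c : A,
    LinearMap.rTensor A T₂.toLinearMap ((TensorProduct.assoc ℂ A A A).symm (a ⊗ₜ T₁ (b ⊗ₜ c))) =
      (TensorProduct.assoc ℂ A A A).symm (LinearMap.lTensor A T₁.toLinearMap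
        (TensorProduct.assoc ℂ A A A (T₂ (a ⊗ₜ b) ⊗ₜ c)))

/-- An algebraic quantum group: a regular multiplier Hopf algebra with a non-zero left integral,
which is fixed. Left invariance is the equality `(ι ⊗ φ)Δ(a) = φ(a) 1` in `M(A)`. -/
structure AlgebraicQuantumGroup (A : Type u) [NonUnitalRing A] [Module ℂ A]
    [IsScalarTower ℂ A A] [SMulCommClass ℂ A A] extends RegularMultiplierHopfAlgebra A where
  /-- the left integral -/
  φ : A →ₗ[ℂ] ℂ
  φ_ne_zero : φ ≠ 0
  left_invariant : ∀ a x : A, slice φ (T₃ (a ⊗ₜ x)) = φ a • x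
  left_invariant' : ∀ a x : A, slice φ (T₂ (x ⊗ₜ a)) = φ a • x

namespace RegularMultiplierHopfAlgebra

variable {A : Type u} [NonUnitalRing A] [Module ℂ A] [IsScalarTower ℂ A A] [SMulCommClass ℂ A A]
variable (H : RegularMultiplierHopfAlgebra A)

theorem nondeg2 (H : RegularMultiplierHopfAlgebra A) : IsNondegenerate (A ⊗[ℂ] A) :=
  H.nondegenerate.tensor H.nondegenerate

theorem mulLeft_T₁ (e a c : A) :
    TensorProduct.map (LinearMap.mulLeft ℂ e) LinearMap.id (H.T₁ (a ⊗ₜ c)) =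
      TensorProduct.map LinearMap.id (LinearMap.mulRight ℂ c) (H.T₂ (e ⊗ₜ a)) := by
  apply of_injective H.nondeg2
  have h1 := mul_of H.nondeg2 (tmul (of e) 1) (H.T₁ (a ⊗ₜ c))
  have h2 := of_mul H.nondeg2 (tmul 1 (of c)) (H.T₂ (e ⊗ₜ a))
  rw [H.T₁_spec, ← mul_assoc, ← H.T₂_spec, h2] at h1
  exact h1.symm

theorem mulRight_T₁ (a c d : A) :
    TensorProduct.map (LinearMap.mulRight ℂ c) LinearMap.id (H.T₁ (a ⊗ₜ d)) =
      left (H.Δ a) (c ⊗ₜ d) := by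
  apply of_injective H.nondeg2
  rw [← mul_of H.nondeg2, of_tmul]
  have h2 := of_mul H.nondeg2 (tmul (of c) 1) (H.T₁ (a ⊗ₜ d))
  refine h2.symm.trans ?_
  rw [H.T₁_spec, mul_assoc, tmul_mul_tmul, one_mul, mul_one]

theorem left_T₃ (x p q : A) : left (H.Δ x) (H.T₃ (p ⊗ₜ q)) = H.T₃ ((x * p) ⊗ₜ q) := by
  apply of_injective H.nondeg2
  rw [← mul_of H.nondeg2, H.T₃_spec, H.T₃_spec, map_mul, mul_assoc]

theorem right_T₂ (a a' y : A) : right (H.Δ y) (H.T₂ (a ⊗ₜ a')) = H.T₂ (a ⊗ₜ (a' * y)) := by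
  apply of_injective H.nondeg2
  rw [← of_mul H.nondeg2, H.T₂_spec, H.T₂_spec, map_mul, mul_assoc]

theorem right_tmul_eq (p q y : A) : right (H.Δ y) (p ⊗ₜ q) =
    TensorProduct.map LinearMap.id (LinearMap.mulLeft ℂ q) (H.T₂ (p ⊗ₜ y)) := by
  apply of_injective H.nondeg2
  rw [← of_mul H.nondeg2, of_tmul]
  have h := mul_of H.nondeg2 (tmul 1 (of q)) (H.T₂ (p ⊗ₜ y))
  refine Eq.trans ?_ h
  rw [H.T₂_spec, ← mul_assoc, tmul_mul_tmul, one_mul, mul_one]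

theorem mulRight_T₂ (p y z : A) :
    TensorProduct.map (LinearMap.mulRight ℂ z) LinearMap.id (H.T₂ (p ⊗ₜ y)) =
      TensorProduct.map (LinearMap.mulLeft ℂ p) LinearMap.id (H.T₃ (y ⊗ₜ z)) := by
  apply of_injective H.nondeg2
  have h1 := mul_of H.nondeg2 (tmul (of p) 1) (H.T₃ (y ⊗ₜ z))
  have h2 := of_mul H.nondeg2 (tmul (of z) 1) (H.T₂ (p ⊗ₜ y))
  rw [H.T₃_spec, ← mul_assoc, ← H.T₂_spec, h2] at h1
  exact h1

end RegularMultiplierHopfAlgebra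

namespace AlgebraicQuantumGroup

variable {A : Type u} [NonUnitalRing A] [Module ℂ A] [IsScalarTower ℂ A A] [SMulCommClass ℂ A A]
variable (H : AlgebraicQuantumGroup A)

/-- The map `c ↦ φ(· c)` from `A` to its linear dual. -/
def fourier : A →ₗ[ℂ] Module.Dual ℂ A where
  toFun c := H.φ ∘ₗ LinearMap.mulRight ℂ c
  map_add' c d := by ext; simp [mul_add]
  map_smul' r c := by ext; simp [mul_smul_comm]

@[simp] theorem fourier_apply (c x : A) : H.fourier c x = H.φ (x * c) := rfl

/-- The dual `B = Â`: the space of all functionals `φ(· c)` with `c ∈ A`. -/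
def Dual : Type u := LinearMap.range H.fourier

instance : AddCommGroup H.Dual := inferInstanceAs (AddCommGroup (LinearMap.range H.fourier))

instance : Module ℂ H.Dual := inferInstanceAs (Module ℂ (LinearMap.range H.fourier))

/-- The inclusion of `B` in the dual space of `A`; thus `⟨a, b⟩ = H.eval b a`. -/
def eval : H.Dual →ₗ[ℂ] Module.Dual ℂ A := (LinearMap.range H.fourier).subtype

/-- The element `φ(· c)` of `B`. -/
def toDual : A →ₗ[ℂ] H.Dual := H.fourier.rangeRestrict

@[simp] theorem eval_toDual (c x : A) : H.eval (H.toDual c) x = H.φ (x * c) := rfl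

theorem toDual_surjective : Function.Surjective H.toDual := LinearMap.surjective_rangeRestrict _

theorem eval_injective : Function.Injective H.eval := Subtype.coe_injective

theorem dual_ext {b b' : H.Dual} (h : ∀ x, H.eval b x = H.eval b' x) : b = b' :=
  H.eval_injective (LinearMap.ext h)

/-- A functional of the form `φ(· c)` as an element of `B`. -/
def ofRange (f : Module.Dual ℂ A) (h : ∃ c, H.fourier c = f) : H.Dual := ⟨f, h⟩

@[simp] theorem eval_ofRange (f : Module.Dual ℂ A) (h : ∃ c, H.fourier c = f) :
    H.eval (H.ofRange f h) = f := rfl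

/-- The map `c ↦ (a ↦ (ι ⊗ φ)(Δ(a)(1 ⊗ c)))`. -/
def actAux : A →ₗ[ℂ] A →ₗ[ℂ] A :=
  LinearMap.mk₂ ℂ (fun c a => slice H.φ (H.T₁ (a ⊗ₜ c)))
    (by intros; simp [TensorProduct.tmul_add]) (by intros; simp)
    (by intros; simp [TensorProduct.add_tmul]) (by intros; simp [← TensorProduct.smul_tmul'])

theorem mul_actAux (c a e : A) :
    e * H.actAux c a = slice (H.fourier c) (H.T₂ (e ⊗ₜ a)) := by
  have h1 := slice_map (LinearMap.mulLeft ℂ e) LinearMap.id H.φ (H.T₁ (a ⊗ₜ c))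
  rw [H.mulLeft_T₁, slice_map] at h1
  exact h1.symm

theorem ker_fourier_le : LinearMap.ker H.fourier ≤ LinearMap.ker H.actAux := by
  intro c hc
  rw [LinearMap.mem_ker] at hc ⊢
  ext a
  apply H.nondegenerate.2
  intro e
  rw [mul_actAux, hc]
  simp [slice]

/-- The left action of `B` on `A`: `b ▷ a = (ι ⊗ ⟨·, b⟩)Δ(a)`, that is,
`b ▷ a = (ι ⊗ φ)(Δ(a)(1 ⊗ c))` for `b = φ(· c)`. -/
def act : H.Dual →ₗ[ℂ] A →ₗ[ℂ] A :=
  (LinearMap.ker H.fourier).liftQ H.actAux H.ker_fourier_le ∘ₗ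
    H.fourier.quotKerEquivRange.symm.toLinearMap

theorem act_toDual (c a : A) : H.act (H.toDual c) a = slice H.φ (H.T₁ (a ⊗ₜ c)) := by
  have h1 : H.fourier.quotKerEquivRange.symm (H.fourier.rangeRestrict c) =
      Submodule.Quotient.mk c := by
    rw [LinearEquiv.symm_apply_eq]; rfl
  exact LinearMap.congr_fun
    (congrArg ((LinearMap.ker H.fourier).liftQ H.actAux H.ker_fourier_le) h1) a

/-- `e (b ▷ a) = (ι ⊗ ⟨·, b⟩)((e ⊗ 1)Δ(a))`. -/
theorem mul_act (b : H.Dual) (a e : A) :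
    e * H.act b a = slice (H.eval b) (H.T₂ (e ⊗ₜ a)) := by
  obtain ⟨c, rfl⟩ := H.toDual_surjective b
  rw [act_toDual]
  exact H.mul_actAux c a e

theorem act_mul (s : A ⊗[ℂ] A) (x c c' : A) (hs : H.T₃ s = c ⊗ₜ c') :
    H.act (H.toDual c') x * c = TensorProduct.lid ℂ A
      (TensorProduct.map (H.φ ∘ₗ LinearMap.mulLeft ℂ x) LinearMap.id s) := by
  have h1 := slice_map (LinearMap.mulRight ℂ c) LinearMap.id H.φ (H.T₁ (x ⊗ₜ c'))
  rw [H.mulRight_T₁, ← hs] at h1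
  rw [act_toDual]
  refine h1.symm.trans ?_
  clear h1 hs
  induction s with
  | zero => simp
  | add s₁ s₂ h₁ h₂ => simp only [map_add, h₁, h₂]
  | tmul p q => simp [H.left_T₃, H.left_invariant]

theorem mul_mem (f : A →ₗ[ℂ] A) (b b' : H.Dual) (hf : ∃ a, f = LinearMap.mulLeft ℂ a ∨ f = 1) :
    ∃ d, H.fourier d = H.eval b ∘ₗ f ∘ₗ H.act b' := by
  obtain ⟨c, rfl⟩ := H.toDual_surjective b
  obtain ⟨c', rfl⟩ := H.toDual_surjective b'
  obtain ⟨s, hs⟩ := H.T₃.surjective (c ⊗ₜ c')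
  refine ⟨slice (H.φ ∘ₗ f) s, ?_⟩
  ext x
  have hx : (H.eval (H.toDual c) ∘ₗ f ∘ₗ H.act (H.toDual c')) x =
      H.φ (f (H.act (H.toDual c') x * c)) := by
    obtain ⟨a, rfl | rfl⟩ := hf
    · simp [mul_assoc]
    · simp
  rw [hx, H.act_mul s x c c' hs]
  clear hx hs
  induction s with
  | zero => simp
  | add s₁ s₂ h₁ h₂ =>
    simp only [map_add, LinearMap.add_apply] at h₁ h₂ ⊢
    rw [h₁, h₂]
  | tmul p q => simp [mul_comm]

/-- The product of `B`: `⟨a, b b'⟩ = ⟨Δ(a), b ⊗ b'⟩ = ⟨b' ▷ a, b⟩`. -/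
instance : Mul H.Dual :=
  ⟨fun b b' => H.ofRange (H.eval b ∘ₗ H.act b') (H.mul_mem 1 b b' ⟨0, Or.inr rfl⟩)⟩

@[simp] theorem eval_mul (b b' : H.Dual) (a : A) : H.eval (b * b') a = H.eval b (H.act b' a) := rfl

/-- `(ι ⊗ b ▷)((p ⊗ 1)Δ(x)) = (p ⊗ 1)Δ(b ▷ x)`. -/
theorem lTensor_act (b : H.Dual) (p x : A) :
    LinearMap.lTensor A (H.act b) (H.T₂ (p ⊗ₜ x)) = H.T₂ (p ⊗ₜ H.act b x) := by
  obtain ⟨c, rfl⟩ := H.toDual_surjective b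
  have h := congrArg (slice H.φ) (H.coassoc p x c)
  have e1 : ∀ t : A ⊗[ℂ] A, slice H.φ (LinearMap.rTensor A H.T₂.toLinearMap
      ((TensorProduct.assoc ℂ A A A).symm (p ⊗ₜ t))) = H.T₂ (p ⊗ₜ slice H.φ t) := by
    intro t
    induction t with
    | zero => simp
    | add x y h₁ h₂ => simp only [TensorProduct.tmul_add, map_add, h₁, h₂]
    | tmul u v => simp
  have e3 : ∀ (u : A) (r : A ⊗[ℂ] A), slice H.φ ((TensorProduct.assoc ℂ A A A).symm (u ⊗ₜ r)) =
      u ⊗ₜ slice H.φ r := by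
    intro u r
    induction r with
    | zero => simp
    | add x y h₁ h₂ => simp only [TensorProduct.tmul_add, map_add, h₁, h₂]
    | tmul u v => simp
  have e2 : ∀ t : A ⊗[ℂ] A, slice H.φ ((TensorProduct.assoc ℂ A A A).symm
      (LinearMap.lTensor A H.T₁.toLinearMap (TensorProduct.assoc ℂ A A A (t ⊗ₜ c)))) =
        LinearMap.lTensor A (H.act (H.toDual c)) t := by
    intro t
    induction t with
    | zero => simp
    | add x y h₁ h₂ => simp only [TensorProduct.add_tmul, map_add, h₁, h₂]
    | tmul u v => simp [e3, act_toDual]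
  rw [e1, e2] at h
  rw [← h, act_toDual]

/-- `(b b') ▷ a = b ▷ (b' ▷ a)`. -/
theorem act_mul_apply (b b' : H.Dual) (a : A) : H.act (b * b') a = H.act b (H.act b' a) := by
  rw [← sub_eq_zero]
  apply H.nondegenerate.2
  intro e
  rw [mul_sub, mul_act, mul_act, ← lTensor_act, sub_eq_zero]
  have := slice_map (X := A) LinearMap.id (H.act b') (H.eval b) (H.T₂ (e ⊗ₜ a))
  exact this.symm

instance : NonUnitalRing H.Dual where
  left_distrib b c d := H.dual_ext fun x => by simp
  right_distrib b c d := H.dual_ext fun x => by simp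
  zero_mul b := H.dual_ext fun x => by simp
  mul_zero b := H.dual_ext fun x => by simp
  mul_assoc b c d := H.dual_ext fun x => by simp [act_mul_apply]

instance : IsScalarTower ℂ H.Dual H.Dual :=
  ⟨fun r b c => H.dual_ext fun x => by simp⟩

instance : SMulCommClass ℂ H.Dual H.Dual :=
  ⟨fun r b c => H.dual_ext fun x => by simp⟩

/-- The left action of `A` on `B`: `⟨a', a ▷ b⟩ = ⟨a' a, b⟩`. -/
def actDual (a : A) (b : H.Dual) : H.Dual :=
  H.ofRange (H.eval b ∘ₗ LinearMap.mulRight ℂ a) (by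
    obtain ⟨c, rfl⟩ := H.toDual_surjective b
    exact ⟨a * c, by ext x; simp [mul_assoc]⟩)

/-- The element `(b ◁ a) b'` of `B`, where `⟨a', b ◁ a⟩ = ⟨a a', b⟩`,
so that `⟨x, (b ◁ a) b'⟩ = ⟨a (b' ▷ x), b⟩`. -/
def actMul (b b' : H.Dual) (a : A) : H.Dual :=
  H.ofRange (H.eval b ∘ₗ LinearMap.mulLeft ℂ a ∘ₗ H.act b')
    (H.mul_mem (LinearMap.mulLeft ℂ a) b b' ⟨a, Or.inl rfl⟩)

@[simp] theorem eval_actMul (b b' : H.Dual) (a x : A) :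
    H.eval (H.actMul b b' a) x = H.eval b (a * H.act b' x) := rfl

/-- `(b ⊗ b') ↦ (a ↦ (b ◁ a) b')` as a linear map. -/
def actMulₗ : H.Dual ⊗[ℂ] H.Dual →ₗ[ℂ] A →ₗ[ℂ] H.Dual :=
  TensorProduct.lift (LinearMap.mk₂ ℂ
    (fun b b' =>
      { toFun := H.actMul b b'
        map_add' := fun a a' => H.dual_ext fun x => by simp [add_mul]
        map_smul' := fun r a => H.dual_ext fun x => by simp [smul_mul_assoc] })
    (fun b c b' => LinearMap.ext fun a => H.dual_ext fun x => by simp)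
    (fun r b b' => LinearMap.ext fun a => H.dual_ext fun x => by simp)
    (fun b c b' => LinearMap.ext fun a => H.dual_ext fun x => by simp [mul_add])
    (fun r b b' => LinearMap.ext fun a => H.dual_ext fun x => by simp [mul_smul_comm]))

@[simp] theorem actMulₗ_tmul (b b' : H.Dual) (a : A) :
    H.actMulₗ (b ⊗ₜ b') a = H.actMul b b' a := rfl

/-- The underlying space `A ⊗ B` of the Heisenberg algebra `AB`. -/
def Heisenberg : Type u := A ⊗[ℂ] H.Dual

instance : AddCommGroup H.Heisenberg := inferInstanceAs (AddCommGroup (A ⊗[ℂ] H.Dual))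

instance : Module ℂ H.Heisenberg := inferInstanceAs (Module ℂ (A ⊗[ℂ] H.Dual))

/-- The element `a ⊗ b` of the Heisenberg algebra. -/
def heis : A →ₗ[ℂ] H.Dual →ₗ[ℂ] H.Heisenberg := TensorProduct.mk ℂ A H.Dual

/-- The product of the Heisenberg algebra,
`(a ⊗ b)(a' ⊗ b') = ∑ ⟨a'₍₂₎, b₍₁₎⟩ a a'₍₁₎ ⊗ b₍₂₎ b' = ∑ a a'₍₁₎ ⊗ (b ◁ a'₍₂₎) b'`.
Here `∑ a a'₍₁₎ ⊗ a'₍₂₎ = (a ⊗ 1)Δ(a')` is in `A ⊗ A`, and `∑ ⟨a, b₍₁₎⟩ b₍₂₎ = b ◁ a`. -/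
def heisMul : H.Heisenberg →ₗ[ℂ] H.Heisenberg →ₗ[ℂ] H.Heisenberg :=
  TensorProduct.curry
    (LinearMap.lTensor A (TensorProduct.lift H.actMulₗ.flip) ∘ₗ
      (TensorProduct.assoc ℂ A A (H.Dual ⊗[ℂ] H.Dual)).toLinearMap ∘ₗ
      LinearMap.rTensor (H.Dual ⊗[ℂ] H.Dual) H.T₂.toLinearMap ∘ₗ
      (TensorProduct.tensorTensorTensorComm ℂ A H.Dual A H.Dual).toLinearMap)

instance : Mul H.Heisenberg := ⟨fun x y => H.heisMul x y⟩

theorem heis_mul_heis (a a' : A) (b b' : H.Dual) :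
    H.heis a b * H.heis a' b' =
      (LinearMap.lTensor A (H.actMulₗ (b ⊗ₜ b')) (H.T₂ (a ⊗ₜ a')) : A ⊗[ℂ] H.Dual) := by
  change LinearMap.lTensor A (TensorProduct.lift H.actMulₗ.flip)
    (TensorProduct.assoc ℂ A A (H.Dual ⊗[ℂ] H.Dual) (H.T₂ (a ⊗ₜ a') ⊗ₜ (b ⊗ₜ b'))) = _
  generalize H.T₂ (a ⊗ₜ a') = w
  induction w with
  | zero => simp
  | add w₁ w₂ h₁ h₂ => simp only [TensorProduct.add_tmul, map_add, h₁, h₂]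
  | tmul p q => simp

/-- The action of the Heisenberg algebra on `A`: `(a ⊗ b) ▷ x = a (b ▷ x)`. -/
def heisAct : H.Heisenberg →ₗ[ℂ] A →ₗ[ℂ] A :=
  TensorProduct.lift (LinearMap.mk₂ ℂ (fun a b => LinearMap.mulLeft ℂ a ∘ₗ H.act b)
    (by intros; ext; simp [add_mul]) (by intros; ext; simp [smul_mul_assoc])
    (by intros; ext; simp [mul_add]) (by intros; ext; simp))

@[simp] theorem heisAct_heis (a : A) (b : H.Dual) (x : A) :
    H.heisAct (H.heis a b) x = a * H.act b x := rfl

theorem heis_induction {p : H.Heisenberg → Prop} (h : ∀ a b, p (H.heis a b))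
    (hadd : ∀ x y, p x → p y → p (x + y)) (x : H.Heisenberg) : p x := by
  induction x using TensorProduct.induction_on with
  | zero =>
    have h0 := h 0 0
    rw [map_zero] at h0
    exact h0
  | tmul a b => exact h a b
  | add x y hx hy => exact hadd x y hx hy

theorem heisAct_mul (s t : H.Heisenberg) (x : A) :
    H.heisAct (s * t) x = H.heisAct s (H.heisAct t x) := by
  induction s using H.heis_induction with
  | hadd s₁ s₂ h₁ h₂ =>
    change H.heisAct (H.heisMul (s₁ + s₂) t) x = _
    rw [map_add, LinearMap.add_apply, map_add, LinearMap.add_apply, map_add, LinearMap.add_apply]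
    exact congrArg₂ (· + ·) h₁ h₂
  | h a b =>
    induction t using H.heis_induction with
    | hadd t₁ t₂ h₁ h₂ =>
      change H.heisAct (H.heisMul _ (t₁ + t₂)) x = _
      rw [map_add, map_add, LinearMap.add_apply, map_add, LinearMap.add_apply, map_add]
      exact congrArg₂ (· + ·) h₁ h₂
    | h a' b' =>
      rw [heisAct_heis, heisAct_heis, mul_act, ← H.right_T₂, heis_mul_heis]
      generalize H.T₂ (a ⊗ₜ a') = w
      induction w with
      | zero =>
        simp only [map_zero]
        exact LinearMap.congr_fun (map_zero H.heisAct) x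
      | add w₁ w₂ h₁ h₂ =>
        simp only [map_add]
        rw [← h₁, ← h₂]
        exact LinearMap.congr_fun (map_add H.heisAct _ _) x
      | tmul p q =>
        have h1 : H.heisAct (LinearMap.lTensor A (H.actMulₗ (b ⊗ₜ b')) (p ⊗ₜ q)) x =
            p * H.act (H.actMul b b' q) x := rfl
        rw [h1, mul_act, H.right_tmul_eq, ← lTensor_act, slice_map]
        have := slice_map (X := A) LinearMap.id (H.act b') (H.eval b ∘ₗ LinearMap.mulLeft ℂ q)
          (H.T₂ (p ⊗ₜ x))
        exact this.symm

/-- The action of the Heisenberg algebra on `A` is faithful. -/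
theorem heisAct_injective (s : H.Heisenberg) (h : ∀ x, H.heisAct s x = 0) : s = 0 := by
  -- `∑ a ⊗ b` acts on `u ⊗ v` as `∑ ⟨v, b⟩ a u`
  let K : H.Heisenberg →ₗ[ℂ] A ⊗[ℂ] A →ₗ[ℂ] A :=
    TensorProduct.lift (LinearMap.mk₂ ℂ (fun a b => LinearMap.mulLeft ℂ a ∘ₗ slice (H.eval b))
      (by intros; apply TensorProduct.ext'; intros; simp [add_mul])
      (by intros; apply TensorProduct.ext'; intros; simp only [smul_mul_assoc,
        LinearMap.comp_apply, LinearMap.smul_apply, LinearMap.mulLeft_apply])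
      (by intros; apply TensorProduct.ext'; intros; simp [add_smul, mul_add, mul_smul_comm])
      (by intros; apply TensorProduct.ext'; intros; simp [mul_smul]))
  have hK : ∀ (s : H.Heisenberg) (x z : A), K s (H.T₃ (x ⊗ₜ z)) = H.heisAct s x * z := by
    intro s x z
    induction s using H.heis_induction with
    | hadd s₁ s₂ h₁ h₂ => simp only [map_add, LinearMap.add_apply, add_mul, h₁, h₂]
    | h a b =>
      change a * slice (H.eval b) (H.T₃ (x ⊗ₜ z)) = _
      rw [heisAct_heis, mul_act]
      have h1 := slice_map (LinearMap.mulRight ℂ z) LinearMap.id (H.eval b) (H.T₂ (a ⊗ₜ x))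
      rw [H.mulRight_T₂, slice_map] at h1
      exact h1
  have hK0 : ∀ w, K s w = 0 := by
    intro w
    obtain ⟨w, rfl⟩ := H.T₃.surjective w
    induction w with
    | zero => simp
    | add w₁ w₂ h₁ h₂ => rw [map_add, map_add, h₁, h₂, add_zero]
    | tmul x z => rw [hK, h, zero_mul]
  -- pair the second leg with `v`
  have hv : ∀ v : A, slice (H.eval.flip v) (s : A ⊗[ℂ] H.Dual) = 0 := by
    intro v
    apply H.nondegenerate.1
    intro u
    have : ∀ s : H.Heisenberg, slice (H.eval.flip v) (s : A ⊗[ℂ] H.Dual) * u = K s (u ⊗ₜ v) := by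
      intro s
      induction s using H.heis_induction with
      | hadd s₁ s₂ h₁ h₂ =>
        rw [map_add, LinearMap.add_apply, ← h₁, ← h₂, ← add_mul]
        exact congrArg (· * u) (map_add (slice (H.eval.flip v)) _ _)
      | h a b =>
        change slice (H.eval.flip v) (a ⊗ₜ b) * u = a * slice (H.eval b) (u ⊗ₜ v)
        simp [smul_mul_assoc, mul_smul_comm]
    rw [this, hK0]
  have hc : TensorProduct.comm ℂ A H.Dual s = 0 := by
    refine eq_zero_of_slice fun ω => H.dual_ext fun v => ?_
    have h2 : ∀ t : A ⊗[ℂ] H.Dual, H.eval (slice ω (TensorProduct.comm ℂ A H.Dual t)) v =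
        ω (slice (H.eval.flip v) t) := by
      intro t
      induction t with
      | zero => simp
      | add t₁ t₂ h₁ h₂ => simp only [map_add, LinearMap.add_apply, h₁, h₂]
      | tmul a b => simp [mul_comm]
    have := h2 s
    rw [hv] at this
    simpa using this
  exact (LinearEquiv.map_eq_zero_iff (TensorProduct.comm ℂ A H.Dual)).mp hc

theorem heis_ext {s t : H.Heisenberg} (h : ∀ x, H.heisAct s x = H.heisAct t x) : s = t := by
  rw [← sub_eq_zero]
  apply H.heisAct_injective
  intro x
  rw [map_sub, LinearMap.sub_apply, h, sub_self]

/-- The Heisenberg algebra `AB`. -/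
instance : NonUnitalRing H.Heisenberg where
  left_distrib x y z := map_add (H.heisMul x) y z
  right_distrib x y z := LinearMap.congr_fun (map_add H.heisMul x y) z
  zero_mul x := LinearMap.congr_fun (map_zero H.heisMul) x
  mul_zero x := map_zero (H.heisMul x)
  mul_assoc x y z := H.heis_ext fun u => by simp only [heisAct_mul]

instance : IsScalarTower ℂ H.Heisenberg H.Heisenberg :=
  ⟨fun r x y => LinearMap.congr_fun (map_smul H.heisMul r x) y⟩

instance : SMulCommClass ℂ H.Heisenberg H.Heisenberg :=
  ⟨fun r x y => (map_smul (H.heisMul x) r y).symm⟩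

/-- The pairing of `B ⊗ B` with `A ⊗ A`: `⟨a ⊗ a', b ⊗ b'⟩ = ⟨a, b⟩⟨a', b'⟩`. -/
def pairDual : H.Dual ⊗[ℂ] H.Dual →ₗ[ℂ] Module.Dual ℂ (A ⊗[ℂ] A) :=
  TensorProduct.dualDistrib ℂ A A ∘ₗ TensorProduct.map H.eval H.eval

/-- The pairing of `B ⊗ A` with `A ⊗ B`: `⟨b ⊗ a, a' ⊗ b'⟩ = ⟨a', b⟩⟨a, b'⟩`. -/
def pairMixed : H.Dual ⊗[ℂ] A →ₗ[ℂ] Module.Dual ℂ (A ⊗[ℂ] H.Dual) :=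
  TensorProduct.dualDistrib ℂ A H.Dual ∘ₗ TensorProduct.map H.eval H.eval.flip

/-- `ΔB` is the coproduct of `B`: `⟨a ⊗ a', ΔB(b)⟩ = ⟨a a', b⟩`, for the pairing of `A ⊗ A` with
`M(B ⊗ B)` given by `⟨y ▷ x, n⟩ = ⟨x, n y⟩` for `x ∈ A ⊗ A` and `y ∈ B ⊗ B`. -/
def IsDualCoproduct (ΔB : H.Dual →ₙₐ[ℂ] Multiplier (H.Dual ⊗[ℂ] H.Dual)) : Prop :=
  ∀ (b b₁ b₂ : H.Dual) (a₁ a₂ : A),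
    H.pairDual (left (ΔB b) (b₁ ⊗ₜ b₂)) (a₁ ⊗ₜ a₂) = H.eval b (H.act b₁ a₁ * H.act b₂ a₂)

/-- `V ∈ M(B ⊗ A)` is the duality: `⟨V, a ⊗ b⟩ = ⟨a, b⟩`, for the pairing of `M(B ⊗ A)` with
`A ⊗ B` given by `⟨m, y ▷ x⟩ = ⟨m y, x⟩` for `x ∈ A ⊗ B` and `y ∈ B ⊗ A`. -/
def IsDuality (V : Multiplier (H.Dual ⊗[ℂ] A)) : Prop :=
  ∀ (b : H.Dual) (a a' : A) (b' : H.Dual),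
    H.pairMixed (left V (b ⊗ₜ a)) (a' ⊗ₜ b') = H.eval (H.actDual a b') (H.act b a')

/-- `jA` and `jB` are the embeddings of `A` and `B` in `M(AB)`, characterized by
`jA(a)(a' ⊗ b') = a a' ⊗ b'` and `(a' ⊗ b') jB(b) = a' ⊗ b' b`. -/
def IsHeisenbergEmbedding (jA : A →ₙₐ[ℂ] Multiplier H.Heisenberg)
    (jB : H.Dual →ₙₐ[ℂ] Multiplier H.Heisenberg) : Prop :=
  (∀ (a a' : A) (b' : H.Dual), left (jA a) (H.heis a' b') = H.heis (a * a') b') ∧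
  (∀ (b : H.Dual) (a' : A) (b' : H.Dual), right (jB b) (H.heis a' b') = H.heis a' (b' * b))

section Relations

variable {C : Type v} [NonUnitalRing C] [Module ℂ C] [IsScalarTower ℂ C C] [SMulCommClass ℂ C C]
variable (jA : A →ₙₐ[ℂ] Multiplier C) (jB : H.Dual →ₙₐ[ℂ] Multiplier C)

/-- The linear map `a ⊗ b ↦ jA(a) jB(b)`. -/
def productMap : H.Heisenberg →ₗ[ℂ] Multiplier C :=
  TensorProduct.lift ((LinearMap.mul ℂ (Multiplier C)).compl₁₂
    (jA : A →ₗ[ℂ] Multiplier C) (jB : H.Dual →ₗ[ℂ] Multiplier C))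

/-- The Heisenberg commutation relations
`jB(b) jA(a') = ∑ ⟨a'₍₂₎, b₍₁₎⟩ jA(a'₍₁₎) jB(b₍₂₎)` for homomorphisms of `A` and `B` to `M(C)`.
They are multiplied by `jA(a)` from the left and by `jB(b')` from the right, and then the right
hand side is the image of `∑ ⟨a'₍₂₎, b₍₁₎⟩ a a'₍₁₎ ⊗ b₍₂₎ b'` in `A ⊗ B`. -/
def HeisenbergRelations : Prop :=
  ∀ (a a' : A) (b b' : H.Dual),
    jA a * (jB b * jA a') * jB b' = H.productMap jA jB (H.heis a b * H.heis a' b')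

/-- `Δ(a) V = V (a ⊗ 1)` in `M(C ⊗ A)` for all `a ∈ A`. -/
def FirstFormula (V : Multiplier (H.Dual ⊗[ℂ] A)) : Prop :=
  ∀ a : A,
    extend (tensorHom jA (ofHom A)) (H.Δ a) * extend (tensorHom jB (ofHom A)) V =
      extend (tensorHom jB (ofHom A)) V * tmul (jA a) 1

/-- `V Δ(b) = (1 ⊗ b) V` in `M(B ⊗ C)` for all `b ∈ B`. -/
def SecondFormula (ΔB : H.Dual →ₙₐ[ℂ] Multiplier (H.Dual ⊗[ℂ] H.Dual))
    (V : Multiplier (H.Dual ⊗[ℂ] A)) : Prop :=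
  ∀ b : H.Dual,
    extend (tensorHom (ofHom H.Dual) jA) V * extend (tensorHom (ofHom H.Dual) jB) (ΔB b) =
      tmul 1 (jB b) * extend (tensorHom (ofHom H.Dual) jA) V

end Relations

end AlgebraicQuantumGroup

end MultiplierHopf

end

/-! The Heisenberg algebra `AB` acts on `A`: elements of `A` act by multiplication and elements of
`B` by `▷`. This action is faithful, so elements and multipliers of `AB` can be compared as
operators on `A`. The relation `b ▷ (x (b' ▷ y)) = ∑ (b₍₁₎ ▷ x)(b₍₂₎ b' ▷ y)`
(`heisAct_heisSlice_dualT₁`) is the Heisenberg commutation relation in operator form.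

The analytic input is about the integral. The counit is extracted from coassociativity, and with it
`B` is shown to separate the points of `A` (`eq_zero_of_act`). This gives the non-degeneracy of `B`
and of `AB`. The antipode `S` is defined by `S((ι ⊗ φ)(Δ(x)(1 ⊗ z))) = (ι ⊗ φ)((1 ⊗ x)Δ(z))`. It
reverses products and coproducts, so `ψ = φ ∘ S` is a right integral. Comparing integrals yields
`φ(· A) = ψ(A ·)` (`exists_ψ_eq`, `exists_φ_eq`) and the injectivity of `c ↦ φ(· c)` and `k ↦ ψ(k
·)`. Thus an element of `B` can be written with `φ` or with `ψ`, and invariance expresses all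
products with `V` and `Δ(b)` through inverses of canonical maps: left multiplication through `φ` and
`T₃⁻¹`, right multiplication through `ψ` and `T₄⁻¹`. The left and right parts fit together because
the left and right actions of `B` on `A` commute (`actR_act`). Uniqueness holds because the pairings
separate points.

Both equivalences with the commutation relations come from slicing. Applying `ι ⊗ φ` to the first
formula at `z ⊗ c` replaces `V` by `b = φ(· c)`: the right side becomes `jB(b) jA(a) z`, and the
left side, multiplied by `jA(a')`, becomes the image of a product in `AB` (`firstFormula_iff`).
Pairing the first leg of the second formula with `u` replaces `V(b₁ ⊗ z)` by `jA(b₁ ▷ u) z`, and the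
two sides become the two sides of the relation for `x = b₁ ▷ u` (`secondFormula_iff`). No
information is lost, by separation of points and non-degeneracy. For `C = AB` the map `a ⊗ b ↦ jA(a)
jB(b)` is the inclusion into `M(AB)`, so the relations hold by multiplicativity, and both formulas
follow. -/

noncomputable section

set_option linter.unusedSectionVars false

namespace MultiplierHopf

universe u v w

open Multiplier

/-! ### Slice maps and tensors killed by families of maps -/

section TensorSlices

variable {X Y Z : Type*} [AddCommGroup X] [Module ℂ X] [AddCommGroup Y] [Module ℂ Y]
  [AddCommGroup Z] [Module ℂ Z]

/-- The slice map `ω ⊗ ι : X ⊗ Y → Y` for a linear functional `ω` on `X`. -/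
def lslice (ω : X →ₗ[ℂ] ℂ) : X ⊗[ℂ] Y →ₗ[ℂ] Y :=
  (TensorProduct.lid ℂ Y).toLinearMap ∘ₗ LinearMap.rTensor Y ω

@[simp] theorem lslice_tmul (ω : X →ₗ[ℂ] ℂ) (x : X) (y : Y) :
    lslice ω (x ⊗ₜ[ℂ] y) = ω x • y := by
  simp [lslice]

theorem slice_lTensor (g : Y →ₗ[ℂ] Z) (ω : Z →ₗ[ℂ] ℂ) (t : X ⊗[ℂ] Y) :
    slice ω (LinearMap.lTensor X g t) = slice (ω ∘ₗ g) t :=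
  slice_map LinearMap.id g ω t

theorem slice_rTensor (f : X →ₗ[ℂ] Z) (ω : Y →ₗ[ℂ] ℂ) (t : X ⊗[ℂ] Y) :
    slice ω (LinearMap.rTensor Y f t) = f (slice ω t) :=
  slice_map f LinearMap.id ω t

theorem lslice_rTensor (f : X →ₗ[ℂ] Z) (ω : Z →ₗ[ℂ] ℂ) (t : X ⊗[ℂ] Y) :
    lslice ω (LinearMap.rTensor Y f t) = lslice (ω ∘ₗ f) t := by
  induction t with
  | zero => simp
  | add x y h₁ h₂ => simp only [map_add, h₁, h₂]
  | tmul x y => simp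

theorem lslice_lTensor (g : Y →ₗ[ℂ] Z) (ω : X →ₗ[ℂ] ℂ) (t : X ⊗[ℂ] Y) :
    lslice ω (LinearMap.lTensor X g t) = g (lslice ω t) := by
  induction t with
  | zero => simp
  | add x y h₁ h₂ => simp only [map_add, h₁, h₂]
  | tmul x y => simp

theorem lslice_comm (ω : Y →ₗ[ℂ] ℂ) (t : X ⊗[ℂ] Y) :
    lslice ω (TensorProduct.comm ℂ X Y t) = slice ω t := by
  induction t with
  | zero => simp
  | add x y h₁ h₂ => simp only [map_add, h₁, h₂]
  | tmul x y => simp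

theorem apply_slice (ω : X →ₗ[ℂ] ℂ) (χ : Y →ₗ[ℂ] ℂ) (t : X ⊗[ℂ] Y) :
    ω (slice χ t) = χ (lslice ω t) := by
  induction t with
  | zero => simp
  | add x y h₁ h₂ => simp only [map_add, h₁, h₂]
  | tmul x y => simp [mul_comm]

theorem slice_surjective {ω : Y →ₗ[ℂ] ℂ} (hω : ω ≠ 0) :
    Function.Surjective (slice ω : X ⊗[ℂ] Y →ₗ[ℂ] X) := by
  obtain ⟨y, hy⟩ : ∃ y, ω y ≠ 0 := by
    by_contra! h
    exact hω (LinearMap.ext h)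
  intro x
  exact ⟨x ⊗ₜ ((ω y)⁻¹ • y), by simp [hy]⟩

theorem lslice_surjective {ω : X →ₗ[ℂ] ℂ} (hω : ω ≠ 0) :
    Function.Surjective (lslice ω : X ⊗[ℂ] Y →ₗ[ℂ] Y) := by
  intro y
  obtain ⟨t, ht⟩ := slice_surjective (X := Y) hω y
  exact ⟨TensorProduct.comm ℂ Y X t, by rw [lslice_comm, ht]⟩

/-- A tensor killed by all `f ⊗ ι` is in `N ⊗ Y`, where `N` is the joint kernel of the `f`. -/
theorem mem_span_tmul_of_rTensor {ι : Type*} (F : ι → X →ₗ[ℂ] Z) (t : X ⊗[ℂ] Y)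
    (h : ∀ i, LinearMap.rTensor Y (F i) t = 0) :
    t ∈ Submodule.span ℂ {s : X ⊗[ℂ] Y | ∃ x y, (∀ i, F i x = 0) ∧ s = x ⊗ₜ y} := by
  classical
  let b := Module.Basis.ofVectorSpace ℂ Y
  let e := TensorProduct.equivFinsuppOfBasisRight (M := X) b
  -- The coordinates of `t` along a basis of `Y` are slices, and slicing the second leg commutes
  -- with `F i` on the first.
  have h1 : ∀ i k, F i (e t k) = 0 := by
    intro i k
    have h2 := slice_rTensor (F i) (b.coord k) t
    rw [h, map_zero] at h2
    rw [h2]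
    congr 1
    exact TensorProduct.equivFinsuppOfBasisRight_apply b t k
  rw [← e.symm_apply_apply t, TensorProduct.equivFinsuppOfBasisRight_symm_apply]
  exact Submodule.sum_mem _ fun k _ => Submodule.subset_span ⟨_, _, fun i => h1 i k, rfl⟩

theorem eq_zero_of_rTensor {ι : Type*} (F : ι → X →ₗ[ℂ] Z) (hF : ∀ x, (∀ i, F i x = 0) → x = 0)
    (t : X ⊗[ℂ] Y) (h : ∀ i, LinearMap.rTensor Y (F i) t = 0) : t = 0 := by
  have := mem_span_tmul_of_rTensor F t h
  rw [← Submodule.mem_bot ℂ]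
  refine (Submodule.span_le.mpr ?_) this
  rintro _ ⟨x, y, hx, rfl⟩
  simp [hF x hx]

theorem eq_of_rTensor {ι : Type*} (F : ι → X →ₗ[ℂ] Z) (hF : ∀ x, (∀ i, F i x = 0) → x = 0)
    {s t : X ⊗[ℂ] Y} (h : ∀ i, LinearMap.rTensor Y (F i) s = LinearMap.rTensor Y (F i) t) :
    s = t := by
  rw [← sub_eq_zero]
  refine eq_zero_of_rTensor F hF _ fun i => ?_
  rw [map_sub, h, sub_self]

theorem comm_rTensor (f : X →ₗ[ℂ] Z) (t : X ⊗[ℂ] Y) :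
    TensorProduct.comm ℂ Z Y (LinearMap.rTensor Y f t) =
      LinearMap.lTensor Y f (TensorProduct.comm ℂ X Y t) := by
  induction t with
  | zero => simp
  | add x y h₁ h₂ => simp only [map_add, h₁, h₂]
  | tmul x y => simp

theorem comm_lTensor (f : Y →ₗ[ℂ] Z) (t : X ⊗[ℂ] Y) :
    TensorProduct.comm ℂ X Z (LinearMap.lTensor X f t) =
      LinearMap.rTensor X f (TensorProduct.comm ℂ X Y t) := by
  induction t with
  | zero => simp
  | add x y h₁ h₂ => simp only [map_add, h₁, h₂]
  | tmul x y => simp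

theorem eq_of_lTensor {ι : Type*} (F : ι → Y →ₗ[ℂ] Z) (hF : ∀ x, (∀ i, F i x = 0) → x = 0)
    {s t : X ⊗[ℂ] Y} (h : ∀ i, LinearMap.lTensor X (F i) s = LinearMap.lTensor X (F i) t) :
    s = t := by
  apply (TensorProduct.comm ℂ X Y).injective
  refine eq_of_rTensor F hF fun i => ?_
  rw [← comm_lTensor, h, comm_lTensor]

theorem mem_span_tmul_of_lTensor {ι : Type*} (F : ι → Y →ₗ[ℂ] Z) (t : X ⊗[ℂ] Y)
    (h : ∀ i, LinearMap.lTensor X (F i) t = 0) :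
    t ∈ Submodule.span ℂ {s : X ⊗[ℂ] Y | ∃ x y, (∀ i, F i y = 0) ∧ s = x ⊗ₜ y} := by
  have h1 := mem_span_tmul_of_rTensor F (TensorProduct.comm ℂ X Y t) fun i => by
    rw [← comm_lTensor, h, map_zero]
  have h2 := Submodule.mem_map_of_mem (f := (TensorProduct.comm ℂ Y X).toLinearMap) h1
  rw [Submodule.map_span] at h2
  simp only [LinearEquiv.coe_coe, TensorProduct.comm_comm] at h2
  refine Submodule.span_mono ?_ h2
  rintro _ ⟨_, ⟨y, x, hy, rfl⟩, rfl⟩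
  exact ⟨x, y, hy, by simp⟩

end TensorSlices

/-! ### Cancellation in non-degenerate algebras -/

section Algebra

variable {A : Type*} [NonUnitalRing A] [Module ℂ A] [IsScalarTower ℂ A A] [SMulCommClass ℂ A A]

theorem IsNondegenerate.eq_of_mul_right (hA : IsNondegenerate A) {a b : A}
    (h : ∀ x, a * x = b * x) : a = b := by
  rw [← sub_eq_zero]
  exact hA.1 _ fun x => by rw [sub_mul, h, sub_self]

theorem IsNondegenerate.eq_of_mul_left (hA : IsNondegenerate A) {a b : A}
    (h : ∀ x, x * a = x * b) : a = b := by
  rw [← sub_eq_zero]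
  exact hA.2 _ fun x => by rw [mul_sub, h, sub_self]

variable {Y : Type*} [AddCommGroup Y] [Module ℂ Y]

theorem IsNondegenerate.eq_of_rTensor_mulLeft (hA : IsNondegenerate A) {s t : A ⊗[ℂ] Y}
    (h : ∀ a, LinearMap.rTensor Y (LinearMap.mulLeft ℂ a) s =
      LinearMap.rTensor Y (LinearMap.mulLeft ℂ a) t) : s = t :=
  eq_of_rTensor (fun a : A => LinearMap.mulLeft ℂ a) (fun x hx => hA.2 x hx) h

/-- This is `m(xn) = (mx)n`; both sides agree after multiplication by `z` from the left. -/
theorem Multiplier.left_right_comm (hA : IsNondegenerate A) (m n : Multiplier A) (x : A) :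
    left m (right n x) = right n (left m x) := by
  refine hA.eq_of_mul_left fun z => ?_
  rw [← central, ← right_mul_left hA, ← right_mul_left hA, central]

theorem Multiplier.ext_right (hA : IsNondegenerate A) {m n : Multiplier A}
    (h : ∀ x, right m x = right n x) : m = n := by
  refine ext' (fun x => hA.eq_of_mul_left fun y => ?_) h
  rw [← central, ← central, h]

end Algebra

/-! ### Relations between the four canonical maps -/

namespace RegularMultiplierHopfAlgebra

variable {A : Type u} [NonUnitalRing A] [Module ℂ A] [IsScalarTower ℂ A A] [SMulCommClass ℂ A A]
variable (H : RegularMultiplierHopfAlgebra A)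

theorem left_T₁ (x p q : A) : left (H.Δ x) (H.T₁ (p ⊗ₜ q)) = H.T₁ ((x * p) ⊗ₜ q) := by
  apply of_injective H.nondeg2
  rw [← mul_of H.nondeg2, H.T₁_spec, H.T₁_spec, map_mul, mul_assoc]

theorem right_T₄ (a a' y : A) : right (H.Δ y) (H.T₄ (a ⊗ₜ a')) = H.T₄ (a ⊗ₜ (a' * y)) := by
  apply of_injective H.nondeg2
  rw [← of_mul H.nondeg2, H.T₄_spec, H.T₄_spec, map_mul, mul_assoc]

theorem left_tmul_eq (a c d : A) : left (H.Δ a) (c ⊗ₜ d) =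
    LinearMap.rTensor A (LinearMap.mulRight ℂ c) (H.T₁ (a ⊗ₜ d)) :=
  (H.mulRight_T₁ a c d).symm

theorem left_tmul_eq' (a c d : A) : left (H.Δ a) (c ⊗ₜ d) =
    LinearMap.lTensor A (LinearMap.mulRight ℂ d) (H.T₃ (a ⊗ₜ c)) := by
  apply of_injective H.nondeg2
  rw [← mul_of H.nondeg2, of_tmul]
  have h2 := of_mul H.nondeg2 (tmul 1 (of d)) (H.T₃ (a ⊗ₜ c))
  refine Eq.trans ?_ h2
  rw [H.T₃_spec, mul_assoc, tmul_mul_tmul, one_mul, mul_one]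

theorem right_tmul_eq' (p q y : A) : right (H.Δ y) (p ⊗ₜ q) =
    LinearMap.rTensor A (LinearMap.mulLeft ℂ p) (H.T₄ (q ⊗ₜ y)) := by
  apply of_injective H.nondeg2
  rw [← of_mul H.nondeg2, of_tmul]
  have h := mul_of H.nondeg2 (tmul (of p) 1) (H.T₄ (q ⊗ₜ y))
  refine Eq.trans ?_ h
  rw [H.T₄_spec, ← mul_assoc, tmul_mul_tmul, one_mul, mul_one]

/-- Both sides are `(1 ⊗ q)Δ(y)(1 ⊗ z)`. The lemmas below likewise bracket a product with one
coproduct in two ways. -/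
theorem lTensor_mulRight_T₄ (q y z : A) :
    LinearMap.lTensor A (LinearMap.mulRight ℂ z) (H.T₄ (q ⊗ₜ y)) =
      LinearMap.lTensor A (LinearMap.mulLeft ℂ q) (H.T₁ (y ⊗ₜ z)) := by
  apply of_injective H.nondeg2
  have h1 := mul_of H.nondeg2 (tmul 1 (of q)) (H.T₁ (y ⊗ₜ z))
  have h2 := of_mul H.nondeg2 (tmul 1 (of z)) (H.T₄ (q ⊗ₜ y))
  rw [H.T₁_spec, ← mul_assoc, ← H.T₄_spec, h2] at h1
  exact h1

theorem rTensor_mulRight_T₄ (q y z : A) :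
    LinearMap.rTensor A (LinearMap.mulRight ℂ z) (H.T₄ (q ⊗ₜ y)) =
      LinearMap.lTensor A (LinearMap.mulLeft ℂ q) (H.T₃ (y ⊗ₜ z)) := by
  apply of_injective H.nondeg2
  have h1 := mul_of H.nondeg2 (tmul 1 (of q)) (H.T₃ (y ⊗ₜ z))
  have h2 := of_mul H.nondeg2 (tmul (of z) 1) (H.T₄ (q ⊗ₜ y))
  rw [H.T₃_spec, ← mul_assoc, ← H.T₄_spec, h2] at h1
  exact h1

theorem rTensor_mulRight_T₂ (p y z : A) :
    LinearMap.rTensor A (LinearMap.mulRight ℂ z) (H.T₂ (p ⊗ₜ y)) =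
      LinearMap.rTensor A (LinearMap.mulLeft ℂ p) (H.T₃ (y ⊗ₜ z)) :=
  H.mulRight_T₂ p y z

theorem rTensor_mulLeft_T₁ (e a c : A) :
    LinearMap.rTensor A (LinearMap.mulLeft ℂ e) (H.T₁ (a ⊗ₜ c)) =
      LinearMap.lTensor A (LinearMap.mulRight ℂ c) (H.T₂ (e ⊗ₜ a)) :=
  H.mulLeft_T₁ e a c

theorem lTensor_mulLeft_T₂ (p q y : A) :
    LinearMap.lTensor A (LinearMap.mulLeft ℂ q) (H.T₂ (p ⊗ₜ y)) =
      LinearMap.rTensor A (LinearMap.mulLeft ℂ p) (H.T₄ (q ⊗ₜ y)) := by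
  rw [← H.right_tmul_eq']
  exact (H.right_tmul_eq p q y).symm

theorem lTensor_mulRight_T₃ (a c d : A) :
    LinearMap.lTensor A (LinearMap.mulRight ℂ d) (H.T₃ (a ⊗ₜ c)) =
      LinearMap.rTensor A (LinearMap.mulRight ℂ c) (H.T₁ (a ⊗ₜ d)) := by
  rw [← left_tmul_eq, left_tmul_eq']

/-- A map that commutes with the left coaction of `A` on itself, with `T₃` in place of `T₂`. -/
theorem lTensor_T₃ (f : A →ₗ[ℂ] A)
    (hf : ∀ p x, LinearMap.lTensor A f (H.T₂ (p ⊗ₜ x)) = H.T₂ (p ⊗ₜ f x)) (s : A ⊗[ℂ] A) :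
    LinearMap.lTensor A f (H.T₃ s) = H.T₃ (LinearMap.rTensor A f s) := by
  induction s with
  | zero => simp
  | add x y h₁ h₂ => simp only [map_add, h₁, h₂]
  | tmul y z =>
    -- Multiplication by `p ⊗ 1` from the left turns `Δ(y)(z ⊗ 1)` into `T₂ (p ⊗ y)` multiplied by
    -- `z ⊗ 1`, to which `hf` applies.
    refine H.nondegenerate.eq_of_rTensor_mulLeft fun p => ?_
    rw [LinearMap.rTensor_tmul, ← H.rTensor_mulRight_T₂, ← hf,
      ← LinearMap.comp_apply, LinearMap.rTensor_comp_lTensor, ← LinearMap.lTensor_comp_rTensor,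
      LinearMap.comp_apply, ← H.rTensor_mulRight_T₂, ← LinearMap.comp_apply,
      LinearMap.lTensor_comp_rTensor, ← LinearMap.rTensor_comp_lTensor, LinearMap.comp_apply]

/-- Slicing the third leg of `coassoc` by `ω` shows that `q ↦ (ι ⊗ ω)(Δ(q)(1 ⊗ c))` commutes with
the left coaction, for an arbitrary functional `ω`. -/
theorem coassoc_slice (p q c : A) (ω : A →ₗ[ℂ] ℂ) :
    H.T₂ (p ⊗ₜ slice ω (H.T₁ (q ⊗ₜ c))) =
      LinearMap.lTensor A (slice ω ∘ₗ H.T₁.toLinearMap ∘ₗ (TensorProduct.mk ℂ A A).flip c)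
        (H.T₂ (p ⊗ₜ q)) := by
  have h := congrArg (slice ω) (H.coassoc p q c)
  have e3 : ∀ (u : A) (r : A ⊗[ℂ] A), slice ω ((TensorProduct.assoc ℂ A A A).symm (u ⊗ₜ r)) =
      u ⊗ₜ slice ω r := by
    intro u r
    induction r with
    | zero => simp
    | add x y h₁ h₂ => simp only [TensorProduct.tmul_add, map_add, h₁, h₂]
    | tmul u v => simp
  rw [slice_rTensor, e3] at h
  refine h.trans ?_
  generalize H.T₂ (p ⊗ₜ q) = t
  induction t with
  | zero => simp
  | add x y h₁ h₂ => simp only [TensorProduct.add_tmul, map_add, h₁, h₂]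
  | tmul u v => simp [e3]

end RegularMultiplierHopfAlgebra

/-! ### The counit, separation of points by `B`, and non-degeneracy of `B` and `AB` -/

namespace AlgebraicQuantumGroup

variable {A : Type u} [NonUnitalRing A] [Module ℂ A] [IsScalarTower ℂ A A] [SMulCommClass ℂ A A]
variable (H : AlgebraicQuantumGroup A)

theorem exists_φ_eq_one : ∃ x, H.φ x = 1 := by
  obtain ⟨x, hx⟩ : ∃ x, H.φ x ≠ 0 := by
    by_contra! h
    exact H.φ_ne_zero (LinearMap.ext h)
  exact ⟨(H.φ x)⁻¹ • x, by simp [hx]⟩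

/-- Apply `m ∘ T₁⁻¹` to the last two legs of coassociativity: one side collapses to `(p ⊗ 1)Δ(q)(1 ⊗
c)`. Since `T₁` is bijective, `Δ(q)(1 ⊗ c)` may be replaced by any tensor `q ⊗ b`. -/
theorem lTensor_mul_T₁_symm (b : A) (s : A ⊗[ℂ] A) :
    LinearMap.lTensor A (LinearMap.mul' ℂ A ∘ₗ H.T₁.symm.toLinearMap ∘ₗ
      (TensorProduct.mk ℂ A A).flip b) (H.T₂ s) = LinearMap.mul' ℂ A s ⊗ₜ b := by
  let E : A ⊗[ℂ] A →ₗ[ℂ] A := LinearMap.mul' ℂ A ∘ₗ H.T₁.symm.toLinearMap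
  have e1 : ∀ (t : A ⊗[ℂ] A) (c : A), LinearMap.lTensor A E (LinearMap.lTensor A H.T₁.toLinearMap
      (TensorProduct.assoc ℂ A A A (t ⊗ₜ c))) = LinearMap.lTensor A (LinearMap.mulRight ℂ c) t := by
    intro t c
    induction t with
    | zero => simp
    | add x y h₁ h₂ => simp only [TensorProduct.add_tmul, map_add, h₁, h₂]
    | tmul u v => simp [E]
  have e2 : ∀ (t : A ⊗[ℂ] A) (c : A), LinearMap.lTensor A E (TensorProduct.assoc ℂ A A A (t ⊗ₜ c)) =
      LinearMap.lTensor A (E ∘ₗ (TensorProduct.mk ℂ A A).flip c) t := by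
    intro t c
    induction t with
    | zero => simp
    | add x y h₁ h₂ => simp only [TensorProduct.add_tmul, map_add, h₁, h₂]
    | tmul u v => simp
  have key : ∀ (c : A) (s : A ⊗[ℂ] A), LinearMap.lTensor A E (TensorProduct.assoc ℂ A A A
      (LinearMap.rTensor A H.T₂.toLinearMap ((TensorProduct.assoc ℂ A A A).symm
        (c ⊗ₜ H.T₁ s)))) = LinearMap.rTensor A (LinearMap.mulLeft ℂ c) (H.T₁ s) := by
    intro c s
    induction s with
    | zero => simp
    | add x y h₁ h₂ => simp only [TensorProduct.tmul_add, map_add, h₁, h₂]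
    | tmul p q =>
      rw [H.coassoc, LinearEquiv.apply_symm_apply, e1, H.rTensor_mulLeft_T₁]
  change LinearMap.lTensor A (E ∘ₗ (TensorProduct.mk ℂ A A).flip b) (H.T₂ s) = _
  induction s with
  | zero => simp
  | add x y h₁ h₂ => simp only [TensorProduct.add_tmul, map_add, h₁, h₂]
  | tmul p q =>
    have h := key p (H.T₁.symm (q ⊗ₜ b))
    rw [LinearEquiv.apply_symm_apply, TensorProduct.assoc_symm_tmul, LinearMap.rTensor_tmul,
      e2] at h
    simpa using h

/-- The counit exists. -/
theorem exists_counit : ∃ ε : A →ₗ[ℂ] ℂ,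
    (∀ a b : A, LinearMap.mul' ℂ A (H.T₁.symm (a ⊗ₜ b)) = ε a • b) ∧
    ∀ a b : A, LinearMap.mul' ℂ A (H.T₂.symm (a ⊗ₜ b)) = ε b • a := by
  obtain ⟨x₀, hx₀⟩ := H.exists_φ_eq_one
  -- An identity of the form `x ⊗ f(y, b) = g(x, y) ⊗ b` forces `f(y, b)` and `g(x, y)` to be the
  -- same scalar multiple of `b` and of `x`. Slicing with `φ` at `x₀`, where `φ(x₀) = 1`, reads off
  -- this scalar `ε(y)`.
  have key : ∀ x y b : A, x ⊗ₜ[ℂ] LinearMap.mul' ℂ A (H.T₁.symm (y ⊗ₜ b)) =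
      LinearMap.mul' ℂ A (H.T₂.symm (x ⊗ₜ y)) ⊗ₜ[ℂ] b := by
    intro x y b
    rw [← H.lTensor_mul_T₁_symm b, LinearEquiv.apply_symm_apply]
    simp
  have h1 : ∀ y b : A, LinearMap.mul' ℂ A (H.T₁.symm (y ⊗ₜ b)) =
      H.φ (LinearMap.mul' ℂ A (H.T₂.symm (x₀ ⊗ₜ y))) • b := by
    intro y b
    have := congrArg (lslice H.φ) (key x₀ y b)
    simpa [hx₀] using this
  refine ⟨H.φ ∘ₗ LinearMap.mul' ℂ A ∘ₗ H.T₂.symm.toLinearMap ∘ₗ TensorProduct.mk ℂ A A x₀,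
    h1, fun a b => ?_⟩
  have := congrArg (slice H.φ) (key a b x₀)
  rw [h1] at this
  simp only [slice_tmul, map_smul, hx₀, smul_eq_mul, mul_one, one_smul] at this
  exact this.symm

/-- The counit. -/
def counit : A →ₗ[ℂ] ℂ := H.exists_counit.choose

theorem lslice_counit_T₁ (s : A ⊗[ℂ] A) :
    lslice H.counit (H.T₁ s) = LinearMap.mul' ℂ A s := by
  have h : ∀ t, LinearMap.mul' ℂ A (H.T₁.symm t) = lslice H.counit t := by
    intro t
    induction t with
    | zero => simp
    | add x y h₁ h₂ => simp only [map_add, h₁, h₂]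
    | tmul a b => rw [lslice_tmul]; exact H.exists_counit.choose_spec.1 a b
  rw [← h, LinearEquiv.symm_apply_apply]

theorem slice_counit_T₂ (s : A ⊗[ℂ] A) :
    slice H.counit (H.T₂ s) = LinearMap.mul' ℂ A s := by
  have h : ∀ t, LinearMap.mul' ℂ A (H.T₂.symm t) = slice H.counit t := by
    intro t
    induction t with
    | zero => simp
    | add x y h₁ h₂ => simp only [map_add, h₁, h₂]
    | tmul a b => rw [slice_tmul]; exact H.exists_counit.choose_spec.2 a b
  rw [← h, LinearEquiv.symm_apply_apply]

theorem slice_counit_T₃ (s : A ⊗[ℂ] A) :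
    slice H.counit (H.T₃ s) = LinearMap.mul' ℂ A s := by
  induction s with
  | zero => simp
  | add x y h₁ h₂ => simp only [map_add, h₁, h₂]
  | tmul y z =>
    refine H.nondegenerate.eq_of_mul_left fun p => ?_
    have h := congrArg (slice H.counit) (H.rTensor_mulRight_T₂ p y z)
    rw [slice_rTensor, slice_rTensor, slice_counit_T₂] at h
    simpa [mul_assoc] using h.symm

theorem lslice_counit_T₄ (s : A ⊗[ℂ] A) :
    lslice H.counit (H.T₄ s) = LinearMap.mul' ℂ A s := by
  induction s with
  | zero => simp
  | add x y h₁ h₂ => simp only [map_add, h₁, h₂]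
  | tmul q y =>
    refine H.nondegenerate.eq_of_mul_right fun z => ?_
    have h := congrArg (lslice H.counit) (H.lTensor_mulRight_T₄ q y z)
    rw [lslice_lTensor, lslice_lTensor, lslice_counit_T₁] at h
    simpa [mul_assoc] using h

/-- The counit property gives `(ε ⊗ ι)(Δ(x)w) = x (ε ⊗ ι)(w)`, as tensors `w = Δ(p)(1 ⊗ q)` span.
For `w = b ⊗ q` this says that `ε(· b)` and `ε(b) ε` agree on the first leg of every `Δ(p)(1 ⊗ q)`,
hence everywhere. -/
theorem counit_mul (a b : A) : H.counit (a * b) = H.counit a * H.counit b := by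
  obtain ⟨y₀, hy₀⟩ := H.exists_φ_eq_one
  have h1 : ∀ (x : A) (w : A ⊗[ℂ] A), lslice H.counit (left (H.Δ x) w) = x * lslice H.counit w := by
    intro x w
    obtain ⟨w, rfl⟩ := H.T₁.surjective w
    induction w with
    | zero => simp
    | add x y h₁ h₂ => simp only [map_add, mul_add, h₁, h₂]
    | tmul p q => simp [H.left_T₁, lslice_counit_T₁, mul_assoc]
  have h2 : ∀ t : A ⊗[ℂ] A, lslice (H.counit ∘ₗ LinearMap.mulRight ℂ b) t =
      H.counit b • lslice H.counit t := by
    intro t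
    obtain ⟨t, rfl⟩ := H.T₁.surjective t
    induction t with
    | zero => simp
    | add x y h₁ h₂ => simp only [map_add, smul_add, h₁, h₂]
    | tmul p q =>
      rw [← lslice_rTensor, ← H.left_tmul_eq, h1, lslice_counit_T₁]
      simp [mul_smul_comm]
  have h3 := congrArg H.φ (h2 (a ⊗ₜ y₀))
  simpa [hy₀, mul_comm] using h3

/-- The product is `(ε ⊗ ι) ∘ T₁`, a composition of surjections. Were `ε` zero, all products would
vanish, so `A = 0`, contrary to `φ ≠ 0`. -/
theorem mul'_surjective (H : AlgebraicQuantumGroup A) : Function.Surjective (LinearMap.mul' ℂ A) := by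
  have hε : H.counit ≠ 0 := by
    intro h
    obtain ⟨x, hx⟩ := H.exists_φ_eq_one
    have hx0 : x = 0 := by
      refine H.nondegenerate.1 x fun y => ?_
      have := H.lslice_counit_T₁ (x ⊗ₜ y)
      rw [h] at this
      simpa [lslice] using this.symm
    simp [hx0] at hx
  intro a
  obtain ⟨t, rfl⟩ := lslice_surjective (Y := A) hε a
  exact ⟨H.T₁.symm t, by rw [← lslice_counit_T₁, LinearEquiv.apply_symm_apply]⟩

/-- `T₃` intertwines `b ▷ ⊗ ι` and `ι ⊗ b ▷`. -/
theorem lTensor_act_T₃ (b : H.Dual) (s : A ⊗[ℂ] A) :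
    LinearMap.lTensor A (H.act b) (H.T₃ s) = H.T₃ (LinearMap.rTensor A (H.act b) s) :=
  H.lTensor_T₃ _ (H.lTensor_act b) s

/-- If `T₃ s = c ⊗ c'`, left invariance gives `(φ(· c') ▷ x) c = (φ(x ·) ⊗ ι)(s)`; apply `φ`. -/
theorem toDual_mul (c c' : A) : H.toDual c * H.toDual c' =
    H.toDual (slice H.φ (H.T₃.symm (c ⊗ₜ c'))) := by
  refine H.dual_ext fun x => ?_
  rw [eval_mul, eval_toDual, H.act_mul _ x c c' (LinearEquiv.apply_symm_apply _ _), eval_toDual]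
  generalize H.T₃.symm (c ⊗ₜ c') = s
  induction s with
  | zero => simp
  | add s t h₁ h₂ => simp only [map_add, mul_add, h₁, h₂]
  | tmul p q => simp [mul_comm, mul_smul_comm]

/-- By `toDual_mul` the product of `B` is `(ι ⊗ φ) ∘ T₃⁻¹` in terms of `A`. -/
theorem dual_mul'_surjective : Function.Surjective (LinearMap.mul' ℂ H.Dual) := by
  intro b
  obtain ⟨d, rfl⟩ := H.toDual_surjective b
  obtain ⟨s, rfl⟩ := slice_surjective (X := A) H.φ_ne_zero d
  refine ⟨TensorProduct.map H.toDual H.toDual (H.T₃ s), ?_⟩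
  have : ∀ t, LinearMap.mul' ℂ H.Dual (TensorProduct.map H.toDual H.toDual t) =
      H.toDual (slice H.φ (H.T₃.symm t)) := by
    intro t
    induction t with
    | zero => simp
    | add s t h₁ h₂ => simp only [map_add, h₁, h₂]
    | tmul p q => simp [toDual_mul]
  rw [this, LinearEquiv.symm_apply_apply]

/-- For `b = φ(· c')`, `act_mul` computes `(b ▷ n) c` from the functional `φ(n ·)`, whose values are
the pairings of `n` with the `φ(· x)`. With the next lemma, the annihilator of `B` in `A` is `N = {n
| B ▷ n = 0}`. -/
theorem act_eq_zero_of_eval {n : A} (h : ∀ b, H.eval b n = 0) (b : H.Dual) : H.act b n = 0 := by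
  obtain ⟨c', rfl⟩ := H.toDual_surjective b
  refine H.nondegenerate.1 _ fun c => ?_
  rw [H.act_mul _ n c c' (LinearEquiv.apply_symm_apply _ _)]
  have : H.φ ∘ₗ LinearMap.mulLeft ℂ n = 0 := LinearMap.ext fun x => h (H.toDual x)
  rw [this]
  simp

/-- `⟨n, b b'⟩ = ⟨b' ▷ n, b⟩`, and `B` is spanned by products. -/
theorem eval_eq_zero_of_act {n : A} (h : ∀ b, H.act b n = 0) (b : H.Dual) : H.eval b n = 0 := by
  obtain ⟨t, rfl⟩ := H.dual_mul'_surjective b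
  induction t with
  | zero => simp
  | add s t h₁ h₂ => simp only [map_add, LinearMap.add_apply, h₁, h₂, add_zero]
  | tmul b b' => simp [h]

/-- Let `N = {n | B ▷ n = 0}` and `φ(u) = 1`. As `T₃` intertwines `b ▷ ⊗ ι` with `ι ⊗ b ▷`, the
tensor `s = T₃⁻¹(u ⊗ n)` lies in `N ⊗ A`, where `φ ∘ m` vanishes because `N` annihilates `B`. But `m
= (ι ⊗ ε) ∘ T₃`, so `φ(m(s)) = ε(n) φ(u)`. -/
theorem counit_eq_zero_of_act {n : A} (h : ∀ b, H.act b n = 0) : H.counit n = 0 := by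
  obtain ⟨u, hu⟩ := H.exists_φ_eq_one
  obtain ⟨s, hs⟩ := H.T₃.surjective (u ⊗ₜ n)
  have h1 : ∀ b, LinearMap.rTensor A (H.act b) s = 0 := by
    intro b
    apply H.T₃.injective
    rw [← lTensor_act_T₃, hs]
    simp [h]
  have h2 := mem_span_tmul_of_rTensor _ s h1
  have h3 : H.φ (LinearMap.mul' ℂ A s) = 0 := by
    clear hs h1
    induction h2 using Submodule.span_induction with
    | mem x hx =>
      obtain ⟨x, y, hx, rfl⟩ := hx
      exact H.eval_eq_zero_of_act hx (H.toDual y)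
    | zero => simp
    | add x y _ _ h₁ h₂ => simp only [map_add, h₁, h₂, add_zero]
    | smul r x _ h => simp [h]
  rw [← slice_counit_T₃, hs] at h3
  simpa [hu] using h3

/-- The elements of `B` separate the points of `A`. -/
theorem eq_zero_of_act {n : A} (h : ∀ b, H.act b n = 0) : n = 0 := by
  refine H.nondegenerate.1 n fun z => ?_
  -- Hence `T₃ (n ⊗ z)` lies in `A ⊗ N`, with `N = {y | B ▷ y = 0}`. There `ι ⊗ ε` vanishes, whereas
  -- it maps `T₃ (n ⊗ z)` to `n z`.
  have h1 : ∀ b, LinearMap.lTensor A (H.act b) (H.T₃ (n ⊗ₜ z)) = 0 := by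
    intro b
    rw [lTensor_act_T₃, LinearMap.rTensor_tmul, h, TensorProduct.zero_tmul, map_zero]
  have h2 := mem_span_tmul_of_lTensor _ _ h1
  have h3 : ∀ t ∈ Submodule.span ℂ {s : A ⊗[ℂ] A | ∃ x y, (∀ b, H.act b y = 0) ∧ s = x ⊗ₜ y},
      slice H.counit t = 0 := by
    intro t ht
    induction ht using Submodule.span_induction with
    | mem x hx =>
      obtain ⟨x, y, hy, rfl⟩ := hx
      simp [H.counit_eq_zero_of_act hy]
    | zero => simp
    | add x y _ _ h₁ h₂ => simp only [map_add, h₁, h₂, add_zero]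
    | smul r x _ h => simp [h]
  have h4 := h3 _ h2
  rw [slice_counit_T₃] at h4
  simpa using h4

theorem eq_zero_of_eval {n : A} (h : ∀ b, H.eval b n = 0) : n = 0 :=
  H.eq_zero_of_act (H.act_eq_zero_of_eval h)

theorem eq_of_eval {m n : A} (h : ∀ b, H.eval b m = H.eval b n) : m = n := by
  rw [← sub_eq_zero]
  exact H.eq_zero_of_eval fun b => by rw [map_sub, h, sub_self]

/-- `x ⊗ z ↦ (ι ⊗ φ)(Δ(x)(1 ⊗ z))`. -/
def sliceT₁ : A ⊗[ℂ] A →ₗ[ℂ] A := slice H.φ ∘ₗ H.T₁.toLinearMap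

/-- `x ⊗ z ↦ (ι ⊗ φ)((1 ⊗ x)Δ(z))`. -/
def sliceT₄ : A ⊗[ℂ] A →ₗ[ℂ] A := slice H.φ ∘ₗ H.T₄.toLinearMap

theorem sliceT₁_surjective : Function.Surjective H.sliceT₁ :=
  (slice_surjective H.φ_ne_zero).comp H.T₁.surjective

theorem sliceT₄_surjective : Function.Surjective H.sliceT₄ :=
  (slice_surjective H.φ_ne_zero).comp H.T₄.surjective

theorem sliceT₁_tmul (x z : A) : H.sliceT₁ (x ⊗ₜ z) = H.act (H.toDual z) x :=
  (H.act_toDual z x).symm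

theorem act_surjective (a : A) :
    a ∈ Submodule.span ℂ {y | ∃ b x, y = H.act b x} := by
  obtain ⟨t, rfl⟩ := H.sliceT₁_surjective a
  induction t with
  | zero => simp
  | add s t h₁ h₂ => rw [map_add]; exact Submodule.add_mem _ h₁ h₂
  | tmul x z => exact Submodule.subset_span ⟨_, _, H.sliceT₁_tmul x z⟩

/-- If `b B = 0`, then `b` vanishes on `B ▷ A`, which spans `A`. If `B b = 0`, separation of points
gives `b ▷ A = 0`, so `(ι ⊗ b) ∘ T₂ = 0`, and `T₂` is surjective. -/
theorem dual_nondegenerate : IsNondegenerate H.Dual := by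
  refine ⟨fun b hb => H.dual_ext fun a => ?_, fun b hb => H.dual_ext fun a => ?_⟩
  · have ha := H.act_surjective a
    induction ha using Submodule.span_induction with
    | mem x hx =>
      obtain ⟨b', x, rfl⟩ := hx
      rw [← eval_mul, hb]; simp
    | zero => simp
    | add x y _ _ h₁ h₂ => simp only [map_add, h₁, h₂]
    | smul r x _ h => simp only [map_smul, h]
  · have h1 : ∀ a, H.act b a = 0 := fun a => H.eq_zero_of_eval fun b' => by
      rw [← eval_mul, hb]; simp
    obtain ⟨u, hu⟩ := H.exists_φ_eq_one
    have h2 : ∀ t, slice (H.eval b) (H.T₂ t) = 0 := by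
      intro t
      induction t with
      | zero => simp
      | add s t h₁ h₂ => simp only [map_add, h₁, h₂, add_zero]
      | tmul p q => rw [← mul_act, h1, mul_zero]
    have h3 := congrArg H.φ (h2 (H.T₂.symm (u ⊗ₜ a)))
    rw [LinearEquiv.apply_symm_apply] at h3
    simpa [hu] using h3

theorem heisAct_surjective (a : A) :
    a ∈ Submodule.span ℂ {y | ∃ t x, y = H.heisAct t x} := by
  obtain ⟨t, rfl⟩ := H.mul'_surjective a
  induction t with
  | zero => simp
  | add s t h₁ h₂ => rw [map_add]; exact Submodule.add_mem _ h₁ h₂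
  | tmul p q =>
    have hq := H.act_surjective q
    induction hq using Submodule.span_induction with
    | mem x hx =>
      obtain ⟨b', x, rfl⟩ := hx
      exact Submodule.subset_span ⟨H.heis p b', x, by simp⟩
    | zero => simp
    | add x y _ _ h₁ h₂ =>
      rw [TensorProduct.tmul_add, map_add]; exact Submodule.add_mem _ h₁ h₂
    | smul r x _ h => rw [TensorProduct.tmul_smul, map_smul]; exact Submodule.smul_mem _ _ h

/-- The action on `A` is faithful. An element `s` with `s AB = 0` kills `AB ▷ A`, which spans `A`;
if `AB s = 0`, then all `p (b ▷ (s ▷ a))` vanish, so `s ▷ a = 0`. -/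
theorem heisenberg_nondegenerate : IsNondegenerate H.Heisenberg := by
  refine ⟨fun s hs => H.heisAct_injective s fun a => ?_,
    fun s hs => H.heisAct_injective s fun a => H.eq_zero_of_act fun b => ?_⟩
  · have ha := H.heisAct_surjective a
    induction ha using Submodule.span_induction with
    | mem x hx =>
      obtain ⟨t, x, rfl⟩ := hx
      rw [← heisAct_mul, hs]; simp
    | zero => simp
    | add x y _ _ h₁ h₂ => simp only [map_add, h₁, h₂, add_zero]
    | smul r x _ h => simp only [map_smul, h, smul_zero]
  · refine H.nondegenerate.2 _ fun p => ?_
    rw [← heisAct_heis, ← heisAct_mul, hs]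
    simp

end AlgebraicQuantumGroup

/-! ### The antipode, the right integral, and `φ(· A) = ψ(A ·)` -/

namespace AlgebraicQuantumGroup

variable {A : Type u} [NonUnitalRing A] [Module ℂ A] [IsScalarTower ℂ A A] [SMulCommClass ℂ A A]
variable (H : AlgebraicQuantumGroup A)

theorem eq_of_slice_eval {X : Type*} [AddCommGroup X] [Module ℂ X] {s t : X ⊗[ℂ] A}
    (h : ∀ b, slice (H.eval b) s = slice (H.eval b) t) : s = t :=
  eq_of_lTensor (fun b => H.eval b) (fun _ hx => H.eq_zero_of_eval hx)
    fun b => (TensorProduct.rid ℂ X).injective (h b)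

/-- Both sides are `(ι ⊗ φ)((1 ⊗ x)Δ(q)(1 ⊗ c))`. -/
theorem slice_eval_T₄ (c x q : A) : slice (H.eval (H.toDual c)) (H.T₄ (x ⊗ₜ q)) =
    slice (H.φ ∘ₗ LinearMap.mulLeft ℂ x) (H.T₁ (q ⊗ₜ c)) := by
  rw [← slice_lTensor, ← H.lTensor_mulRight_T₄, slice_lTensor]
  rfl

/-- Coassociativity for `T₄` is inherited from that for `T₁`: slice the last leg by elements of `B`,
where `slice_eval_T₄` converts `T₄` to `T₁` and `coassoc_slice` applies. As `B` separates points,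
the unsliced tensors `E₁` and `E₂` agree. -/
theorem coassoc_slice_T₄ (p q x : A) (ω : A →ₗ[ℂ] ℂ) :
    H.T₂ (p ⊗ₜ slice ω (H.T₄ (x ⊗ₜ q))) =
      LinearMap.lTensor A (slice ω ∘ₗ H.T₄.toLinearMap ∘ₗ TensorProduct.mk ℂ A A x)
        (H.T₂ (p ⊗ₜ q)) := by
  let E₁ : (A ⊗[ℂ] A) ⊗[ℂ] A :=
    LinearMap.rTensor A (H.T₂.toLinearMap ∘ₗ TensorProduct.mk ℂ A A p) (H.T₄ (x ⊗ₜ q))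
  let E₂ : (A ⊗[ℂ] A) ⊗[ℂ] A := (TensorProduct.assoc ℂ A A A).symm
    (LinearMap.lTensor A (H.T₄.toLinearMap ∘ₗ TensorProduct.mk ℂ A A x) (H.T₂ (p ⊗ₜ q)))
  have h₁ : ∀ χ : A →ₗ[ℂ] ℂ, slice χ E₁ = H.T₂ (p ⊗ₜ slice χ (H.T₄ (x ⊗ₜ q))) := fun χ =>
    slice_rTensor _ _ _
  have e : ∀ (χ : A →ₗ[ℂ] ℂ) (t : A ⊗[ℂ] (A ⊗[ℂ] A)),
      slice χ ((TensorProduct.assoc ℂ A A A).symm t) = LinearMap.lTensor A (slice χ) t := by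
    intro χ t
    induction t with
    | zero => simp
    | add x y h₁ h₂ => simp only [map_add, h₁, h₂]
    | tmul u v =>
      induction v with
      | zero => simp
      | add x y h₁ h₂ => simp only [TensorProduct.tmul_add, map_add, h₁, h₂]
      | tmul v w => simp
  have h₂ : ∀ χ : A →ₗ[ℂ] ℂ, slice χ E₂ = LinearMap.lTensor A
      (slice χ ∘ₗ H.T₄.toLinearMap ∘ₗ TensorProduct.mk ℂ A A x) (H.T₂ (p ⊗ₜ q)) := fun χ => by
    rw [e, ← LinearMap.lTensor_comp_apply]
  have h₃ : E₁ = E₂ := by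
    refine H.eq_of_slice_eval fun b => ?_
    obtain ⟨c, rfl⟩ := H.toDual_surjective b
    rw [h₁, h₂, slice_eval_T₄, H.coassoc_slice]
    congr 2
    ext y
    exact (H.slice_eval_T₄ c x y).symm
  rw [← h₁, ← h₂, h₃]

theorem lTensor_sliceT₄ (x p q : A) :
    LinearMap.lTensor A (H.sliceT₄ ∘ₗ TensorProduct.mk ℂ A A x) (H.T₂ (p ⊗ₜ q)) =
      H.T₂ (p ⊗ₜ (H.sliceT₄ ∘ₗ TensorProduct.mk ℂ A A x) q) :=
  (H.coassoc_slice_T₄ p q x H.φ).symm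

theorem lTensor_sliceT₁ (z p q : A) :
    LinearMap.lTensor A (H.sliceT₁ ∘ₗ (TensorProduct.mk ℂ A A).flip z) (H.T₂ (p ⊗ₜ q)) =
      H.T₂ (p ⊗ₜ (H.sliceT₁ ∘ₗ (TensorProduct.mk ℂ A A).flip z) q) :=
  (H.coassoc_slice p q z H.φ).symm

theorem sliceT₁_mul (x z u : A) : H.sliceT₁ (x ⊗ₜ z) * u =
    lslice (H.φ ∘ₗ LinearMap.mulLeft ℂ x) (H.T₃.symm (u ⊗ₜ z)) := by
  rw [sliceT₁_tmul]
  exact H.act_mul _ x u z (LinearEquiv.apply_symm_apply _ _)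

theorem slice_φ_T₂ (s : A ⊗[ℂ] A) : slice H.φ (H.T₂ s) = slice H.φ s := by
  induction s with
  | zero => simp
  | add x y h₁ h₂ => simp only [map_add, h₁, h₂]
  | tmul x y => rw [H.left_invariant', slice_tmul]

/-- Write `u ⊗ x = T₂ s`. Then `(u ⊗ x)Δ(z) = T₂ (s(1 ⊗ z))`, and left invariance makes `ι ⊗ φ`
ignore `T₂`. -/
theorem mul_sliceT₄ (x z u : A) : u * H.sliceT₄ (x ⊗ₜ z) =
    slice (H.φ ∘ₗ LinearMap.mulRight ℂ z) (H.T₂.symm (u ⊗ₜ x)) := by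
  have h1 : ∀ s, right (H.Δ z) (H.T₂ s) = H.T₂ (LinearMap.lTensor A (LinearMap.mulRight ℂ z) s) := by
    intro s
    induction s with
    | zero => simp
    | add x y h₁ h₂ => simp only [map_add, h₁, h₂]
    | tmul p q => rw [H.right_T₂]; simp
  have h2 := congrArg (slice H.φ) (H.right_tmul_eq' u x z)
  rw [slice_rTensor, ← LinearEquiv.apply_symm_apply H.T₂ (u ⊗ₜ x), h1, slice_φ_T₂,
    slice_lTensor] at h2
  exact h2.symm

theorem sliceT₄_mul (x z y : A) : H.sliceT₄ (x ⊗ₜ z) * y =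
    slice (H.φ ∘ₗ LinearMap.mulLeft ℂ x) (H.T₃ (z ⊗ₜ y)) := by
  rw [← slice_lTensor, ← H.rTensor_mulRight_T₄, slice_rTensor]
  rfl

/-- The map `sliceT₄ (x ⊗ ·)` commutes with the left coaction, so `T₃⁻¹` moves it from the second
leg to the first, where `ε` turns it into `φ(x ·)`. With its counterpart for `T₂⁻¹` below, this
shows that `sliceT₁` and `sliceT₄` have the same kernel, so the antipode is well defined and
bijective. -/
theorem lslice_counit_T₃_symm (u : A) (t : A ⊗[ℂ] A) :
    lslice H.counit (H.T₃.symm (u ⊗ₜ H.sliceT₄ t)) = H.sliceT₁ t * u := by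
  induction t with
  | zero => simp
  | add x y h₁ h₂ => simp only [map_add, TensorProduct.tmul_add, add_mul, h₁, h₂]
  | tmul x z =>
    have h := H.lTensor_T₃ _ (H.lTensor_sliceT₄ x) (H.T₃.symm (u ⊗ₜ z))
    rw [LinearEquiv.apply_symm_apply, LinearMap.lTensor_tmul, ← LinearEquiv.symm_apply_eq] at h
    have h' : H.T₃.symm (u ⊗ₜ H.sliceT₄ (x ⊗ₜ z)) = _ := h
    rw [h', lslice_rTensor, sliceT₁_mul]
    congr 2
    ext q
    change H.counit (slice H.φ (H.T₄ (x ⊗ₜ q))) = _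
    rw [apply_slice, lslice_counit_T₄]
    rfl

theorem slice_counit_T₂_symm (u : A) (t : A ⊗[ℂ] A) :
    slice H.counit (H.T₂.symm (u ⊗ₜ H.sliceT₁ t)) = u * H.sliceT₄ t := by
  induction t with
  | zero => simp
  | add x y h₁ h₂ => simp only [map_add, TensorProduct.tmul_add, mul_add, h₁, h₂]
  | tmul x z =>
    have h : ∀ s, LinearMap.lTensor A (H.sliceT₁ ∘ₗ (TensorProduct.mk ℂ A A).flip z) (H.T₂ s) =
      H.T₂ (LinearMap.lTensor A (H.sliceT₁ ∘ₗ (TensorProduct.mk ℂ A A).flip z) s) := by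
      intro s
      induction s with
      | zero => simp
      | add x y h₁ h₂ => simp only [map_add, h₁, h₂]
      | tmul p q => exact H.lTensor_sliceT₁ z p q
    replace h := h (H.T₂.symm (u ⊗ₜ x))
    rw [LinearEquiv.apply_symm_apply, LinearMap.lTensor_tmul, ← LinearEquiv.symm_apply_eq] at h
    have h' : H.T₂.symm (u ⊗ₜ H.sliceT₁ (x ⊗ₜ z)) = _ := h
    rw [h', slice_lTensor, mul_sliceT₄]
    congr 2
    ext q
    change H.counit (slice H.φ (H.T₁ (q ⊗ₜ z))) = _
    rw [apply_slice, lslice_counit_T₁]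
    rfl

theorem ker_sliceT₁ : LinearMap.ker H.sliceT₁ = LinearMap.ker H.sliceT₄ := by
  ext t
  rw [LinearMap.mem_ker, LinearMap.mem_ker]
  constructor
  · intro h
    refine H.nondegenerate.2 _ fun u => ?_
    rw [← slice_counit_T₂_symm, h]
    simp
  · intro h
    refine H.nondegenerate.1 _ fun u => ?_
    rw [← lslice_counit_T₃_symm, h]
    simp

/-- The antipode, `S((ι ⊗ φ)(Δ(x)(1 ⊗ z))) = (ι ⊗ φ)((1 ⊗ x)Δ(z))`. -/
def antipode : A ≃ₗ[ℂ] A :=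
  (H.sliceT₁.quotKerEquivOfSurjective H.sliceT₁_surjective).symm ≪≫ₗ
    Submodule.quotEquivOfEq _ _ H.ker_sliceT₁ ≪≫ₗ
    H.sliceT₄.quotKerEquivOfSurjective H.sliceT₄_surjective

@[simp] theorem antipode_sliceT₁ (t : A ⊗[ℂ] A) : H.antipode (H.sliceT₁ t) = H.sliceT₄ t := by
  have : (H.sliceT₁.quotKerEquivOfSurjective H.sliceT₁_surjective).symm (H.sliceT₁ t) =
      Submodule.Quotient.mk t := by
    rw [LinearEquiv.symm_apply_eq]; rfl
  simp only [antipode, LinearEquiv.trans_apply, this]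
  rfl

theorem mul_antipode (u a : A) :
    u * H.antipode a = slice H.counit (H.T₂.symm (u ⊗ₜ a)) := by
  obtain ⟨t, rfl⟩ := H.sliceT₁_surjective a
  rw [antipode_sliceT₁, slice_counit_T₂_symm]

/-- By `mul_antipode`, `u S(a) = (ι ⊗ ε)(T₂⁻¹(u ⊗ a))`. The map `Θ` computes `T₂⁻¹(u ⊗ ab)` from
`T₂⁻¹(u ⊗ b)`, and multiplicativity of `ε` then produces `u S(b) S(a)`. -/
theorem antipode_mul (a b : A) : H.antipode (a * b) = H.antipode b * H.antipode a := by
  refine H.nondegenerate.eq_of_mul_left fun u => ?_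
  -- `T₂⁻¹(u ⊗ ab) = ∑ T₂⁻¹(p ⊗ a)(1 ⊗ q)`, where `T₂⁻¹(u ⊗ b) = ∑ p ⊗ q`
  have h1 : ∀ q s, H.T₂ (LinearMap.lTensor A (LinearMap.mulRight ℂ q) s) =
      right (H.Δ q) (H.T₂ s) := by
    intro q s
    induction s with
    | zero => simp
    | add x y h₁ h₂ => simp only [map_add, h₁, h₂]
    | tmul p q => rw [H.right_T₂]; simp
  let Θ : A ⊗[ℂ] A →ₗ[ℂ] A ⊗[ℂ] A := TensorProduct.lift (LinearMap.mk₂ ℂ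
    (fun p q => LinearMap.lTensor A (LinearMap.mulRight ℂ q) (H.T₂.symm (p ⊗ₜ a)))
    (by intros; simp [TensorProduct.add_tmul])
    (by intros; simp [← TensorProduct.smul_tmul'])
    (by
      intro p q q'
      have : LinearMap.mulRight ℂ (q + q') = LinearMap.mulRight ℂ q + LinearMap.mulRight ℂ q' := by
        ext; simp [mul_add]
      rw [this, LinearMap.lTensor_add, LinearMap.add_apply])
    (by
      intro r p q
      have : LinearMap.mulRight ℂ (r • q) = r • LinearMap.mulRight ℂ q := by
        ext; simp [mul_smul_comm]
      rw [this, LinearMap.lTensor_smul, LinearMap.smul_apply]))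
  have hΘ : ∀ s, H.T₂ (Θ s) = LinearMap.lTensor A (LinearMap.mulLeft ℂ a) (H.T₂ s) := by
    intro s
    induction s with
    | zero => simp
    | add x y h₁ h₂ => simp only [map_add, h₁, h₂]
    | tmul p q =>
      change H.T₂ (LinearMap.lTensor A (LinearMap.mulRight ℂ q) (H.T₂.symm (p ⊗ₜ a))) = _
      rw [h1, LinearEquiv.apply_symm_apply, H.right_tmul_eq]
      rfl
  have hΘ' : ∀ s, slice H.counit (Θ s) = slice H.counit s * H.antipode a := by
    intro s
    induction s with
    | zero => simp
    | add x y h₁ h₂ => simp only [map_add, add_mul, h₁, h₂]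
    | tmul p q =>
      change slice H.counit
        (LinearMap.lTensor A (LinearMap.mulRight ℂ q) (H.T₂.symm (p ⊗ₜ a))) = _
      have : H.counit ∘ₗ LinearMap.mulRight ℂ q = H.counit q • H.counit := by
        ext y
        simp [counit_mul, mul_comm]
      rw [slice_lTensor, this, slice_tmul, smul_mul_assoc, mul_antipode]
      simp [slice]
  have h2 := hΘ (H.T₂.symm (u ⊗ₜ b))
  rw [LinearEquiv.apply_symm_apply, LinearMap.lTensor_tmul, LinearMap.mulLeft_apply,
    ← LinearEquiv.eq_symm_apply] at h2
  rw [mul_antipode, ← h2, hΘ', ← mul_antipode, mul_assoc]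

theorem antipode_symm_mul (a b : A) :
    H.antipode.symm (a * b) = H.antipode.symm b * H.antipode.symm a := by
  rw [LinearEquiv.symm_apply_eq, antipode_mul]
  simp

theorem map_antipode_rTensor_mulLeft (e : A) (t : A ⊗[ℂ] A) :
    TensorProduct.map H.antipode.toLinearMap H.antipode.toLinearMap
      (LinearMap.rTensor A (LinearMap.mulLeft ℂ e) t) =
    LinearMap.rTensor A (LinearMap.mulRight ℂ (H.antipode e))
      (TensorProduct.map H.antipode.toLinearMap H.antipode.toLinearMap t) := by
  induction t with
  | zero => simp
  | add x y h₁ h₂ => simp only [map_add, h₁, h₂]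
  | tmul x y => simp [antipode_mul]

theorem map_antipode_lTensor_mulLeft (e : A) (t : A ⊗[ℂ] A) :
    TensorProduct.map H.antipode.toLinearMap H.antipode.toLinearMap
      (LinearMap.lTensor A (LinearMap.mulLeft ℂ e) t) =
    LinearMap.lTensor A (LinearMap.mulRight ℂ (H.antipode e))
      (TensorProduct.map H.antipode.toLinearMap H.antipode.toLinearMap t) := by
  induction t with
  | zero => simp
  | add x y h₁ h₂ => simp only [map_add, h₁, h₂]
  | tmul x y => simp [antipode_mul]

/-- `(S ⊗ S)((1 ⊗ p)Δ(a)) = σ(Δ(S(a))(S(p) ⊗ 1))`. -/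
theorem map_antipode_T₄ (p a : A) :
    TensorProduct.map H.antipode.toLinearMap H.antipode.toLinearMap (H.T₄ (p ⊗ₜ a)) =
      TensorProduct.comm ℂ A A (H.T₃ (H.antipode a ⊗ₜ H.antipode p)) := by
  obtain ⟨t, rfl⟩ := H.sliceT₁_surjective a
  induction t with
  | zero => simp
  | add x y h₁ h₂ => simp only [map_add, TensorProduct.tmul_add, TensorProduct.add_tmul, h₁, h₂]
  | tmul x z =>
    refine eq_of_rTensor (fun e => LinearMap.mulRight ℂ (H.antipode e))
      (fun y hy => H.nondegenerate.1 y fun e => ?_) fun e => ?_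
    · simpa using hy (H.antipode.symm e)
    -- Here `a = b ▷ x` with `b = φ(· z)`, and `(e ⊗ 1)Δ(a) = (ι ⊗ b ▷)((e ⊗ 1)Δ(x))`. `G` and `K`
    -- both contract `z' ⊗ z''` with `e' ⊗ x'` by the scalar `φ(x' z'')`; `G` keeps `z'` and `K`
    -- keeps `e'`. So `hGK` trades a contraction along `Δ(x)` for one along `Δ(z)`: `S(p (b ▷ ·))`
    -- is `G` of `Δ(z)(S(p) ⊗ 1)`, and `S ∘ K` for `(e ⊗ 1)Δ(x)` is `sliceT₄ (x ⊗ ·)` followed by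
    -- right multiplication by `S(e)`. The map `sliceT₄ (x ⊗ ·)` passes through `T₃` and creates
    -- `S(a)`.
    · let G : A ⊗[ℂ] A →ₗ[ℂ] A →ₗ[ℂ] A := TensorProduct.lift (LinearMap.mk₂ ℂ
        (fun z' z'' => (H.fourier z'').smulRight z')
        (by intros; ext; simp) (by intros; ext; exact smul_comm _ _ _)
        (by intros; ext; simp [add_smul]) (by intros; ext; simp [mul_smul]))
      let K : A ⊗[ℂ] A →ₗ[ℂ] A →ₗ[ℂ] A := TensorProduct.lift (LinearMap.mk₂ ℂ
        (fun e' x' => (H.fourier.flip x').smulRight e')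
        (by intros; ext; simp) (by intros; ext; exact smul_comm _ _ _)
        (by intros; ext; simp [add_smul]) (by intros; ext; simp [mul_smul]))
      have hG : ∀ r x', G r x' = slice (H.φ ∘ₗ LinearMap.mulLeft ℂ x') r := by
        intro r x'
        induction r with
        | zero => simp
        | add s t h₁ h₂ => simp only [map_add, LinearMap.add_apply, h₁, h₂]
        | tmul z' z'' => simp [G]
      have hK : ∀ w z'', K w z'' = slice (H.eval (H.toDual z'')) w := by
        intro w z''
        induction w with
        | zero => simp
        | add s t h₁ h₂ => simp only [map_add, LinearMap.add_apply, h₁, h₂]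
        | tmul e' x' => simp [K]
      have hGK : ∀ r w, TensorProduct.map H.antipode.toLinearMap (G r) w =
          TensorProduct.comm ℂ A A
            (LinearMap.lTensor A (H.antipode.toLinearMap ∘ₗ K w) r) := by
        intro r w
        induction w with
        | zero => simp
        | add s t h₁ h₂ =>
          simp only [map_add, h₁, h₂, LinearMap.comp_add, LinearMap.lTensor_add,
            LinearMap.add_apply]
        | tmul e' x' =>
          induction r with
          | zero => simp
          | add s t h₁ h₂ =>
            simp only [map_add, ← h₁, ← h₂, TensorProduct.map_add_right, LinearMap.add_apply]
          | tmul z' z'' => simp [G, K]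
      have h1 : H.sliceT₁ (x ⊗ₜ z) = H.act (H.toDual z) x := H.sliceT₁_tmul x z
      have h2 : H.antipode.toLinearMap ∘ₗ LinearMap.mulLeft ℂ p ∘ₗ H.act (H.toDual z) =
          G (H.T₃ (z ⊗ₜ H.antipode p)) := by
        ext x'
        rw [hG, ← sliceT₄_mul, ← antipode_sliceT₁, ← antipode_mul, sliceT₁_tmul]
        rfl
      have h3 : H.antipode.toLinearMap ∘ₗ K (H.T₂ (e ⊗ₜ x)) =
          LinearMap.mulRight ℂ (H.antipode e) ∘ₗ H.sliceT₄ ∘ₗ TensorProduct.mk ℂ A A x := by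
        ext z''
        simp only [LinearMap.comp_apply, hK, LinearMap.mulRight_apply, TensorProduct.mk_apply]
        rw [← antipode_sliceT₁, ← antipode_mul, sliceT₁_tmul, mul_act]
        rfl
      rw [← map_antipode_rTensor_mulLeft, ← H.lTensor_mulLeft_T₂, h1, ← lTensor_act,
        ← LinearMap.lTensor_comp_apply, ← LinearMap.comp_apply, LinearMap.map_comp_lTensor, h2,
        hGK, h3, LinearMap.lTensor_comp_apply, comm_lTensor, H.lTensor_T₃ _ (H.lTensor_sliceT₄ x),
        LinearMap.rTensor_tmul, ← h1, antipode_sliceT₁]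
      rfl

/-- `(S ⊗ S)((k ⊗ 1)Δ(x)) = σ(Δ(S(x))(1 ⊗ S(k)))`. -/
theorem map_antipode_T₂ (k x : A) :
    TensorProduct.map H.antipode.toLinearMap H.antipode.toLinearMap (H.T₂ (k ⊗ₜ x)) =
      TensorProduct.comm ℂ A A (H.T₁ (H.antipode x ⊗ₜ H.antipode k)) := by
  refine eq_of_lTensor (fun e => LinearMap.mulRight ℂ (H.antipode e))
    (fun y hy => H.nondegenerate.1 y fun e => ?_) fun p => ?_
  · simpa using hy (H.antipode.symm e)
  · rw [← map_antipode_lTensor_mulLeft, H.lTensor_mulLeft_T₂, map_antipode_rTensor_mulLeft,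
      map_antipode_T₄, ← comm_lTensor, H.lTensor_mulRight_T₃, comm_rTensor]

/-- The right integral `φ ∘ S`. -/
def ψ : A →ₗ[ℂ] ℂ := H.φ ∘ₗ H.antipode.toLinearMap

theorem ψ_apply (x : A) : H.ψ x = H.φ (H.antipode x) := rfl

/-- Since `S` flips the coproduct (`map_antipode_T₄`), this is left invariance of `φ` transported by
`S`. -/
theorem right_invariant (p q : A) : lslice H.ψ (H.T₄ (p ⊗ₜ q)) = H.ψ q • p := by
  apply H.antipode.injective
  have h : ∀ t : A ⊗[ℂ] A, H.antipode (lslice H.ψ t) = lslice H.φ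
      (TensorProduct.map H.antipode.toLinearMap H.antipode.toLinearMap t) := by
    intro t
    induction t with
    | zero => simp
    | add s t h₁ h₂ => simp only [map_add, h₁, h₂]
    | tmul x y => simp [ψ_apply]
  rw [h, map_antipode_T₄, lslice_comm, H.left_invariant, map_smul, ψ_apply]

theorem ψ_mul_sliceT₁ (k x z : A) : H.ψ (k * H.sliceT₁ (x ⊗ₜ z)) =
    H.φ (x * lslice H.φ (H.T₃ (z ⊗ₜ H.antipode k))) := by
  rw [ψ_apply, antipode_mul, antipode_sliceT₁, sliceT₄_mul, apply_slice]
  rfl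

/-- Here `S ⊗ S` is applied to `(k ⊗ 1)Δ(x)`. Comparison with `ψ_mul_sliceT₁` gives `φ(x d) = ψ(k'
x)` for all `x`, where `d = (φ ⊗ ι)(Δ(z)(S(k) ⊗ 1))` and `k' = S⁻¹((φS⁻² ⊗ ι)(Δ(S(k))(S²(z) ⊗ 1)))`.
As `z` and `k` vary, the `d` span `A`, and so do the `k'`. -/
theorem ψ_mul_sliceT₁' (k x z : A) : H.ψ (k * H.sliceT₁ (x ⊗ₜ z)) =
    H.ψ (H.antipode.symm (lslice (H.φ ∘ₗ H.antipode.symm.toLinearMap ∘ₗ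
      H.antipode.symm.toLinearMap)
        (H.T₃ (H.antipode k ⊗ₜ H.antipode (H.antipode z)))) * x) := by
  have h : ∀ w : A ⊗[ℂ] A, H.ψ (slice (H.eval (H.toDual z)) w) =
      H.φ (H.antipode.symm (H.antipode z * lslice H.φ
        (TensorProduct.map H.antipode.toLinearMap H.antipode.toLinearMap w))) := by
    intro w
    induction w with
    | zero => simp
    | add s t h₁ h₂ => simp only [map_add, mul_add, h₁, h₂]
    | tmul a b => simp [ψ_apply, antipode_symm_mul, mul_comm, mul_smul_comm]
  have h1 : H.sliceT₁ (H.antipode x ⊗ₜ H.antipode k) =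
      H.antipode.symm (H.sliceT₄ (H.antipode x ⊗ₜ H.antipode k)) := by
    rw [LinearEquiv.eq_symm_apply, antipode_sliceT₁]
  have h2 : H.antipode z * H.sliceT₁ (H.antipode x ⊗ₜ H.antipode k) = H.antipode.symm
      (slice (H.φ ∘ₗ LinearMap.mulLeft ℂ (H.antipode x))
        (H.T₃ (H.antipode k ⊗ₜ H.antipode (H.antipode z)))) := by
    rw [h1, ← sliceT₄_mul, antipode_symm_mul, LinearEquiv.symm_apply_apply]
  rw [sliceT₁_tmul, mul_act, h, map_antipode_T₂, lslice_comm]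
  change H.φ (H.antipode.symm (_ * H.sliceT₁ _)) = _
  rw [h2, ψ_apply, antipode_mul, LinearEquiv.apply_symm_apply]
  exact apply_slice (H.φ ∘ₗ H.antipode.symm.toLinearMap ∘ₗ H.antipode.symm.toLinearMap) _ _

theorem exists_ψ_eq (d : A) : ∃ k, ∀ x, H.φ (x * d) = H.ψ (k * x) := by
  obtain ⟨t, rfl⟩ := lslice_surjective (Y := A) H.φ_ne_zero d
  obtain ⟨t, rfl⟩ := H.T₃.surjective t
  induction t with
  | zero => exact ⟨0, by simp⟩
  | add s t h₁ h₂ =>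
    obtain ⟨k, hk⟩ := h₁
    obtain ⟨l, hl⟩ := h₂
    exact ⟨k + l, fun x => by simp [mul_add, add_mul, hk, hl]⟩
  | tmul z y =>
    obtain ⟨k, rfl⟩ := H.antipode.surjective y
    exact ⟨_, fun x => by rw [← ψ_mul_sliceT₁, ψ_mul_sliceT₁']⟩

theorem exists_φ_eq (k : A) : ∃ d, ∀ x, H.ψ (k * x) = H.φ (x * d) := by
  obtain ⟨g, rfl⟩ := H.antipode.symm.surjective k
  have hne : H.φ ∘ₗ H.antipode.symm.toLinearMap ∘ₗ H.antipode.symm.toLinearMap ≠ 0 := by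
    intro h
    obtain ⟨x, hx⟩ := H.exists_φ_eq_one
    have := LinearMap.congr_fun h (H.antipode (H.antipode x))
    simp [hx] at this
  obtain ⟨t, rfl⟩ := lslice_surjective (Y := A) hne g
  obtain ⟨t, rfl⟩ := H.T₃.surjective t
  induction t with
  | zero => exact ⟨0, by simp⟩
  | add s t h₁ h₂ =>
    obtain ⟨k, hk⟩ := h₁
    obtain ⟨l, hl⟩ := h₂
    exact ⟨k + l, fun x => by simp only [map_add, mul_add, add_mul, hk, hl]⟩
  | tmul h y =>
    obtain ⟨k, rfl⟩ := H.antipode.surjective h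
    obtain ⟨y, rfl⟩ := H.antipode.surjective y
    obtain ⟨z, rfl⟩ := H.antipode.surjective y
    exact ⟨_, fun x => by rw [← ψ_mul_sliceT₁', ψ_mul_sliceT₁]⟩

/-- The element `ψ(k ·)` of `B`. -/
def toDual' : A →ₗ[ℂ] H.Dual where
  toFun k := H.ofRange (H.ψ ∘ₗ LinearMap.mulLeft ℂ k) (by
    obtain ⟨d, hd⟩ := H.exists_φ_eq k
    exact ⟨d, LinearMap.ext fun x => (hd x).symm⟩)
  map_add' k l := H.dual_ext fun x => by simp [add_mul]
  map_smul' r k := H.dual_ext fun x => by simp [smul_mul_assoc]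

@[simp] theorem eval_toDual' (k x : A) : H.eval (H.toDual' k) x = H.ψ (k * x) := rfl

theorem toDual'_surjective : Function.Surjective H.toDual' := by
  intro b
  obtain ⟨d, rfl⟩ := H.toDual_surjective b
  obtain ⟨k, hk⟩ := H.exists_ψ_eq d
  exact ⟨k, H.dual_ext fun x => (hk x).symm⟩

end AlgebraicQuantumGroup

/-! ### Faithfulness of the integrals and the right action of `B` on `A` -/

namespace AlgebraicQuantumGroup

variable {A : Type u} [NonUnitalRing A] [Module ℂ A] [IsScalarTower ℂ A A] [SMulCommClass ℂ A A]
variable (H : AlgebraicQuantumGroup A)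

/-- For `t = T₄ s` one has `tΔ(x) = T₄ (s(1 ⊗ x))`, and right invariance removes `T₄`. The next
lemma is the analogue for `φ` and `T₂`. -/
theorem lslice_ψ_right (x : A) (t : A ⊗[ℂ] A) : lslice H.ψ (right (H.Δ x) t) =
    slice (H.ψ ∘ₗ LinearMap.mulRight ℂ x) (H.T₄.symm t) := by
  obtain ⟨s, rfl⟩ := H.T₄.surjective t
  rw [LinearEquiv.symm_apply_apply]
  induction s with
  | zero => simp
  | add s t h₁ h₂ => simp only [map_add, h₁, h₂]
  | tmul p q => rw [H.right_T₄, right_invariant]; simp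

theorem slice_φ_right (x : A) (t : A ⊗[ℂ] A) : slice H.φ (right (H.Δ x) t) =
    slice (H.φ ∘ₗ LinearMap.mulRight ℂ x) (H.T₂.symm t) := by
  obtain ⟨s, rfl⟩ := H.T₂.surjective t
  rw [LinearEquiv.symm_apply_apply]
  induction s with
  | zero => simp
  | add s t h₁ h₂ => simp only [map_add, h₁, h₂]
  | tmul p q => rw [H.right_T₂, H.left_invariant']; simp

/-- `ψ(A ·) ⊆ φ(A ·)`. -/
theorem exists_left_φ_eq (k : A) : ∃ d, ∀ x, H.ψ (k * x) = H.φ (d * x) := by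
  obtain ⟨t, rfl⟩ := lslice_surjective (Y := A) H.φ_ne_zero k
  refine ⟨lslice H.ψ (H.T₂.symm (H.T₄ t)), fun x => ?_⟩
  -- Both sides are `(ψ ⊗ φ)(w Δ(x))` for `w = T₄ t`. Evaluating the inner `φ` by left invariance
  -- gives a functional `φ(d ·)`, evaluating the inner `ψ` by right invariance gives `ψ(k ·)`.
  have h1 := apply_slice H.ψ H.φ (right (H.Δ x) (H.T₄ t))
  rw [slice_φ_right, lslice_ψ_right, apply_slice, apply_slice, LinearEquiv.symm_apply_apply] at h1
  exact h1.symm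

/-- Every `b` has the form `ψ(k ·) = φ(d ·)`, so `φ(· c) = 0` implies `⟨c, b⟩ = φ(d c) = 0`, and `B`
separates points. -/
theorem toDual_injective : Function.Injective H.toDual := by
  rw [injective_iff_map_eq_zero]
  intro c hc
  refine H.eq_zero_of_eval fun b => ?_
  obtain ⟨k, rfl⟩ := H.toDual'_surjective b
  obtain ⟨d, hd⟩ := H.exists_left_φ_eq k
  rw [eval_toDual', hd, ← eval_toDual, hc]
  simp

theorem toDual'_injective : Function.Injective H.toDual' := by
  rw [injective_iff_map_eq_zero]
  intro k hk
  rw [← H.antipode.map_eq_zero_iff]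
  apply H.toDual_injective
  rw [map_zero]
  refine H.dual_ext fun x => ?_
  have h := congrArg (fun b => H.eval b (H.antipode.symm x)) hk
  simpa [ψ_apply, antipode_mul] using h

/-- The isomorphism `c ↦ φ(· c)`. -/
def dualEquiv : A ≃ₗ[ℂ] H.Dual :=
  LinearEquiv.ofBijective H.toDual ⟨H.toDual_injective, H.toDual_surjective⟩

/-- The isomorphism `c ↦ ψ(c ·)`. -/
def dualEquiv' : A ≃ₗ[ℂ] H.Dual :=
  LinearEquiv.ofBijective H.toDual' ⟨H.toDual'_injective, H.toDual'_surjective⟩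

@[simp] theorem dualEquiv_symm_toDual (c : A) : H.dualEquiv.symm (H.toDual c) = c :=
  H.dualEquiv.symm_apply_apply c

@[simp] theorem dualEquiv'_symm_toDual' (c : A) : H.dualEquiv'.symm (H.toDual' c) = c :=
  H.dualEquiv'.symm_apply_apply c

/-- The right action of `B` on `A`: `a ◁ b = (⟨·, b⟩ ⊗ ι)Δ(a)`. -/
def actR : H.Dual →ₗ[ℂ] A →ₗ[ℂ] A :=
  (TensorProduct.curry (lslice H.φ ∘ₗ H.T₃.toLinearMap)).flip ∘ₗ H.dualEquiv.symm.toLinearMap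

theorem actR_toDual (c a : A) : H.actR (H.toDual c) a = lslice H.φ (H.T₃ (a ⊗ₜ c)) := by
  simp [actR]

theorem actR_mul (b : H.Dual) (a e : A) :
    H.actR b a * e = lslice (H.eval b) (H.T₁ (a ⊗ₜ e)) := by
  obtain ⟨c, rfl⟩ := H.toDual_surjective b
  have h := congrArg (lslice H.φ) (H.lTensor_mulRight_T₃ a c e)
  rw [lslice_lTensor, lslice_rTensor] at h
  rw [actR_toDual]
  exact h

theorem mul_actR (b : H.Dual) (a e : A) :
    e * H.actR b a = lslice (H.eval b) (H.T₄ (e ⊗ₜ a)) := by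
  refine H.nondegenerate.eq_of_mul_right fun z => ?_
  have h := congrArg (lslice (H.eval b)) (H.lTensor_mulRight_T₄ e a z)
  rw [lslice_lTensor, lslice_lTensor, ← actR_mul] at h
  rw [mul_assoc]
  exact h.symm

/-- Right invariance in the form needed for right multiplication by `V` and `Δ(b)`; this is why
elements of `B` are written as `ψ(c ·)` there. -/
theorem mul_actR_toDual' (c a x : A) : a * H.actR (H.toDual' c) x =
    slice (H.ψ ∘ₗ LinearMap.mulRight ℂ x) (H.T₄.symm (c ⊗ₜ a)) := by
  rw [mul_actR, ← lslice_ψ_right, H.right_tmul_eq', lslice_rTensor]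
  rfl

/-- Both sides are `(b ⊗ b')(Δ(a))`, with the legs evaluated in different orders. -/
theorem eval_mul' (b b' : H.Dual) (a : A) : H.eval (b * b') a = H.eval b' (H.actR b a) := by
  obtain ⟨c, rfl⟩ := H.toDual_surjective b'
  rw [eval_mul, act_toDual, apply_slice, ← actR_mul, eval_toDual]

/-- Commutation of the two actions is dual to the associativity of `B`. -/
theorem actR_act (b b' : H.Dual) (a : A) :
    H.actR b (H.act b' a) = H.act b' (H.actR b a) := by
  refine H.eq_of_eval fun f => ?_
  rw [← eval_mul', ← eval_mul, ← eval_mul, ← eval_mul', mul_assoc]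

/-- The slice map `⟨a, ·⟩ ⊗ ι` on `B ⊗ Y`. -/
def sliceAt {Y : Type*} [AddCommGroup Y] [Module ℂ Y] (a : A) : H.Dual ⊗[ℂ] Y →ₗ[ℂ] Y :=
  lslice (H.eval.flip a)

@[simp] theorem sliceAt_tmul {Y : Type*} [AddCommGroup Y] [Module ℂ Y] (a : A) (b : H.Dual)
    (y : Y) : H.sliceAt a (b ⊗ₜ y) = H.eval b a • y := by
  simp [sliceAt]

theorem eq_of_sliceAt {Y : Type*} [AddCommGroup Y] [Module ℂ Y] {s t : H.Dual ⊗[ℂ] Y}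
    (h : ∀ a, H.sliceAt a s = H.sliceAt a t) : s = t :=
  eq_of_rTensor (fun a => H.eval.flip a) (fun _ hb => H.dual_ext fun a => by simpa using hb a)
    fun a => (TensorProduct.lid ℂ Y).injective (h a)

/-! ### The duality `V` in `M(B ⊗ A)` -/

section Duality

theorem sliceAt_mul_tmul (t : H.Dual ⊗[ℂ] A) (b : H.Dual) (a x : A) :
    H.sliceAt x (t * b ⊗ₜ a) = H.sliceAt (H.act b x) t * a := by
  induction t with
  | zero => simp
  | add s t h₁ h₂ => simp only [map_add, add_mul, h₁, h₂]
  | tmul b' a' => simp [smul_mul_assoc]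

theorem sliceAt_tmul_mul (t : H.Dual ⊗[ℂ] A) (b : H.Dual) (a x : A) :
    H.sliceAt x (b ⊗ₜ a * t) = a * H.sliceAt (H.actR b x) t := by
  induction t with
  | zero => simp
  | add s t h₁ h₂ => simp only [map_add, mul_add, h₁, h₂]
  | tmul b' a' =>
    rw [Algebra.TensorProduct.tmul_mul_tmul, sliceAt_tmul, sliceAt_tmul, eval_mul', mul_smul_comm]

/-- Left multiplication by the duality, `(⟨x, ·⟩ ⊗ ι)(V(b ⊗ a)) = (b ▷ x)a`. -/
def dualityLeft : H.Dual ⊗[ℂ] A →ₗ[ℂ] H.Dual ⊗[ℂ] A :=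
  LinearMap.rTensor A H.toDual ∘ₗ H.T₃.symm.toLinearMap ∘ₗ
    (TensorProduct.comm ℂ A A).toLinearMap ∘ₗ LinearMap.rTensor A H.dualEquiv.symm.toLinearMap

theorem dualityLeft_toDual (c a : A) : H.dualityLeft (H.toDual c ⊗ₜ a) =
    LinearMap.rTensor A H.toDual (H.T₃.symm (a ⊗ₜ c)) := by
  simp [dualityLeft]

theorem sliceAt_dualityLeft (b : H.Dual) (a x : A) :
    H.sliceAt x (H.dualityLeft (b ⊗ₜ a)) = H.act b x * a := by
  obtain ⟨c, rfl⟩ := H.toDual_surjective b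
  rw [dualityLeft_toDual, sliceAt, lslice_rTensor,
    H.act_mul _ x a c (LinearEquiv.apply_symm_apply _ _)]
  rfl

/-- Right multiplication by the duality, `(⟨x, ·⟩ ⊗ ι)((b ⊗ a)V) = a(x ◁ b)`. -/
def dualityRight : H.Dual ⊗[ℂ] A →ₗ[ℂ] H.Dual ⊗[ℂ] A :=
  LinearMap.rTensor A H.toDual' ∘ₗ (TensorProduct.comm ℂ A A).toLinearMap ∘ₗ
    H.T₄.symm.toLinearMap ∘ₗ LinearMap.rTensor A H.dualEquiv'.symm.toLinearMap

theorem sliceAt_dualityRight (b : H.Dual) (a x : A) :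
    H.sliceAt x (H.dualityRight (b ⊗ₜ a)) = a * H.actR b x := by
  obtain ⟨c, rfl⟩ := H.toDual'_surjective b
  have h : H.dualityRight (H.toDual' c ⊗ₜ a) =
      LinearMap.rTensor A H.toDual' (TensorProduct.comm ℂ A A (H.T₄.symm (c ⊗ₜ a))) := by
    simp [dualityRight]
  rw [h, sliceAt, lslice_rTensor, lslice_comm, mul_actR_toDual']
  rfl

/-- Paired with `x`, the two sides are `a((b' ▷ x) ◁ b)a'` and `a(b' ▷ (x ◁ b))a'`, which agree
because the actions commute. -/
theorem dualityRight_mul (s t : H.Dual ⊗[ℂ] A) :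
    H.dualityRight s * t = s * H.dualityLeft t := by
  induction s with
  | zero => simp
  | add s s' h₁ h₂ => simp only [map_add, add_mul, h₁, h₂]
  | tmul b a =>
    induction t with
    | zero => simp
    | add t t' h₁ h₂ => simp only [map_add, mul_add, h₁, h₂]
    | tmul b' a' =>
      refine H.eq_of_sliceAt fun x => ?_
      rw [sliceAt_mul_tmul, sliceAt_tmul_mul, sliceAt_dualityLeft, sliceAt_dualityRight, actR_act,
        mul_assoc]

/-- The duality `V ∈ M(B ⊗ A)`. -/
def duality : Multiplier (H.Dual ⊗[ℂ] A) :=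
  Multiplier.mk H.dualityLeft H.dualityRight H.dualityRight_mul

theorem pairMixed_tmul (t : H.Dual ⊗[ℂ] A) (a : A) (b : H.Dual) :
    H.pairMixed t (a ⊗ₜ b) = H.eval b (H.sliceAt a t) := by
  induction t with
  | zero => simp
  | add s t h₁ h₂ => simp only [map_add, LinearMap.add_apply, h₁, h₂]
  | tmul b' a' => simp [pairMixed]

/-- The condition prescribes every pairing of `V(b ⊗ a)`; the pairings separate `B ⊗ A`, and a
multiplier is determined by its left part. -/
theorem isDuality_iff (V : Multiplier (H.Dual ⊗[ℂ] A)) : H.IsDuality V ↔ V = H.duality := by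
  constructor
  · intro hV
    refine ext_left (H.dual_nondegenerate.tensor H.nondegenerate) fun t => ?_
    induction t with
    | zero => simp
    | add s t h₁ h₂ => simp only [map_add, h₁, h₂]
    | tmul b a =>
      refine H.eq_of_sliceAt fun x => H.eq_of_eval fun b' => ?_
      rw [← pairMixed_tmul, hV, duality, left_mk, sliceAt_dualityLeft]
      rfl
  · rintro rfl b a x b'
    rw [pairMixed_tmul, duality, left_mk, sliceAt_dualityLeft]
    rfl

end Duality

/-! ### The coproduct of `B` -/

section Coproduct

theorem pairDual_tmul (t : H.Dual ⊗[ℂ] H.Dual) (x y : A) :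
    H.pairDual t (x ⊗ₜ y) = H.eval (H.sliceAt x t) y := by
  induction t with
  | zero => simp
  | add s t h₁ h₂ => simp only [map_add, LinearMap.add_apply, h₁, h₂]
  | tmul b b' => simp [pairDual]

theorem eq_of_pairDual {s t : H.Dual ⊗[ℂ] H.Dual}
    (h : ∀ x y, H.pairDual s (x ⊗ₜ y) = H.pairDual t (x ⊗ₜ y)) : s = t :=
  H.eq_of_sliceAt fun x => H.dual_ext fun y => by rw [← pairDual_tmul, h, pairDual_tmul]

theorem pairDual_rTensor_mulRight (t : H.Dual ⊗[ℂ] H.Dual) (b : H.Dual) (x y : A) :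
    H.pairDual (LinearMap.rTensor H.Dual (LinearMap.mulRight ℂ b) t) (x ⊗ₜ y) =
      H.pairDual t (H.act b x ⊗ₜ y) := by
  induction t with
  | zero => simp
  | add s t h₁ h₂ => simp only [map_add, LinearMap.add_apply, h₁, h₂]
  | tmul b₁ b₂ => simp [pairDual]

theorem pairDual_lTensor_mulLeft (t : H.Dual ⊗[ℂ] H.Dual) (b : H.Dual) (x y : A) :
    H.pairDual (LinearMap.lTensor H.Dual (LinearMap.mulLeft ℂ b) t) (x ⊗ₜ y) =
      H.pairDual t (x ⊗ₜ H.actR b y) := by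
  induction t with
  | zero => simp
  | add s t h₁ h₂ => simp only [map_add, LinearMap.add_apply, h₁, h₂]
  | tmul b₁ b₂ => simp [pairDual, -eval_mul, eval_mul']

theorem pairDual_mul_tmul (t : H.Dual ⊗[ℂ] H.Dual) (b b' : H.Dual) (x y : A) :
    H.pairDual (t * b ⊗ₜ b') (x ⊗ₜ y) = H.pairDual t (H.act b x ⊗ₜ H.act b' y) := by
  induction t with
  | zero => simp
  | add s t h₁ h₂ => simp only [map_add, add_mul, LinearMap.add_apply, h₁, h₂]
  | tmul b₁ b₂ => simp [pairDual]

theorem pairDual_tmul_mul (t : H.Dual ⊗[ℂ] H.Dual) (b b' : H.Dual) (x y : A) :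
    H.pairDual (b ⊗ₜ b' * t) (x ⊗ₜ y) = H.pairDual t (H.actR b x ⊗ₜ H.actR b' y) := by
  induction t with
  | zero => simp
  | add s t h₁ h₂ => simp only [map_add, mul_add, LinearMap.add_apply, h₁, h₂]
  | tmul b₁ b₂ => simp [pairDual, -eval_mul, eval_mul']

/-- `b ⊗ b' ↦ Δ(b)(1 ⊗ b')`. -/
def dualT₁ : H.Dual ⊗[ℂ] H.Dual →ₗ[ℂ] H.Dual ⊗[ℂ] H.Dual :=
  TensorProduct.map H.toDual H.toDual ∘ₗ (TensorProduct.comm ℂ A A).toLinearMap ∘ₗ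
    H.T₃.symm.toLinearMap ∘ₗ
    TensorProduct.map H.dualEquiv.symm.toLinearMap H.dualEquiv.symm.toLinearMap

/-- Up to the identification of `A` with `B`, the map is the flip after `T₃⁻¹`. It is what makes
`embB` non-degenerate on the left. -/
theorem dualT₁_surjective : Function.Surjective H.dualT₁ := by
  have h1 : Function.Surjective (TensorProduct.map H.toDual H.toDual) :=
    TensorProduct.map_surjective H.toDual_surjective H.toDual_surjective
  have h2 : Function.Surjective
      (TensorProduct.map H.dualEquiv.symm.toLinearMap H.dualEquiv.symm.toLinearMap) :=
    TensorProduct.map_surjective H.dualEquiv.symm.surjective H.dualEquiv.symm.surjective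
  exact h1.comp ((TensorProduct.comm ℂ A A).surjective.comp (H.T₃.symm.surjective.comp h2))

theorem sliceAt_dualT₁ (b b' : H.Dual) (x : A) :
    H.sliceAt x (H.dualT₁ (b ⊗ₜ b')) = H.actMul b b' x := by
  obtain ⟨c, rfl⟩ := H.toDual_surjective b
  obtain ⟨c', rfl⟩ := H.toDual_surjective b'
  refine H.dual_ext fun y => ?_
  rw [eval_actMul, eval_toDual, mul_assoc, H.act_mul _ y c c' (LinearEquiv.apply_symm_apply _ _)]
  simp only [dualT₁, LinearMap.comp_apply, TensorProduct.map_tmul, LinearEquiv.coe_coe,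
    dualEquiv_symm_toDual]
  generalize H.T₃.symm (c ⊗ₜ c') = s
  induction s with
  | zero => simp
  | add s t h₁ h₂ => simp only [map_add, mul_add, LinearMap.add_apply, h₁, h₂]
  | tmul p q => simp [mul_comm, mul_smul_comm]

/-- `b ⊗ b' ↦ (b ⊗ 1)Δ(b')`. -/
def dualT₂ : H.Dual ⊗[ℂ] H.Dual →ₗ[ℂ] H.Dual ⊗[ℂ] H.Dual :=
  TensorProduct.map H.toDual' H.toDual' ∘ₗ (TensorProduct.comm ℂ A A).toLinearMap ∘ₗ
    H.T₄.symm.toLinearMap ∘ₗ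
    TensorProduct.map H.dualEquiv'.symm.toLinearMap H.dualEquiv'.symm.toLinearMap

theorem pairDual_dualT₂ (b b' : H.Dual) (x y : A) :
    H.pairDual (H.dualT₂ (b ⊗ₜ b')) (x ⊗ₜ y) = H.eval b' (H.actR b x * y) := by
  obtain ⟨c, rfl⟩ := H.toDual'_surjective b
  obtain ⟨c', rfl⟩ := H.toDual'_surjective b'
  rw [eval_toDual', ← mul_assoc, mul_actR_toDual']
  simp only [dualT₂, LinearMap.comp_apply, TensorProduct.map_tmul, LinearEquiv.coe_coe,
    dualEquiv'_symm_toDual']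
  generalize H.T₄.symm (c ⊗ₜ c') = s
  induction s with
  | zero => simp
  | add s t h₁ h₂ => simp only [map_add, add_mul, LinearMap.add_apply, h₁, h₂]
  | tmul p q => simp [pairDual, smul_mul_assoc]

theorem pairDual_dualT₁ (b b' : H.Dual) (x y : A) :
    H.pairDual (H.dualT₁ (b ⊗ₜ b')) (x ⊗ₜ y) = H.eval b (x * H.act b' y) := by
  rw [pairDual_tmul, sliceAt_dualT₁, eval_actMul]

/-- Left multiplication by `Δ(b)`. -/
def coproductLeft (b : H.Dual) : H.Dual ⊗[ℂ] H.Dual →ₗ[ℂ] H.Dual ⊗[ℂ] H.Dual :=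
  TensorProduct.lift ((LinearMap.rTensorHom H.Dual ∘ₗ (LinearMap.mul ℂ H.Dual).flip).compl₂
    (H.dualT₁ ∘ₗ TensorProduct.mk ℂ H.Dual H.Dual b))

theorem coproductLeft_tmul (b b₁ b₂ : H.Dual) : H.coproductLeft b (b₁ ⊗ₜ b₂) =
    LinearMap.rTensor H.Dual (LinearMap.mulRight ℂ b₁) (H.dualT₁ (b ⊗ₜ b₂)) := rfl

theorem pairDual_coproductLeft (b b₁ b₂ : H.Dual) (x y : A) :
    H.pairDual (H.coproductLeft b (b₁ ⊗ₜ b₂)) (x ⊗ₜ y) =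
      H.eval b (H.act b₁ x * H.act b₂ y) := by
  rw [coproductLeft_tmul, pairDual_rTensor_mulRight, pairDual_dualT₁]

/-- Right multiplication by `Δ(b)`. -/
def coproductRight (b : H.Dual) : H.Dual ⊗[ℂ] H.Dual →ₗ[ℂ] H.Dual ⊗[ℂ] H.Dual :=
  TensorProduct.lift ((LinearMap.lTensorHom H.Dual ∘ₗ LinearMap.mul ℂ H.Dual).compl₂
    (H.dualT₂ ∘ₗ (TensorProduct.mk ℂ H.Dual H.Dual).flip b)).flip

theorem pairDual_coproductRight (b b₁ b₂ : H.Dual) (x y : A) :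
    H.pairDual (H.coproductRight b (b₁ ⊗ₜ b₂)) (x ⊗ₜ y) =
      H.eval b (H.actR b₁ x * H.actR b₂ y) := by
  have h : H.coproductRight b (b₁ ⊗ₜ b₂) =
      LinearMap.lTensor H.Dual (LinearMap.mulLeft ℂ b₂) (H.dualT₂ (b₁ ⊗ₜ b)) := rfl
  rw [h, pairDual_lTensor_mulLeft, pairDual_dualT₂]

theorem coproductRight_mul (b : H.Dual) (s t : H.Dual ⊗[ℂ] H.Dual) :
    H.coproductRight b s * t = s * H.coproductLeft b t := by
  induction s with
  | zero => simp
  | add s s' h₁ h₂ => simp only [map_add, add_mul, h₁, h₂]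
  | tmul b₁ b₂ =>
    induction t with
    | zero => simp
    | add t t' h₁ h₂ => simp only [map_add, mul_add, h₁, h₂]
    | tmul b₃ b₄ =>
      refine H.eq_of_pairDual fun x y => ?_
      rw [pairDual_mul_tmul, pairDual_tmul_mul, pairDual_coproductLeft, pairDual_coproductRight,
        actR_act, actR_act]

/-- The element `∑ (β ▷ x) ⊗ β'` of the Heisenberg algebra for `∑ β ⊗ β'` in `B ⊗ B`. -/
def heisSlice (x : A) : H.Dual ⊗[ℂ] H.Dual →ₗ[ℂ] H.Heisenberg :=
  LinearMap.rTensor H.Dual (H.act.flip x)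

@[simp] theorem heisSlice_tmul (x : A) (b b' : H.Dual) :
    H.heisSlice x (b ⊗ₜ b') = H.heis (H.act b x) b' := rfl

/-- The module algebra property `b ▷ (x (b' ▷ y)) = ∑ (b₍₁₎ ▷ x)(b₍₂₎ b' ▷ y)`. After multiplication
by `a`, the right side is the action of the product `(a ⊗ b)(x ⊗ b')` in `AB`, whose factors `(b ◁
q) b'` are slices of `Δ(b)(1 ⊗ b')`. -/
theorem heisAct_heisSlice_dualT₁ (b b' : H.Dual) (x y : A) :
    H.heisAct (H.heisSlice x (H.dualT₁ (b ⊗ₜ b'))) y = H.act b (x * H.act b' y) := by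
  refine H.nondegenerate.eq_of_mul_left fun a => ?_
  let F : A ⊗[ℂ] H.Dual →ₗ[ℂ] A →ₗ[ℂ] A := H.heisAct
  let σ : H.Dual ⊗[ℂ] H.Dual →ₗ[ℂ] A →ₗ[ℂ] H.Dual := TensorProduct.lift (LinearMap.mk₂ ℂ
    (fun β β' => (H.eval β).smulRight β')
    (by intros; ext; simp [add_smul]) (by intros; ext; simp [mul_smul])
    (by intros; ext; simp) (by intros; ext; exact smul_comm _ _ _))
  have hσ : ∀ t q, σ t q = H.sliceAt q t := by
    intro t q
    induction t with
    | zero => simp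
    | add s t h₁ h₂ => simp only [map_add, LinearMap.add_apply, h₁, h₂]
    | tmul β β' => simp [σ]
  have h1 : a * H.act b (x * H.act b' y) = H.heisAct (H.heis a b * H.heis x b') y := by
    rw [heisAct_mul, heisAct_heis, heisAct_heis]
  have h2 : ∀ t, a * H.heisAct (H.heisSlice x t) y = F (LinearMap.lTensor A (σ t)
      (H.T₂ (a ⊗ₜ x))) y := by
    intro t
    induction t with
    | zero => simp
    | add s t h₁ h₂ =>
      simp only [map_add, mul_add, LinearMap.add_apply, h₁, h₂, LinearMap.lTensor_add]
    | tmul β β' =>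
      rw [heisSlice_tmul, heisAct_heis, ← mul_assoc, H.mul_act β]
      generalize H.T₂ (a ⊗ₜ x) = w
      induction w with
      | zero => simp
      | add s t h₁ h₂ => simp only [map_add, add_mul, LinearMap.add_apply, h₁, h₂]
      | tmul p q =>
        change _ = H.heisAct (H.heis p (σ (β ⊗ₜ β') q)) y
        rw [hσ]
        simp [smul_mul_assoc]
  have h3 : H.actMulₗ (b ⊗ₜ b') = σ (H.dualT₁ (b ⊗ₜ b')) := by
    ext q
    rw [hσ, sliceAt_dualT₁, actMulₗ_tmul]
  rw [h1, h2, heis_mul_heis, h3]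
  rfl

theorem heisSlice_rTensor_mulRight (x : A) (b : H.Dual) (t : H.Dual ⊗[ℂ] H.Dual) :
    H.heisSlice x (LinearMap.rTensor H.Dual (LinearMap.mulRight ℂ b) t) =
      H.heisSlice (H.act b x) t := by
  induction t with
  | zero => simp
  | add s t h₁ h₂ => simp only [map_add, h₁, h₂]
  | tmul b₁ b₂ => simp [act_mul_apply]

theorem heisAct_heisSlice_coproductLeft (b b₁ b₂ : H.Dual) (x y : A) :
    H.heisAct (H.heisSlice x (H.coproductLeft b (b₁ ⊗ₜ b₂))) y =
      H.act b (H.act b₁ x * H.act b₂ y) := by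
  rw [coproductLeft_tmul, heisSlice_rTensor_mulRight, heisAct_heisSlice_dualT₁]

/-- Allowing any `t` in `B ⊗ B` is needed for `t = Δ(b')(b₁ ⊗ b₂)`, in the proof that the coproduct
is multiplicative. -/
theorem pairDual_coproductLeft_eq (b : H.Dual) (t : H.Dual ⊗[ℂ] H.Dual) (x y : A) :
    H.pairDual (H.coproductLeft b t) (x ⊗ₜ y) = H.eval b (H.heisAct (H.heisSlice x t) y) := by
  induction t with
  | zero => simp
  | add s t h₁ h₂ => simp only [map_add, LinearMap.add_apply, h₁, h₂]
  | tmul b₁ b₂ => rw [pairDual_coproductLeft, heisSlice_tmul, heisAct_heis]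

theorem multiplier_ext_pairDual {m n : Multiplier (H.Dual ⊗[ℂ] H.Dual)}
    (h : ∀ b₁ b₂ x y, H.pairDual (left m (b₁ ⊗ₜ b₂)) (x ⊗ₜ y) =
      H.pairDual (left n (b₁ ⊗ₜ b₂)) (x ⊗ₜ y)) : m = n := by
  refine ext_left (H.dual_nondegenerate.tensor H.dual_nondegenerate) fun t => ?_
  induction t with
  | zero => simp
  | add s t h₁ h₂ => simp only [map_add, h₁, h₂]
  | tmul b₁ b₂ => exact H.eq_of_pairDual (h b₁ b₂)

/-- The coproduct of `B`. -/
def coproduct : H.Dual →ₙₐ[ℂ] Multiplier (H.Dual ⊗[ℂ] H.Dual) where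
  toFun b := Multiplier.mk (H.coproductLeft b) (H.coproductRight b) (H.coproductRight_mul b)
  map_smul' r b := H.multiplier_ext_pairDual fun b₁ b₂ x y => by
    simp [pairDual_coproductLeft]
  map_zero' := H.multiplier_ext_pairDual fun b₁ b₂ x y => by
    change H.pairDual (H.coproductLeft 0 (b₁ ⊗ₜ b₂)) (x ⊗ₜ y) = H.pairDual 0 (x ⊗ₜ y)
    simp [pairDual_coproductLeft]
  map_add' b b' := H.multiplier_ext_pairDual fun b₁ b₂ x y => by
    simp [pairDual_coproductLeft]
  map_mul' b b' := H.multiplier_ext_pairDual fun b₁ b₂ x y => by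
    -- By the module algebra property, both pairings equal `⟨b' ▷ ((b₁ ▷ x)(b₂ ▷ y)), b⟩`.
    rw [left_mul, left_mk, left_mk, left_mk, pairDual_coproductLeft, pairDual_coproductLeft_eq,
      eval_mul, heisAct_heisSlice_coproductLeft]

theorem left_coproduct (b : H.Dual) : left (H.coproduct b) = H.coproductLeft b := rfl

theorem isDualCoproduct_iff (ΔB : H.Dual →ₙₐ[ℂ] Multiplier (H.Dual ⊗[ℂ] H.Dual)) :
    H.IsDualCoproduct ΔB ↔ ΔB = H.coproduct := by
  constructor
  · intro h
    ext b
    refine H.multiplier_ext_pairDual fun b₁ b₂ x y => ?_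
    rw [h, left_coproduct, pairDual_coproductLeft]
  · rintro rfl b b₁ b₂ x y
    rw [left_coproduct, pairDual_coproductLeft]

end Coproduct

end AlgebraicQuantumGroup

/-! ### The embeddings of `A` and `B` in `M(AB)` -/

namespace AlgebraicQuantumGroup

variable {A : Type u} [NonUnitalRing A] [Module ℂ A] [IsScalarTower ℂ A A] [SMulCommClass ℂ A A]
variable (H : AlgebraicQuantumGroup A)

/-- The right action of `A` on `B`: `⟨x, b ◁ a⟩ = ⟨a x, b⟩`. -/
def actDualR : H.Dual →ₗ[ℂ] A →ₗ[ℂ] H.Dual :=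
  (LinearMap.mul ℂ A).compr₂ H.toDual' ∘ₗ H.dualEquiv'.symm.toLinearMap

theorem actDualR_toDual' (c a : A) : H.actDualR (H.toDual' c) a = H.toDual' (c * a) := by
  simp [actDualR]

theorem eval_actDualR (b : H.Dual) (a x : A) :
    H.eval (H.actDualR b a) x = H.eval b (a * x) := by
  obtain ⟨c, rfl⟩ := H.toDual'_surjective b
  rw [actDualR_toDual', eval_toDual', eval_toDual', mul_assoc]

/-- The multiplier `m` of the Heisenberg algebra acts on `A` by `T`. -/
def ActsBy (m : Multiplier H.Heisenberg) (T : A →ₗ[ℂ] A) : Prop :=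
  ∀ s x, H.heisAct (left m s) x = T (H.heisAct s x)

variable {H} in
theorem ActsBy.unique {m n : Multiplier H.Heisenberg} {T : A →ₗ[ℂ] A} (hm : H.ActsBy m T)
    (hn : H.ActsBy n T) : m = n :=
  ext_left H.heisenberg_nondegenerate fun s => H.heis_ext fun x => by rw [hm, hn]

variable {H} in
theorem ActsBy.mul {m n : Multiplier H.Heisenberg} {T U : A →ₗ[ℂ] A} (hm : H.ActsBy m T)
    (hn : H.ActsBy n U) : H.ActsBy (m * n) (T ∘ₗ U) := fun s x => by
  rw [left_mul, hm, hn, LinearMap.comp_apply]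

variable {H} in
theorem ActsBy.add {m n : Multiplier H.Heisenberg} {T U : A →ₗ[ℂ] A} (hm : H.ActsBy m T)
    (hn : H.ActsBy n U) : H.ActsBy (m + n) (T + U) := fun s x => by
  rw [left_add, LinearMap.add_apply, map_add, LinearMap.add_apply, hm, hn, LinearMap.add_apply]

variable {H} in
theorem ActsBy.smul {m : Multiplier H.Heisenberg} {T : A →ₗ[ℂ] A} (r : ℂ) (hm : H.ActsBy m T) :
    H.ActsBy (r • m) (r • T) := fun s x => by
  rw [left_smul, LinearMap.smul_apply, map_smul, LinearMap.smul_apply, hm, LinearMap.smul_apply]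

theorem actsBy_zero : H.ActsBy 0 0 := fun s x => by
  change H.heisAct 0 x = 0
  simp

theorem actsBy_of (s : H.Heisenberg) : H.ActsBy (of s) (H.heisAct s) := fun t x => by
  rw [left_of, heisAct_mul]

/-- By faithfulness of the action, two maps `L` and `R` that compose with the same operator `T`,
after and before, form a multiplier. -/
theorem heisAct_central {T : A →ₗ[ℂ] A} {L R : H.Heisenberg →ₗ[ℂ] H.Heisenberg}
    (hL : ∀ s x, H.heisAct (L s) x = T (H.heisAct s x))
    (hR : ∀ s x, H.heisAct (R s) x = H.heisAct s (T x)) (s t : H.Heisenberg) :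
    R s * t = s * L t :=
  H.heis_ext fun x => by rw [heisAct_mul, heisAct_mul, hL, hR]

section EmbA

/-- Left multiplication by `a ∈ A`. -/
def embALeft (a : A) : H.Heisenberg →ₗ[ℂ] H.Heisenberg :=
  LinearMap.rTensor H.Dual (LinearMap.mulLeft ℂ a)

@[simp] theorem embALeft_heis (a a' : A) (b : H.Dual) :
    H.embALeft a (H.heis a' b) = H.heis (a * a') b := rfl

/-- Right multiplication by `a ∈ A`. -/
def embARight (a : A) : H.Heisenberg →ₗ[ℂ] H.Heisenberg :=
  TensorProduct.lift (((LinearMap.lTensorHom A ∘ₗ H.actDualR).compl₂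
    (H.T₂.toLinearMap ∘ₗ (TensorProduct.mk ℂ A A).flip a)).flip)

theorem embARight_heis (a a' : A) (b : H.Dual) : H.embARight a (H.heis a' b) =
    (LinearMap.lTensor A (H.actDualR b) (H.T₂ (a' ⊗ₜ a)) : A ⊗[ℂ] H.Dual) := rfl

theorem heisAct_embALeft (a : A) (s : H.Heisenberg) (x : A) :
    H.heisAct (H.embALeft a s) x = LinearMap.mulLeft ℂ a (H.heisAct s x) := by
  induction s using H.heis_induction with
  | h p b => simp [mul_assoc]
  | hadd s t h₁ h₂ => simp only [map_add, LinearMap.add_apply, h₁, h₂]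

/-- For `s = p ⊗ b` both sides are `p (b ▷ (a x)) = (ι ⊗ b)((p ⊗ 1)Δ(a)Δ(x))`. -/
theorem heisAct_embARight (a : A) (s : H.Heisenberg) (x : A) :
    H.heisAct (H.embARight a s) x = H.heisAct s (LinearMap.mulLeft ℂ a x) := by
  induction s using H.heis_induction with
  | h p b =>
    let F : A ⊗[ℂ] H.Dual →ₗ[ℂ] A →ₗ[ℂ] A := H.heisAct
    rw [heisAct_heis, LinearMap.mulLeft_apply, mul_act, ← H.right_T₂, embARight_heis]
    change F _ x = _
    generalize H.T₂ (p ⊗ₜ a) = w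
    induction w with
    | zero => simp
    | add s t h₁ h₂ => simp only [map_add, LinearMap.add_apply, h₁, h₂]
    | tmul p q =>
      change p * H.act (H.actDualR b q) x = _
      rw [mul_act, H.right_tmul_eq]
      refine Eq.trans ?_ (slice_lTensor (LinearMap.mulLeft ℂ q) (H.eval b) _).symm
      congr 2
      ext y
      exact H.eval_actDualR b q y
  | hadd s t h₁ h₂ => simp only [map_add, LinearMap.add_apply, h₁, h₂]

/-- `a ∈ A` as a multiplier of the Heisenberg algebra. -/
def embAMul (a : A) : Multiplier H.Heisenberg := Multiplier.mk (H.embALeft a) (H.embARight a)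
  (H.heisAct_central (H.heisAct_embALeft a) (H.heisAct_embARight a))

theorem actsBy_embAMul (a : A) : H.ActsBy (H.embAMul a) (LinearMap.mulLeft ℂ a) :=
  H.heisAct_embALeft a

/-- The embedding of `A` in the multiplier algebra of the Heisenberg algebra. -/
def embA : A →ₙₐ[ℂ] Multiplier H.Heisenberg where
  toFun := H.embAMul
  map_smul' r a := (H.actsBy_embAMul _).unique (by
    have : LinearMap.mulLeft ℂ (r • a) = r • LinearMap.mulLeft ℂ a := by
      ext; simp [smul_mul_assoc]
    rw [this]
    exact (H.actsBy_embAMul a).smul r)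
  map_zero' := (H.actsBy_embAMul _).unique (by
    rw [LinearMap.mulLeft_zero_eq_zero]
    exact H.actsBy_zero)
  map_add' a a' := (H.actsBy_embAMul _).unique (by
    have : LinearMap.mulLeft ℂ (a + a') = LinearMap.mulLeft ℂ a + LinearMap.mulLeft ℂ a' := by
      ext; simp [add_mul]
    rw [this]
    exact (H.actsBy_embAMul a).add (H.actsBy_embAMul a'))
  map_mul' a a' := (H.actsBy_embAMul _).unique (by
    rw [LinearMap.mulLeft_mul]
    exact (H.actsBy_embAMul a).mul (H.actsBy_embAMul a'))

theorem left_embA (a : A) : left (H.embA a) = H.embALeft a := rfl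

theorem actsBy_embA (a : A) : H.ActsBy (H.embA a) (LinearMap.mulLeft ℂ a) := H.heisAct_embALeft a

end EmbA

section EmbB

/-- Left multiplication by `b ∈ B`. -/
def embBLeft (b : H.Dual) : H.Heisenberg →ₗ[ℂ] H.Heisenberg :=
  TensorProduct.lift ((LinearMap.rTensorHom H.Dual ∘ₗ H.act.flip).compl₂
    (H.dualT₁ ∘ₗ TensorProduct.mk ℂ H.Dual H.Dual b))

theorem embBLeft_heis (b : H.Dual) (x : A) (b' : H.Dual) :
    H.embBLeft b (H.heis x b') = H.heisSlice x (H.dualT₁ (b ⊗ₜ b')) := rfl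

/-- Right multiplication by `b ∈ B`. -/
def embBRight (b : H.Dual) : H.Heisenberg →ₗ[ℂ] H.Heisenberg :=
  LinearMap.lTensor A (LinearMap.mulRight ℂ b)

@[simp] theorem embBRight_heis (b : H.Dual) (a : A) (b' : H.Dual) :
    H.embBRight b (H.heis a b') = H.heis a (b' * b) := rfl

theorem heisAct_embBLeft (b : H.Dual) (s : H.Heisenberg) (x : A) :
    H.heisAct (H.embBLeft b s) x = H.act b (H.heisAct s x) := by
  induction s using H.heis_induction with
  | h p b' => rw [embBLeft_heis, heisAct_heisSlice_dualT₁, heisAct_heis]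
  | hadd s t h₁ h₂ => simp only [map_add, LinearMap.add_apply, h₁, h₂]

theorem heisAct_embBRight (b : H.Dual) (s : H.Heisenberg) (x : A) :
    H.heisAct (H.embBRight b s) x = H.heisAct s (H.act b x) := by
  induction s using H.heis_induction with
  | h p b' => simp [act_mul_apply]
  | hadd s t h₁ h₂ => simp only [map_add, LinearMap.add_apply, h₁, h₂]

/-- `b ∈ B` as a multiplier of the Heisenberg algebra. -/
def embBMul (b : H.Dual) : Multiplier H.Heisenberg := Multiplier.mk (H.embBLeft b) (H.embBRight b)
  (H.heisAct_central (H.heisAct_embBLeft b) (H.heisAct_embBRight b))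

theorem actsBy_embBMul (b : H.Dual) : H.ActsBy (H.embBMul b) (H.act b) :=
  H.heisAct_embBLeft b

/-- The embedding of `B` in the multiplier algebra of the Heisenberg algebra. -/
def embB : H.Dual →ₙₐ[ℂ] Multiplier H.Heisenberg where
  toFun := H.embBMul
  map_smul' r b := (H.actsBy_embBMul _).unique (by
    rw [map_smul]
    exact (H.actsBy_embBMul b).smul r)
  map_zero' := (H.actsBy_embBMul _).unique (by
    rw [map_zero]
    exact H.actsBy_zero)
  map_add' b b' := (H.actsBy_embBMul _).unique (by
    rw [map_add]
    exact (H.actsBy_embBMul b).add (H.actsBy_embBMul b'))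
  map_mul' b b' := (H.actsBy_embBMul _).unique (by
    have : H.act (b * b') = H.act b ∘ₗ H.act b' := by
      ext; simp [act_mul_apply]
    rw [this]
    exact (H.actsBy_embBMul b).mul (H.actsBy_embBMul b'))

theorem right_embB (b : H.Dual) : right (H.embB b) = H.embBRight b := rfl

theorem actsBy_embB (b : H.Dual) : H.ActsBy (H.embB b) (H.act b) := H.heisAct_embBLeft b

end EmbB

theorem isHeisenbergEmbedding_iff (jA : A →ₙₐ[ℂ] Multiplier H.Heisenberg)
    (jB : H.Dual →ₙₐ[ℂ] Multiplier H.Heisenberg) :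
    H.IsHeisenbergEmbedding jA jB ↔ jA = H.embA ∧ jB = H.embB := by
  constructor
  · rintro ⟨hA, hB⟩
    constructor
    · ext a
      refine ext_left H.heisenberg_nondegenerate fun s => ?_
      induction s using H.heis_induction with
      | h p b => rw [hA, left_embA, embALeft_heis]
      | hadd s t h₁ h₂ => rw [map_add, map_add, h₁, h₂]
    · ext b
      refine ext_right H.heisenberg_nondegenerate fun s => ?_
      induction s using H.heis_induction with
      | h p b => rw [hB, right_embB, embBRight_heis]
      | hadd s t h₁ h₂ => rw [map_add, map_add, h₁, h₂]
  · rintro ⟨rfl, rfl⟩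
    exact ⟨fun a a' b => rfl, fun b a' b' => rfl⟩

/-- Both multipliers act on `A` by `x ↦ a (b ▷ x)`. -/
theorem embA_mul_embB (a : A) (b : H.Dual) : H.embA a * H.embB b = of (H.heis a b) :=
  ((H.actsBy_embA a).mul (H.actsBy_embB b)).unique (H.actsBy_of (H.heis a b))

/-- `ψ(x ·) ◁ y = ψ(x y ·)`, and `A` is spanned by products. -/
theorem span_actDualR (b : H.Dual) :
    b ∈ Submodule.span ℂ {y | ∃ b' a, y = H.actDualR b' a} := by
  obtain ⟨c, rfl⟩ := H.toDual'_surjective b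
  obtain ⟨t, rfl⟩ := H.mul'_surjective c
  induction t with
  | zero => simp
  | add s t h₁ h₂ => simp only [map_add]; exact Submodule.add_mem _ h₁ h₂
  | tmul x y => exact Submodule.subset_span ⟨H.toDual' x, y, by simp [actDualR_toDual']⟩

/-- On the left, `A` is spanned by products. On the right, `(x ⊗ b') y = (ι ⊗ (b' ◁ ·))(T₂ (x ⊗
y))`, where `T₂` is surjective and `B ◁ A` spans `B`. -/
theorem embA_nondegenerate : IsNondegenerateHom H.embA := by
  constructor
  · rw [eq_top_iff]
    rintro s -
    induction s using H.heis_induction with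
    | hadd s t h₁ h₂ => exact Submodule.add_mem _ h₁ h₂
    | h a b =>
      obtain ⟨t, rfl⟩ := H.mul'_surjective a
      induction t with
      | zero => simp
      | add s t h₁ h₂ =>
        simp only [map_add, LinearMap.add_apply]
        exact Submodule.add_mem _ h₁ h₂
      | tmul x y => exact Submodule.subset_span ⟨x, H.heis y b, rfl⟩
  · rw [eq_top_iff]
    rintro s -
    induction s using H.heis_induction with
    | hadd s t h₁ h₂ => exact Submodule.add_mem _ h₁ h₂
    | h a b =>
      have hb := H.span_actDualR b
      induction hb using Submodule.span_induction with
      | zero => simp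
      | add s t _ _ h₁ h₂ => rw [map_add]; exact Submodule.add_mem _ h₁ h₂
      | smul r t _ h => rw [map_smul]; exact Submodule.smul_mem _ _ h
      | mem b hb =>
        obtain ⟨b', q, rfl⟩ := hb
        let S : Submodule ℂ H.Heisenberg :=
          Submodule.span ℂ {y | ∃ p x, y = right (H.embA p) x}
        let F : A ⊗[ℂ] A →ₗ[ℂ] H.Heisenberg := LinearMap.lTensor A (H.actDualR b')
        have h : ∀ t, F (H.T₂ t) ∈ S := by
          intro t
          induction t with
          | zero => simp
          | add s t h₁ h₂ => simp only [map_add]; exact Submodule.add_mem _ h₁ h₂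
          | tmul x y => exact Submodule.subset_span ⟨y, H.heis x b', rfl⟩
        have := h (H.T₂.symm (a ⊗ₜ q))
        rw [LinearEquiv.apply_symm_apply] at this
        exact this

/-- On the left, `b (x ⊗ b') = ∑ (b₍₁₎ ▷ x) ⊗ b₍₂₎ b'`, where `dualT₁` is surjective and `B ▷ A`
spans `A`. On the right, `B` is spanned by products. -/
theorem embB_nondegenerate : IsNondegenerateHom H.embB := by
  constructor
  · rw [eq_top_iff]
    rintro s -
    induction s using H.heis_induction with
    | hadd s t h₁ h₂ => exact Submodule.add_mem _ h₁ h₂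
    | h a b =>
      have ha := H.act_surjective a
      induction ha using Submodule.span_induction with
      | zero => simp
      | add s t _ _ h₁ h₂ =>
        rw [map_add, LinearMap.add_apply]; exact Submodule.add_mem _ h₁ h₂
      | smul r t _ h =>
        rw [map_smul, LinearMap.smul_apply]; exact Submodule.smul_mem _ _ h
      | mem a ha =>
        obtain ⟨β, x, rfl⟩ := ha
        have h : ∀ t, H.heisSlice x (H.dualT₁ t) ∈
            Submodule.span ℂ {y | ∃ p x, y = left (H.embB p) x} := by
          intro t
          induction t with
          | zero => simp
          | add s t h₁ h₂ => simp only [map_add]; exact Submodule.add_mem _ h₁ h₂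
          | tmul b b' => exact Submodule.subset_span ⟨b, H.heis x b', rfl⟩
        obtain ⟨t, ht⟩ := H.dualT₁_surjective (β ⊗ₜ b)
        have := h t
        rw [ht] at this
        exact this
  · rw [eq_top_iff]
    rintro s -
    induction s using H.heis_induction with
    | hadd s t h₁ h₂ => exact Submodule.add_mem _ h₁ h₂
    | h a b =>
      obtain ⟨t, rfl⟩ := H.dual_mul'_surjective b
      induction t with
      | zero => simp
      | add s t h₁ h₂ =>
        simp only [map_add]
        exact Submodule.add_mem _ h₁ h₂
      | tmul x y => exact Submodule.subset_span ⟨y, H.heis a x, rfl⟩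

end AlgebraicQuantumGroup

/-! ### Non-degenerate homomorphisms and their extensions -/

section Extension

variable {P : Type*} [NonUnitalRing P] [Module ℂ P] [IsScalarTower ℂ P P] [SMulCommClass ℂ P P]
variable {Q : Type*} [NonUnitalRing Q] [Module ℂ Q] [IsScalarTower ℂ Q Q] [SMulCommClass ℂ Q Q]

theorem ofHom_nondegenerate (h : Function.Surjective (LinearMap.mul' ℂ P)) :
    IsNondegenerateHom (ofHom P) := by
  have key : ∀ S : Submodule ℂ P, (∀ x y, x * y ∈ S) → S = ⊤ := by
    intro S hS
    rw [eq_top_iff]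
    rintro p -
    obtain ⟨t, rfl⟩ := h p
    induction t with
    | zero => simp
    | add s t h₁ h₂ => rw [map_add]; exact S.add_mem h₁ h₂
    | tmul x y => exact hS x y
  exact ⟨key _ fun x y => Submodule.subset_span ⟨x, y, rfl⟩,
    key _ fun x y => Submodule.subset_span ⟨y, x, rfl⟩⟩

/-- No scalar case is needed, because scalars are absorbed in the argument of `γ`. -/
theorem IsNondegenerateHom.induction {γ : P →ₙₐ[ℂ] Multiplier Q} (hγ : IsNondegenerateHom γ)
    {p : Q → Prop} (h0 : p 0) (hadd : ∀ x y, p x → p y → p (x + y))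
    (h : ∀ a x, p (left (γ a) x)) (x : Q) : p x := by
  have hx : x ∈ Submodule.span ℂ {y : Q | ∃ p x, y = left (γ p) x} := hγ.1 ▸ Submodule.mem_top
  induction hx using Submodule.closure_induction with
  | zero => exact h0
  | add x y _ _ h₁ h₂ => exact hadd x y h₁ h₂
  | smul_mem r x hx =>
    obtain ⟨a, y, rfl⟩ := hx
    have := h (r • a) y
    rwa [map_smul, left_smul] at this

/-- `(z γ(a)) x = z (γ(a) x)`, and the elements `z γ(a)` span `Q`. -/
theorem IsNondegenerateHom.eq_of_left {γ : P →ₙₐ[ℂ] Multiplier Q} (hγ : IsNondegenerateHom γ)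
    (hQ : IsNondegenerate Q) {x y : Q} (h : ∀ a, left (γ a) x = left (γ a) y) : x = y := by
  refine hQ.eq_of_mul_left fun z => ?_
  have hz : z ∈ Submodule.span ℂ {y : Q | ∃ p x, y = right (γ p) x} := hγ.2 ▸ Submodule.mem_top
  induction hz using Submodule.span_induction with
  | mem z hz =>
    obtain ⟨a, z, rfl⟩ := hz
    rw [central, central, h]
  | zero => simp
  | add x y _ _ h₁ h₂ => rw [add_mul, add_mul, h₁, h₂]
  | smul r x _ h => rw [smul_mul_assoc, smul_mul_assoc, h]

theorem IsNondegenerateHom.eq_of_mul {γ : P →ₙₐ[ℂ] Multiplier Q} (hγ : IsNondegenerateHom γ)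
    (hQ : IsNondegenerate Q) {m n : Multiplier Q} (h : ∀ a, m * γ a = n * γ a) : m = n := by
  refine ext_left hQ fun x => ?_
  induction x using hγ.induction with
  | h0 => simp
  | hadd x y h₁ h₂ => rw [map_add, map_add, h₁, h₂]
  | h a x => rw [← left_mul, h, left_mul]

@[simp] theorem Multiplier.left_zero (x : Q) : left (0 : Multiplier Q) x = 0 := rfl

theorem left_extend (hQ : IsNondegenerate Q) {γ : P →ₙₐ[ℂ] Multiplier Q}
    (hγ : IsNondegenerateHom γ) (m : Multiplier P) (p : P) (x : Q) :
    left (extend γ m) (left (γ p) x) = left (γ (left m p)) x := by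
  rw [← left_mul, (extend_spec hQ hγ m p).1]

end Extension

/-! ### The two formulas and the Heisenberg commutation relations -/

namespace AlgebraicQuantumGroup

variable {A : Type u} [NonUnitalRing A] [Module ℂ A] [IsScalarTower ℂ A A] [SMulCommClass ℂ A A]
variable (H : AlgebraicQuantumGroup A)
variable {C : Type v} [NonUnitalRing C] [Module ℂ C] [IsScalarTower ℂ C C] [SMulCommClass ℂ C C]
variable {jA : A →ₙₐ[ℂ] Multiplier C} {jB : H.Dual →ₙₐ[ℂ] Multiplier C}

@[simp] theorem productMap_heis (a : A) (b : H.Dual) :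
    H.productMap jA jB (H.heis a b) = jA a * jB b := rfl

theorem productMap_embALeft (a : A) (s : H.Heisenberg) :
    H.productMap jA jB (H.embALeft a s) = jA a * H.productMap jA jB s := by
  induction s using H.heis_induction with
  | h p b => rw [embALeft_heis, productMap_heis, productMap_heis, map_mul, mul_assoc]
  | hadd s t h₁ h₂ => simp only [map_add, mul_add, h₁, h₂]

theorem heis_mul (a : A) (b : H.Dual) (s : H.Heisenberg) :
    H.heis a b * s = H.embALeft a (H.embBLeft b s) :=
  H.heis_ext fun x => by
    rw [heisAct_mul, heisAct_embALeft, heisAct_embBLeft, heisAct_heis, LinearMap.mulLeft_apply]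

/-! ### The formula `Δ(a) V = V (a ⊗ 1)` -/

section First

/-- The extension of `jB ⊗ ι` is accessible only on vectors in the range of `jB ⊗ ι`, so the vector
of `C` appears as `jB(b) z` and that of `A` as a product `a x`. -/
theorem slice_left_extend_duality_mul (hC : IsNondegenerate C) (hB : IsNondegenerateHom jB)
    (ω : A →ₗ[ℂ] ℂ) (b : H.Dual) (z : C) (a x : A) :
    slice ω (left (extend (tensorHom jB (ofHom A)) H.duality) (left (jB b) z ⊗ₜ (a * x))) =
      left (jB (slice (ω ∘ₗ LinearMap.mulRight ℂ x) (H.dualityLeft (b ⊗ₜ a)))) z := by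
  have hγ := tensorHom_nondegenerate hB (ofHom_nondegenerate H.mul'_surjective)
  have h := left_extend (hC.tensor H.nondegenerate) hγ H.duality (b ⊗ₜ a) (z ⊗ₜ x)
  have h1 : left (tensorHom jB (ofHom A) (b ⊗ₜ a)) (z ⊗ₜ x) = left (jB b) z ⊗ₜ (a * x) := by
    simp
  rw [h1] at h
  rw [h]
  change slice ω (left (tensorHom jB (ofHom A) (H.dualityLeft (b ⊗ₜ a))) (z ⊗ₜ x)) = _
  generalize H.dualityLeft (b ⊗ₜ a) = t
  induction t with
  | zero =>
    simp only [map_zero]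
    change slice ω 0 = 0
    simp
  | add s t h₁ h₂ => simp only [map_add, left_add, LinearMap.add_apply, h₁, h₂]
  | tmul β α => simp

theorem eval_slice_dualityLeft (ω : A →ₗ[ℂ] ℂ) (b : H.Dual) (a u : A) :
    H.eval (slice ω (H.dualityLeft (b ⊗ₜ a))) u = ω (H.act b u * a) := by
  rw [← sliceAt_dualityLeft]
  exact apply_slice (H.eval.flip u) ω _

/-- `(ι ⊗ φ(y ·))(V(b' z ⊗ c)) = ((b ◁ y) b') z` for `b = φ(· c)`. -/
theorem slice_mulLeft_left_extend_duality (hC : IsNondegenerate C) (hB : IsNondegenerateHom jB)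
    (b' : H.Dual) (z : C) (c y : A) :
    slice (H.φ ∘ₗ LinearMap.mulLeft ℂ y)
      (left (extend (tensorHom jB (ofHom A)) H.duality) (left (jB b') z ⊗ₜ c)) =
      left (jB (H.actMulₗ (H.toDual c ⊗ₜ b') y)) z := by
  obtain ⟨t, rfl⟩ := H.mul'_surjective c
  induction t with
  | zero => simp [left_zero]
  | add s t h₁ h₂ =>
    simp only [map_add, TensorProduct.tmul_add, TensorProduct.add_tmul, LinearMap.add_apply,
      left_add, h₁, h₂]
  | tmul a x =>
    rw [LinearMap.mul'_apply, H.slice_left_extend_duality_mul hC hB]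
    congr 3
    refine H.dual_ext fun u => ?_
    rw [eval_slice_dualityLeft]
    simp [mul_assoc]

/-- `(ι ⊗ φ)(V(z ⊗ c)) = b z` for `b = φ(· c)`. -/
theorem slice_left_extend_duality (hC : IsNondegenerate C) (hB : IsNondegenerateHom jB)
    (z : C) (c : A) :
    slice H.φ (left (extend (tensorHom jB (ofHom A)) H.duality) (z ⊗ₜ c)) =
      left (jB (H.toDual c)) z := by
  induction z using hB.induction with
  | h0 => simp
  | hadd x y h₁ h₂ => simp only [TensorProduct.add_tmul, map_add, h₁, h₂]
  | h b' z =>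
    obtain ⟨t, rfl⟩ := H.mul'_surjective c
    induction t with
    | zero => simp [left_zero]
    | add s t h₁ h₂ =>
      simp only [map_add, TensorProduct.tmul_add, LinearMap.add_apply, left_add, h₁, h₂]
    | tmul a x =>
      rw [LinearMap.mul'_apply, H.slice_left_extend_duality_mul hC hB, ← left_mul, ← map_mul]
      congr 3
      refine H.dual_ext fun u => ?_
      rw [eval_slice_dualityLeft]
      simp [mul_assoc]

theorem tmul_mul_tensorHom (a : A) (p : A ⊗[ℂ] A) :
    tmul (jA a) 1 * tensorHom jA (ofHom A) p =
      tensorHom jA (ofHom A) (LinearMap.rTensor A (LinearMap.mulLeft ℂ a) p) := by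
  induction p with
  | zero => simp
  | add s t h₁ h₂ => simp only [map_add, mul_add, h₁, h₂]
  | tmul x y => simp [tmul_mul_tmul]

/-- `(a' ⊗ 1)Δ(a)` in `M(C ⊗ A)`. -/
theorem tmul_mul_extend_Δ (hC : IsNondegenerate C) (hA : IsNondegenerateHom jA) (a a' : A) :
    tmul (jA a') 1 * extend (tensorHom jA (ofHom A)) (H.Δ a) =
      tensorHom jA (ofHom A) (H.T₂ (a' ⊗ₜ a)) := by
  have hγ := tensorHom_nondegenerate hA (ofHom_nondegenerate H.mul'_surjective)
  have hCA := hC.tensor H.nondegenerate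
  refine hγ.eq_of_mul hCA fun p => ?_
  rw [mul_assoc, (extend_spec hCA hγ (H.Δ a) p).1, tmul_mul_tensorHom, ← map_mul]
  congr 1
  have h := congrArg (fun m => left m p) (H.T₂_spec a' a)
  exact h.symm

/-- The factor `jA(a')` replaces the multiplier `Δ(a)` by the tensor `(a' ⊗ 1)Δ(a)`. Each of its
terms `p ⊗ q` contributes `jA(p) jB((b ◁ q) b') z` with `b = φ(· c)`, as in the product of `AB`. -/
theorem left_slice_left_extend (hC : IsNondegenerate C) (hA : IsNondegenerateHom jA)
    (hB : IsNondegenerateHom jB) (a a' c : A) (b' : H.Dual) (z : C) :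
    left (jA a') (slice H.φ (left (extend (tensorHom jA (ofHom A)) (H.Δ a) *
      extend (tensorHom jB (ofHom A)) H.duality) (left (jB b') z ⊗ₜ c))) =
      left (H.productMap jA jB (H.heis a' (H.toDual c) * H.heis a b')) z := by
  rw [← slice_rTensor]
  have h1 : ∀ w, LinearMap.rTensor A (left (jA a')) w = left (tmul (jA a') 1) w := fun w => rfl
  rw [h1, ← left_mul, ← mul_assoc, H.tmul_mul_extend_Δ hC hA, left_mul, heis_mul_heis]
  generalize H.T₂ (a' ⊗ₜ a) = w
  let F : A ⊗[ℂ] H.Dual →ₗ[ℂ] Multiplier C := H.productMap jA jB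
  change _ = left (F _) z
  have h2 : ∀ (p q : A) (w : C ⊗[ℂ] A), slice H.φ (left (tensorHom jA (ofHom A) (p ⊗ₜ q)) w) =
      left (jA p) (slice (H.φ ∘ₗ LinearMap.mulLeft ℂ q) w) := by
    intro p q w
    induction w with
    | zero => simp
    | add s t h₁ h₂ => simp only [map_add, h₁, h₂]
    | tmul x y => simp
  induction w with
  | zero =>
    simp only [map_zero]
    change slice H.φ 0 = 0
    simp
  | add s t h₁ h₂ => simp only [map_add, left_add, LinearMap.add_apply, h₁, h₂]
  | tmul p q =>
    rw [h2, H.slice_mulLeft_left_extend_duality hC hB]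
    rfl

theorem slice_left_extend (hC : IsNondegenerate C) (hB : IsNondegenerateHom jB) (a c : A) (z : C) :
    slice H.φ (left (extend (tensorHom jB (ofHom A)) H.duality * tmul (jA a) 1) (z ⊗ₜ c)) =
      left (jB (H.toDual c) * jA a) z := by
  rw [left_mul, left_tmul, TensorProduct.map_tmul, left_one, H.slice_left_extend_duality hC hB,
    left_mul]

/-- The left part of `m` commutes with right multiplication by `1 ⊗ c`, so slicing by `φ` at `z ⊗ e
c` is slicing by `φ(· c)` at `z ⊗ e`, and these functionals separate points. -/
theorem multiplier_ext_slice (hC : IsNondegenerate C) {m n : Multiplier (C ⊗[ℂ] A)}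
    (h : ∀ z c, slice H.φ (left m (z ⊗ₜ c)) = slice H.φ (left n (z ⊗ₜ c))) : m = n := by
  have hCA := hC.tensor H.nondegenerate
  have key : ∀ (m : Multiplier (C ⊗[ℂ] A)) (z : C) (e c : A),
      slice (H.eval (H.toDual c)) (left m (z ⊗ₜ e)) = slice H.φ (left m (z ⊗ₜ (e * c))) := by
    intro m z e c
    have h1 := left_right_comm hCA m (tmul 1 (of c)) (z ⊗ₜ e)
    simp only [right_tmul, TensorProduct.map_tmul, right_one, right_of] at h1
    rw [h1]
    exact (slice_lTensor (LinearMap.mulRight ℂ c) H.φ _).symm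
  refine ext_left hCA fun t => ?_
  induction t with
  | zero => simp
  | add s t h₁ h₂ => simp only [map_add, h₁, h₂]
  | tmul z e =>
    refine H.eq_of_slice_eval fun b => ?_
    obtain ⟨c, rfl⟩ := H.toDual_surjective b
    rw [key, key, h]

/-- Slice by `φ` at `jB(b') z ⊗ c`, multiply by `jA(a')`, and put `b = φ(· c)`: the formula becomes
the relation applied to `z`. Conversely these tests determine a multiplier, by
`multiplier_ext_slice` and the non-degeneracy of `jA` and `jB`. -/
theorem firstFormula_iff (hC : IsNondegenerate C) (hA : IsNondegenerateHom jA)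
    (hB : IsNondegenerateHom jB) :
    H.FirstFormula jA jB H.duality ↔ H.HeisenbergRelations jA jB := by
  constructor
  · intro h a a' b b'
    obtain ⟨c, rfl⟩ := H.toDual_surjective b
    refine ext_left hC fun z => ?_
    rw [← H.left_slice_left_extend hC hA hB, h, H.slice_left_extend hC hB]
    simp only [left_mul]
  · intro h a
    refine H.multiplier_ext_slice hC fun z c => ?_
    refine hA.eq_of_left hC fun a' => ?_
    induction z using hB.induction with
    | h0 => simp
    | hadd x y h₁ h₂ => simp only [TensorProduct.add_tmul, map_add, h₁, h₂]
    | h b' z =>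
      rw [H.left_slice_left_extend hC hA hB, ← h, H.slice_left_extend hC hB]
      simp only [left_mul]

end First

/-! ### The formula `V Δ(b) = (1 ⊗ b) V` -/

section Second

/-- Since `(a ⊗ b) s = a (b s)` in `AB`, the relations carry a common left factor `jA(a)`, which
non-degeneracy of `jA` cancels. -/
theorem heisenbergRelations_iff (hC : IsNondegenerate C) (hA : IsNondegenerateHom jA) :
    H.HeisenbergRelations jA jB ↔ ∀ b b' x, H.productMap jA jB (H.embBLeft b (H.heis x b')) =
      jB b * (jA x * jB b') := by
  have key : ∀ a b b' x, H.productMap jA jB (H.heis a b * H.heis x b') =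
      jA a * H.productMap jA jB (H.embBLeft b (H.heis x b')) := by
    intro a b b' x
    rw [heis_mul, productMap_embALeft]
  constructor
  · intro h b b' x
    refine ext_left hC fun z => hA.eq_of_left hC fun a => ?_
    rw [← left_mul, ← key, ← h]
    simp only [left_mul]
  · intro h a x b b'
    rw [key, h]
    simp only [mul_assoc]

/-- `(⟨u, ·⟩ ⊗ ι)(V(b ⊗ z)) = (b ▷ u)z`. -/
theorem sliceAt_left_extend_duality (hC : IsNondegenerate C) (hA : IsNondegenerateHom jA)
    (b : H.Dual) (z : C) (u : A) :
    H.sliceAt u (left (extend (tensorHom (ofHom H.Dual) jA) H.duality) (b ⊗ₜ z)) =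
      left (jA (H.act b u)) z := by
  have hγ := tensorHom_nondegenerate (ofHom_nondegenerate H.dual_mul'_surjective) hA
  induction z using hA.induction with
  | h0 => simp
  | hadd x y h₁ h₂ => simp only [TensorProduct.tmul_add, map_add, h₁, h₂]
  | h a z =>
    obtain ⟨t, rfl⟩ := H.dual_mul'_surjective b
    induction t with
    | zero => simp [left_zero]
    | add s t h₁ h₂ =>
      simp only [map_add, TensorProduct.add_tmul, LinearMap.add_apply, left_add, h₁, h₂]
    | tmul b b₀ =>
      have h := left_extend (H.dual_nondegenerate.tensor hC) hγ H.duality (b ⊗ₜ a) (b₀ ⊗ₜ z)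
      have h1 : left (tensorHom (ofHom H.Dual) jA (b ⊗ₜ a)) (b₀ ⊗ₜ z) =
          (b * b₀) ⊗ₜ left (jA a) z := by
        simp
      rw [h1] at h
      rw [LinearMap.mul'_apply, h, act_mul_apply, ← left_mul, ← map_mul, ← sliceAt_dualityLeft]
      change H.sliceAt u (left (tensorHom (ofHom H.Dual) jA (H.dualityLeft (b ⊗ₜ a)))
        (b₀ ⊗ₜ z)) = _
      generalize H.dualityLeft (b ⊗ₜ a) = t
      induction t with
      | zero =>
        simp only [map_zero]
        change H.sliceAt u 0 = 0
        simp
      | add s t h₁ h₂ => simp only [map_add, left_add, LinearMap.add_apply, h₁, h₂]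
      | tmul β α => simp

/-- Write `Δ(b)(b₁ ⊗ b₂) = ∑ β ⊗ β'`. Pairing the first leg after `V` turns `β` into `jA(β ▷ u)`,
and `∑ (β ▷ u) ⊗ β'` is `b` times `(b₁ ▷ u) ⊗ b₂` in `AB`. The first leg is split into products to
reach the extension. -/
theorem sliceAt_left_extend_coproduct (hC : IsNondegenerate C) (hA : IsNondegenerateHom jA)
    (hB : IsNondegenerateHom jB) (b b₁ b₂ : H.Dual) (z : C) (u : A) :
    H.sliceAt u (left (extend (tensorHom (ofHom H.Dual) jA) H.duality *
      extend (tensorHom (ofHom H.Dual) jB) (H.coproduct b)) (b₁ ⊗ₜ left (jB b₂) z)) =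
      left (H.productMap jA jB (H.embBLeft b (H.heis (H.act b₁ u) b₂))) z := by
  have hγ := tensorHom_nondegenerate (ofHom_nondegenerate H.dual_mul'_surjective) hB
  obtain ⟨t, rfl⟩ := H.dual_mul'_surjective b₁
  induction t with
  | zero =>
    simp only [map_zero, TensorProduct.zero_tmul, LinearMap.zero_apply]
    rfl
  | add s t h₁ h₂ =>
    simp only [map_add, TensorProduct.add_tmul, LinearMap.add_apply, left_add, h₁, h₂]
  | tmul b₁ b₀ =>
    have h := left_extend (H.dual_nondegenerate.tensor hC) hγ (H.coproduct b) (b₁ ⊗ₜ b₂)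
      (b₀ ⊗ₜ z)
    have h1 : left (tensorHom (ofHom H.Dual) jB (b₁ ⊗ₜ b₂)) (b₀ ⊗ₜ z) =
        (b₁ * b₀) ⊗ₜ left (jB b₂) z := by
      simp
    rw [h1] at h
    rw [LinearMap.mul'_apply, left_mul, h, left_coproduct, embBLeft_heis, act_mul_apply,
      ← heisSlice_rTensor_mulRight, ← coproductLeft_tmul]
    generalize H.coproductLeft b (b₁ ⊗ₜ b₂) = t
    induction t with
    | zero =>
      simp only [map_zero]
      change H.sliceAt u (left _ 0) = 0
      simp
    | add s t h₁ h₂ => simp only [map_add, left_add, LinearMap.add_apply, h₁, h₂]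
    | tmul β β' =>
      rw [heisSlice_tmul, productMap_heis, left_mul, tensorHom_tmul, left_tmul,
        TensorProduct.map_tmul, H.sliceAt_left_extend_duality hC hA]
      simp [act_mul_apply]

theorem sliceAt_left_tmul_extend (hC : IsNondegenerate C) (hA : IsNondegenerateHom jA)
    (b b₁ : H.Dual) (z : C) (u : A) :
    H.sliceAt u (left (tmul 1 (jB b) * extend (tensorHom (ofHom H.Dual) jA) H.duality)
      (b₁ ⊗ₜ z)) = left (jB b * jA (H.act b₁ u)) z := by
  have h1 : ∀ w : H.Dual ⊗[ℂ] C, left (tmul 1 (jB b)) w = LinearMap.lTensor H.Dual (left (jB b)) w :=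
    fun w => rfl
  rw [left_mul, h1, sliceAt, lslice_lTensor, left_mul]
  congr 1
  exact H.sliceAt_left_extend_duality hC hA b₁ z u

/-- Evaluated at `b₁ ⊗ jB(b') z` and paired with `u`, the formula becomes the cancelled relation for
`x = b₁ ▷ u`; such `x` span `A`, and the pairings with all `u` separate points. -/
theorem secondFormula_iff (hC : IsNondegenerate C) (hA : IsNondegenerateHom jA)
    (hB : IsNondegenerateHom jB) :
    H.SecondFormula jA jB H.coproduct H.duality ↔ H.HeisenbergRelations jA jB := by
  rw [H.heisenbergRelations_iff hC hA]
  constructor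
  · intro h b b' x
    refine ext_left hC fun z => ?_
    have hx := H.act_surjective x
    induction hx using Submodule.span_induction with
    | mem x hx =>
      obtain ⟨b₁, u, rfl⟩ := hx
      rw [← H.sliceAt_left_extend_coproduct hC hA hB, h, H.sliceAt_left_tmul_extend hC hA]
      simp only [left_mul]
    | zero =>
      simp only [map_zero, LinearMap.zero_apply, mul_zero, zero_mul]
    | add x y _ _ h₁ h₂ =>
      simp only [map_add, LinearMap.add_apply, left_add, add_mul, mul_add, h₁, h₂]
    | smul r x _ h =>
      simp only [map_smul, LinearMap.smul_apply, left_smul, smul_mul_assoc, mul_smul_comm, h]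
  · intro h b
    refine ext_left (H.dual_nondegenerate.tensor hC) fun t => ?_
    induction t with
    | zero => simp
    | add s t h₁ h₂ => simp only [map_add, h₁, h₂]
    | tmul b₁ z =>
      refine H.eq_of_sliceAt fun u => ?_
      induction z using hB.induction with
      | h0 => simp
      | hadd x y h₁ h₂ => simp only [TensorProduct.tmul_add, map_add, h₁, h₂]
      | h b' z =>
        rw [H.sliceAt_left_extend_coproduct hC hA hB, h, H.sliceAt_left_tmul_extend hC hA]
        simp only [left_mul]

end Second

/-- Here `productMap` is the inclusion of `AB` in `M(AB)`, so the relations express its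
multiplicativity. -/
theorem heisenbergRelations_emb : H.HeisenbergRelations H.embA H.embB := by
  have h : ∀ s, H.productMap H.embA H.embB s = ofHom H.Heisenberg s := by
    intro s
    induction s using H.heis_induction with
    | h a b => exact H.embA_mul_embB a b
    | hadd s t h₁ h₂ => rw [map_add, map_add, h₁, h₂]
  intro a a' b b'
  rw [h, map_mul, ofHom_apply, ofHom_apply, ← embA_mul_embB, ← embA_mul_embB]
  simp only [mul_assoc]

end AlgebraicQuantumGroup

end MultiplierHopf

end

/-! ### The proposition -/

theorem proposition3p15 {A : Type*} [NonUnitalRing A] [Module ℂ A] [IsScalarTower ℂ A A]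
    [SMulCommClass ℂ A A] (H : MultiplierHopf.AlgebraicQuantumGroup A) :
    -- the algebras `B` and `AB` are non-degenerate
    MultiplierHopf.IsNondegenerate H.Dual ∧ MultiplierHopf.IsNondegenerate H.Heisenberg ∧
    -- the coproduct of `B`, the duality `V` and the embeddings of `A` and `B` in `M(AB)`
    (∃! ΔB, H.IsDualCoproduct ΔB) ∧
    (∃! V, H.IsDuality V) ∧
    (∃! j : (A →ₙₐ[ℂ] MultiplierHopf.Multiplier H.Heisenberg) ×
        (H.Dual →ₙₐ[ℂ] MultiplierHopf.Multiplier H.Heisenberg),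
      H.IsHeisenbergEmbedding j.1 j.2) ∧
    ∀ ΔB, H.IsDualCoproduct ΔB → ∀ V, H.IsDuality V →
      -- the two formulas in `M(AB ⊗ A)` and in `M(B ⊗ AB)`
      (∀ jA jB, H.IsHeisenbergEmbedding jA jB →
        MultiplierHopf.IsNondegenerateHom jA ∧ MultiplierHopf.IsNondegenerateHom jB ∧
        (∀ a b, jA a * jB b = MultiplierHopf.Multiplier.of (H.heis a b)) ∧
        H.FirstFormula jA jB V ∧ H.SecondFormula jA jB ΔB V) ∧
      -- the equivalence with the Heisenberg commutation relations
      (∀ (C : Type*) [NonUnitalRing C] [Module ℂ C] [IsScalarTower ℂ C C] [SMulCommClass ℂ C C]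
        (jA : A →ₙₐ[ℂ] MultiplierHopf.Multiplier C)
        (jB : H.Dual →ₙₐ[ℂ] MultiplierHopf.Multiplier C),
        MultiplierHopf.IsNondegenerate C →
        MultiplierHopf.IsNondegenerateHom jA → MultiplierHopf.IsNondegenerateHom jB →
        (H.FirstFormula jA jB V ↔ H.HeisenbergRelations jA jB) ∧
        (H.SecondFormula jA jB ΔB V ↔ H.HeisenbergRelations jA jB)) := by
  refine ⟨H.dual_nondegenerate, H.heisenberg_nondegenerate,
    ⟨H.coproduct, (H.isDualCoproduct_iff _).2 rfl, fun _ h => (H.isDualCoproduct_iff _).1 h⟩,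
    ⟨H.duality, (H.isDuality_iff _).2 rfl, fun _ h => (H.isDuality_iff _).1 h⟩,
    ⟨(H.embA, H.embB), (H.isHeisenbergEmbedding_iff _ _).2 ⟨rfl, rfl⟩,
      fun _ h => Prod.ext_iff.2 ((H.isHeisenbergEmbedding_iff _ _).1 h)⟩, ?_⟩
  intro ΔB hΔB V hV
  obtain rfl := (H.isDualCoproduct_iff _).1 hΔB
  obtain rfl := (H.isDuality_iff _).1 hV
  refine ⟨fun jA jB hj => ?_, fun C _ _ _ _ jA jB hC hA hB =>
    ⟨H.firstFormula_iff hC hA hB, H.secondFormula_iff hC hA hB⟩⟩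
  obtain ⟨rfl, rfl⟩ := (H.isHeisenbergEmbedding_iff _ _).1 hj
  exact ⟨H.embA_nondegenerate, H.embB_nondegenerate, H.embA_mul_embB,
    (H.firstFormula_iff H.heisenberg_nondegenerate H.embA_nondegenerate
      H.embB_nondegenerate).2 H.heisenbergRelations_emb,
    (H.secondFormula_iff H.heisenberg_nondegenerate H.embA_nondegenerate
      H.embB_nondegenerate).2 H.heisenbergRelations_emb⟩
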